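/- Let $n\ge 1$, $T>0$, $\mathbb{T}^n=\mathbb{R}^n/\mathbb{Z}^n$ and $Q_T=\mathbb{T}^n\times(0,T)$. Let $b\in L^1(0,T;L^2(\mathbb{T}^n;\mathbb{R}^n))$ be a vector field whose distributional divergence in space satisfies $$\mathrm{div}(b)\in L^r(0,T;L^q(\mathbb{T}^n)),\qquad \frac{n}{2q}+\frac1r\le 1,$$ where $r\in[1,\infty)$ and $q\in(n/2,\infty]$ if $n\ge2$, and $r\in[1,2]$ and $q\in[1,\infty]$ if $n=1$ (with $\frac{n}{2q}=0$ for $q=\infty$). Let $\rho_0\in L^2(\mathbb{T}^n)$, and let $$\mathcal{H}_2^1(Q_T)=\{u\in L^2(0,T;H^1(\mathbb{T}^n)):\ \partial_t u\in L^2(0,T;H^{-1}(\mathbb{T}^n))\}.$$ A function $\rho\in\mathcal{H}_2^1(Q_T)$ is called a solution of the Fokker–Planck problem $$\partial_t\rho-\Delta\rho+\mathrm{div}(b\rho)=0\ \text{ in } Q_T,\qquad \rho(\cdot,0)=\rho_0\ \text{ in }\mathbb{T}^n,$$ if $b\rho\in L^1(Q_T)$ and $$-\iint_{Q_T}\rho\,\partial_t\varphi\,dx\,dt+\iint_{Q_T}D\rho\cdot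 D\varphi\,dx\,dt-\iint_{Q_T}\rho\,b\cdot D\varphi\,dx\,dt=\int_{\mathbb{T}^n}\rho_0\,\varphi(\cdot,0)\,dx$$ for every smooth $\varphi:\mathbb{T}^n\times\mathbb{R}\to\mathbb{R}$ that vanishes for all $t\ge\tau$, for some $\tau<T$. Then a solution in $\mathcal{H}_2^1(Q_T)$, if it exists, is unique: any two solutions with the same $\rho_0$ coincide almost everywhere in $Q_T$. -/

import Mathlib

open MeasureTheory Set Function
open scoped ENNReal ContDiff

namespace FokkerPlanck

noncomputable section

/-- The flat torus `ℝⁿ / ℤⁿ`; its `volume` is the Haar (Lebesgue) measure of total mass one. -/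
abbrev Torus (n : ℕ) : Type := UnitAddTorus (Fin n)

/-- The projection `ℝⁿ → ℝⁿ / ℤⁿ`. -/
def proj {n : ℕ} (y : Fin n → ℝ) : Torus n := fun i => (y i : UnitAddCircle)

/-- The partial derivative `∂ᵢ f (x)`, i.e. the derivative of `s ↦ f (x + s eᵢ)` at `s = 0`. -/
def partialDeriv {n : ℕ} (i : Fin n) (f : Torus n → ℝ) (x : Torus n) : ℝ :=
  deriv (fun s : ℝ => f (x + proj (Pi.single i s))) 0

/-- The space `C^∞(𝕋ⁿ)`: functions whose periodic lift to `ℝⁿ` is smooth. -/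
def smoothFun (n : ℕ) : Submodule ℝ (Torus n → ℝ) where
  carrier := {ψ | ContDiff ℝ ∞ (fun y : Fin n → ℝ => ψ (proj y))}
  add_mem' := by
    intro a c ha hc
    simp only [mem_ofPred_eq] at ha hc
    exact ha.add hc
  zero_mem' := by
    simp only [mem_ofPred_eq, Pi.zero_apply]
    exact contDiff_const
  smul_mem' := by
    intro c a ha
    simp only [mem_ofPred_eq] at ha
    exact contDiff_const.mul ha

/-- The norm of `H¹(𝕋ⁿ)`, on smooth functions. -/
def h1Norm {n : ℕ} (ψ : smoothFun n) : ℝ :=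
  Real.sqrt ((∫ x, (ψ : Torus n → ℝ) x ^ 2) + ∑ i, ∫ x, partialDeriv i (ψ : Torus n → ℝ) x ^ 2)

/-- The product of Lebesgue measure on `(0,T)` and on the torus: the measure of `Q_T`. -/
def cylinder (n : ℕ) (T : ℝ) : Measure (ℝ × Torus n) :=
  (volume.restrict (Ioo 0 T)).prod volume

/-- `g ∈ L^r(0,T; L^q(𝕋ⁿ))`. -/
def MemMixedLp {n : ℕ} {E : Type*} [NormedAddCommGroup E]
    (r q : ℝ≥0∞) (T : ℝ) (g : ℝ → Torus n → E) : Prop :=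
  AEStronglyMeasurable (uncurry g) (cylinder n T) ∧
    eLpNorm (fun t => eLpNorm (g t) q volume) r (volume.restrict (Ioo 0 T)) < ⊤

/-- `G` is the weak gradient of `u` on the torus. -/
def IsWeakGradient {n : ℕ} (u : Torus n → ℝ) (G : Torus n → EuclideanSpace ℝ (Fin n)) : Prop :=
  ∀ ψ : smoothFun n, ∀ i, ∫ x, u x * partialDeriv i (ψ : Torus n → ℝ) x = -∫ x, G x i * (ψ : Torus n → ℝ) x

/-- `g` is the distributional divergence of the vector field `b` on the torus. -/
def IsWeakDivergence {n : ℕ} (b : Torus n → EuclideanSpace ℝ (Fin n)) (g : Torus n → ℝ) : Prop :=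
  ∀ ψ : smoothFun n, ∫ x, ∑ i, b x i * partialDeriv i (ψ : Torus n → ℝ) x = -∫ x, g x * (ψ : Torus n → ℝ) x

/-- `u ∈ L²(0,T; H¹(𝕋ⁿ))`, with spatial gradient `G`. -/
def IsL2H1 {n : ℕ} (T : ℝ) (u : ℝ → Torus n → ℝ)
    (G : ℝ → Torus n → EuclideanSpace ℝ (Fin n)) : Prop :=
  MemLp (uncurry u) 2 (cylinder n T) ∧ MemLp (uncurry G) 2 (cylinder n T) ∧
    ∀ᵐ t ∂(volume.restrict (Ioo 0 T)), IsWeakGradient (u t) (G t)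

/-- `v ∈ L²(0,T; H⁻¹(𝕋ⁿ))`. As `C^∞(𝕋ⁿ)` is dense in `H¹(𝕋ⁿ)`, an element of the dual `H⁻¹(𝕋ⁿ)`
is a linear functional on `C^∞(𝕋ⁿ)` that is bounded for the norm of `H¹(𝕋ⁿ)`. -/
def IsL2HNegOne {n : ℕ} (T : ℝ) (v : ℝ → smoothFun n →ₗ[ℝ] ℝ) : Prop :=
  (∀ ψ, AEMeasurable (fun t => v t ψ) (volume.restrict (Ioo 0 T))) ∧
    ∃ N : ℝ → ℝ, MemLp N 2 (volume.restrict (Ioo 0 T)) ∧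
      ∀ᵐ t ∂(volume.restrict (Ioo 0 T)), ∀ ψ, |v t ψ| ≤ N t * h1Norm ψ

/-- `v` is the weak time derivative of `u` on `(0,T)`, as a functional-valued function:
`∫ θ' u dt = -∫ θ v dt` for all `θ ∈ C_c^∞(0,T)`. -/
def IsWeakTimeDeriv {n : ℕ} (T : ℝ) (u : ℝ → Torus n → ℝ)
    (v : ℝ → smoothFun n →ₗ[ℝ] ℝ) : Prop :=
  ∀ θ : ℝ → ℝ, ContDiff ℝ ∞ θ → HasCompactSupport θ → tsupport θ ⊆ Ioo 0 T →
    ∀ ψ : smoothFun n,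
      ∫ t in Ioo 0 T, deriv θ t * ∫ x, u t x * (ψ : Torus n → ℝ) x
        = -∫ t in Ioo 0 T, θ t * v t ψ

/-- The parabolic class: `u ∈ L²(0,T; H¹(𝕋ⁿ))` and `∂ₜ u ∈ L²(0,T; H⁻¹(𝕋ⁿ))`. -/
def MemParabolicClass {n : ℕ} (T : ℝ) (u : ℝ → Torus n → ℝ) : Prop :=
  (∃ G, IsL2H1 T u G) ∧ ∃ v, IsL2HNegOne T v ∧ IsWeakTimeDeriv T u v

/-- Test functions: smooth functions on `ℝ × 𝕋ⁿ` that vanish for times near and after `T`. -/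
def IsTestFun {n : ℕ} (T : ℝ) (φ : ℝ → Torus n → ℝ) : Prop :=
  ContDiff ℝ ∞ (fun p : ℝ × (Fin n → ℝ) => φ p.1 (proj p.2)) ∧
    ∃ τ < T, ∀ t, τ ≤ t → ∀ x, φ t x = 0

/-- `ρ`, in the parabolic class, is a weak solution of `∂ₜρ - Δρ + div(bρ) = 0` in `𝕋ⁿ × (0,T)`
with `ρ(·,0) = ρ₀`. -/
def IsSolution {n : ℕ} (T : ℝ) (b : ℝ → Torus n → EuclideanSpace ℝ (Fin n))
    (ρ₀ : Torus n → ℝ) (ρ : ℝ → Torus n → ℝ) : Prop :=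
  MemParabolicClass T ρ ∧
    Integrable (fun z : ℝ × Torus n => ρ z.1 z.2 • b z.1 z.2) (cylinder n T) ∧
    ∃ Dρ, IsL2H1 T ρ Dρ ∧
      ∀ φ, IsTestFun T φ →
        -(∫ z, ρ z.1 z.2 * deriv (fun s => φ s z.2) z.1 ∂(cylinder n T))
          + (∫ z, ∑ i, Dρ z.1 z.2 i * partialDeriv i (φ z.1) z.2 ∂(cylinder n T))
          - (∫ z, ρ z.1 z.2 * ∑ i, b z.1 z.2 i * partialDeriv i (φ z.1) z.2 ∂(cylinder n T))
        = ∫ x, ρ₀ x * φ 0 x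

/-- The conditions on the exponents `r` and `q` in dimension `n`. -/
def AdmissibleExponents (n : ℕ) (r q : ℝ≥0∞) : Prop :=
  (n : ℝ≥0∞) / (2 * q) + 1 / r ≤ 1 ∧
    ((2 ≤ n ∧ 1 ≤ r ∧ r < ⊤ ∧ (n : ℝ≥0∞) / 2 < q) ∨ (n = 1 ∧ 1 ≤ r ∧ r ≤ 2 ∧ 1 ≤ q))

end

end FokkerPlanck

namespace FokkerPlanck

noncomputable section

variable {n : ℕ}

/-! The difference `u` of two solutions solves the equation with zero initial datum. It cannot
simply be tested with itself, since `u b · Du` need not be integrable on the cylinder. The test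
function is S'(u) instead, with the entropy S(s) = s arctan s / 2, whose derivative is bounded and
Lipschitz. Formally, d/dt ∫ S(u) = -∫ S''(u) |Du|² + ∫ u b · D(S'(u)). At almost every time b · Du +
u div b is integrable, so the last term is -∫ (b · Du + u div b) S'(u), and since S'(u) Du = D(S(u))
it equals ∫ div b (S(u) - u S'(u)).

Put w = arctan u. The entropy is chosen so that S''(u) |Du|² = |Dw|², |S(u) - u S'(u)| ≤ w²/2 and w²
≤ 2 S(u). Hence 2 d/dt ∫ S(u) ≤ -2 ∫ |Dw|² + ∫ |div b| w². With θ = n/(2q) < 1, Gagliardo–Nirenberg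
and Young give ∫ |div b| w² ≤ κ(t) ∫ w² + ∫ |Dw|², where κ is a multiple of ‖div b‖_q^(1/(1-θ)) + 1.
The condition on r and q says that 1/(1-θ) ≤ r, so κ is integrable. Integration in time gives ∫
w²(t) ≤ ∫₀ᵗ κ ∫ w², and Grönwall's lemma gives w = 0. These estimates are `HasGN.hasFormBound`,
`exists_limit_le` and `ae_eq_zero_of_le_integral`.

To justify the computation, `u` is convolved in space with trigonometric kernels k(x - y) = Σ φⱼ(x)
ψⱼ(y). The regularized function involves only finitely many moments of `u`, which are absolutely
continuous in time, so the ordinary chain rule applies (`IsWeakSolution.entropy_avg_eq`). At a fixed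
time the regularization is removed by convergence in `H¹`. Under the time integral the limit is
dominated: the equation's flux pairing coincides with ∂ₜu, and ∂ₜu ∈ L²(H⁻¹) bounds it by N(t)
‖u(t)‖_{H¹} uniformly in the kernel (`IsWeakSolution.abs_fluxPairing_testFun_le`). -/

instance : IsProbabilityMeasure (volume : Measure UnitAddCircle) :=
  ⟨UnitAddCircle.measure_univ⟩

instance : IsProbabilityMeasure (volume : Measure (Torus n)) := by
  unfold Torus UnitAddTorus; infer_instance

instance : (volume : Measure (Torus n)).IsAddHaarMeasure := by
  unfold Torus UnitAddTorus; infer_instance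

/-! ### Smooth functions on the torus -/

lemma proj_add (y z : Fin n → ℝ) : proj (y + z) = proj y + proj z := by
  funext i; simp [proj]

@[simp] lemma proj_zero : proj (0 : Fin n → ℝ) = 0 := by
  funext i; simp [proj]

lemma isOpenQuotientMap_proj : IsOpenQuotientMap (proj : (Fin n → ℝ) → Torus n) :=
  IsOpenQuotientMap.piMap (fun _ => QuotientAddGroup.isOpenQuotientMap_mk)

lemma proj_surjective : Surjective (proj : (Fin n → ℝ) → Torus n) :=
  isOpenQuotientMap_proj.surjective

lemma continuous_proj : Continuous (proj : (Fin n → ℝ) → Torus n) :=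
  isOpenQuotientMap_proj.continuous

lemma smoothFun.contDiff (ψ : smoothFun n) :
    ContDiff ℝ ∞ (fun y : Fin n → ℝ => (ψ : Torus n → ℝ) (proj y)) := ψ.2

lemma smoothFun.continuous (ψ : smoothFun n) : Continuous (ψ : Torus n → ℝ) :=
  isOpenQuotientMap_proj.isQuotientMap.continuous_iff.2 (smoothFun.contDiff ψ).continuous

lemma smoothFun.hasDerivAt (ψ : smoothFun n) (i : Fin n) (y : Fin n → ℝ) (s : ℝ) :
    HasDerivAt (fun s : ℝ => (ψ : Torus n → ℝ) (proj y + proj (Pi.single i s)))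
      (fderiv ℝ (fun y : Fin n → ℝ => (ψ : Torus n → ℝ) (proj y)) (y + Pi.single i s)
        (Pi.single i 1)) s := by
  have h1 : HasDerivAt (fun s : ℝ => y + Pi.single i s) (Pi.single i (1 : ℝ)) s := by
    refine HasDerivAt.const_add y (hasDerivAt_pi.2 fun j => ?_)
    by_cases hj : j = i
    · subst hj; simpa using hasDerivAt_id' s
    · simpa [hj] using hasDerivAt_const s (0 : ℝ)
  have h2 := ((smoothFun.contDiff ψ).differentiable (by simp) (y + Pi.single i s)).hasFDerivAt
  have := h2.comp_hasDerivAt s h1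
  simpa [Function.comp_def, proj_add] using this

lemma partialDeriv_proj (ψ : smoothFun n) (i : Fin n) (y : Fin n → ℝ) :
    partialDeriv i (ψ : Torus n → ℝ) (proj y) =
      fderiv ℝ (fun y : Fin n → ℝ => (ψ : Torus n → ℝ) (proj y)) y (Pi.single i 1) := by
  simpa [partialDeriv] using (smoothFun.hasDerivAt ψ i y 0).deriv

/-- The partial derivative of a smooth function, as a smooth function. -/
def smoothFun.pderiv (i : Fin n) (ψ : smoothFun n) : smoothFun n :=
  ⟨partialDeriv i (ψ : Torus n → ℝ), by
    show ContDiff ℝ ∞ _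
    simp only [partialDeriv_proj]
    exact ((smoothFun.contDiff ψ).fderiv_right (m := ∞) (by simp)).clm_apply contDiff_const⟩

@[simp] lemma smoothFun.coe_pderiv (i : Fin n) (ψ : smoothFun n) :
    (smoothFun.pderiv i ψ : Torus n → ℝ) = partialDeriv i (ψ : Torus n → ℝ) := rfl

lemma smoothFun.hasDerivAt_line (ψ : smoothFun n) (i : Fin n) (x : Torus n) (s : ℝ) :
    HasDerivAt (fun s : ℝ => (ψ : Torus n → ℝ) (x + proj (Pi.single i s)))
      (partialDeriv i (ψ : Torus n → ℝ) (x + proj (Pi.single i s))) s := by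
  obtain ⟨y, rfl⟩ := proj_surjective x
  rw [← proj_add, partialDeriv_proj]
  exact smoothFun.hasDerivAt ψ i y s

lemma smoothFun.hasDerivAt_line_zero (ψ : smoothFun n) (i : Fin n) (x : Torus n) :
    HasDerivAt (fun s : ℝ => (ψ : Torus n → ℝ) (x + proj (Pi.single i s)))
      (partialDeriv i (ψ : Torus n → ℝ) x) 0 := by
  simpa using smoothFun.hasDerivAt_line ψ i x 0

lemma smoothFun.continuous_partialDeriv (ψ : smoothFun n) (i : Fin n) :
    Continuous (partialDeriv i (ψ : Torus n → ℝ)) :=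
  smoothFun.continuous (smoothFun.pderiv i ψ)

lemma memLp_of_continuous {f : Torus n → ℝ} (hf : Continuous f) (p : ℝ≥0∞) : MemLp f p volume := by
  obtain ⟨C, hC⟩ := isCompact_univ.exists_bound_of_continuousOn hf.continuousOn
  exact MemLp.of_bound hf.aestronglyMeasurable C (.of_forall fun x => hC x trivial)

lemma integrable_of_continuous {f : Torus n → ℝ} (hf : Continuous f) : Integrable f volume :=
  memLp_one_iff_integrable.1 (memLp_of_continuous hf 1)

lemma smoothFun.memLp (ψ : smoothFun n) (p : ℝ≥0∞) : MemLp (ψ : Torus n → ℝ) p volume :=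
  memLp_of_continuous (smoothFun.continuous ψ) p

lemma smoothFun.memLp_partialDeriv (ψ : smoothFun n) (i : Fin n) (p : ℝ≥0∞) :
    MemLp (partialDeriv i (ψ : Torus n → ℝ)) p volume :=
  memLp_of_continuous (smoothFun.continuous_partialDeriv ψ i) p

/-- Composition of a smooth function on the torus with a smooth function on the line. -/
def smoothFun.comp (γ : ℝ → ℝ) (hγ : ContDiff ℝ ∞ γ) (ψ : smoothFun n) : smoothFun n :=
  ⟨fun x => γ ((ψ : Torus n → ℝ) x), hγ.comp (smoothFun.contDiff ψ)⟩

@[simp] lemma smoothFun.coe_comp (γ : ℝ → ℝ) (hγ : ContDiff ℝ ∞ γ) (ψ : smoothFun n)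
    (x : Torus n) : (smoothFun.comp γ hγ ψ : Torus n → ℝ) x = γ ((ψ : Torus n → ℝ) x) := rfl

lemma smoothFun.partialDeriv_comp (γ : ℝ → ℝ) (hγ : ContDiff ℝ ∞ γ) (ψ : smoothFun n)
    (i : Fin n) (x : Torus n) :
    partialDeriv i (smoothFun.comp γ hγ ψ : Torus n → ℝ) x =
      deriv γ ((ψ : Torus n → ℝ) x) * partialDeriv i (ψ : Torus n → ℝ) x := by
  have h1 := smoothFun.hasDerivAt_line_zero ψ i x
  have h2 := ((hγ.differentiable (by simp)) ((ψ : Torus n → ℝ) x))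
  exact (HasDerivAt.comp (h₂ := γ) (0 : ℝ) (by simpa using h2.hasDerivAt) h1).deriv

/-- The product of two smooth functions. -/
def smoothFun.mul (ψ φ : smoothFun n) : smoothFun n :=
  ⟨fun x => (ψ : Torus n → ℝ) x * (φ : Torus n → ℝ) x, ContDiff.mul (smoothFun.contDiff ψ) (smoothFun.contDiff φ)⟩

@[simp] lemma smoothFun.coe_mul (ψ φ : smoothFun n) (x : Torus n) :
    (smoothFun.mul ψ φ : Torus n → ℝ) x = (ψ : Torus n → ℝ) x * (φ : Torus n → ℝ) x := rfl

lemma smoothFun.partialDeriv_mul (ψ φ : smoothFun n) (i : Fin n) (x : Torus n) :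
    partialDeriv i (smoothFun.mul ψ φ : Torus n → ℝ) x =
      partialDeriv i (ψ : Torus n → ℝ) x * (φ : Torus n → ℝ) x +
        (ψ : Torus n → ℝ) x * partialDeriv i (φ : Torus n → ℝ) x := by
  simpa [partialDeriv, Pi.mul_def] using ((smoothFun.hasDerivAt_line_zero ψ i x).mul (smoothFun.hasDerivAt_line_zero φ i x)).deriv

lemma smoothFun.partialDeriv_sum {J : Type*} [Fintype J] (c : J → ℝ) (φ : J → smoothFun n)
    (i : Fin n) (x : Torus n) :
    partialDeriv i ((∑ j, c j • φ j : smoothFun n) : Torus n → ℝ) x =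
      ∑ j, c j * partialDeriv i (φ j : Torus n → ℝ) x := by
  have h := HasDerivAt.fun_sum (u := Finset.univ)
    (fun j _ => (smoothFun.hasDerivAt_line_zero (φ j) i x).const_mul (c j))
  rw [← h.deriv]
  simp [partialDeriv, Finset.sum_apply]

lemma smoothFun.sum_apply {J : Type*} [Fintype J] (c : J → ℝ) (φ : J → smoothFun n)
    (x : Torus n) :
    ((∑ j, c j • φ j : smoothFun n) : Torus n → ℝ) x = ∑ j, c j * (φ j : Torus n → ℝ) x := by
  simp [Finset.sum_apply]

/-! ### Smoothing kernels of finite rank -/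

/-- A function of two variables on the torus that is a finite sum of products of smooth functions
of one variable. -/
def IsSeparable (k : Torus n → Torus n → ℝ) : Prop :=
  ∃ (J : Type) (_ : Fintype J) (φ ψ : J → smoothFun n),
    ∀ x y, k x y = ∑ j, (φ j : Torus n → ℝ) x * (ψ j : Torus n → ℝ) y

lemma IsSeparable.mul_fun (φ ψ : smoothFun n) :
    IsSeparable (fun x y => (φ : Torus n → ℝ) x * (ψ : Torus n → ℝ) y) :=
  ⟨Unit, inferInstance, fun _ => φ, fun _ => ψ, by simp⟩

lemma IsSeparable.const (c : ℝ) : IsSeparable (fun _ _ : Torus n => c) := by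
  have h (a : ℝ) : (fun _ => a) ∈ smoothFun n := by
    show ContDiff ℝ ∞ _
    exact contDiff_const
  simpa using IsSeparable.mul_fun ⟨fun _ => c, h c⟩ ⟨fun _ => 1, h 1⟩

lemma IsSeparable.add {k l : Torus n → Torus n → ℝ} (hk : IsSeparable k) (hl : IsSeparable l) :
    IsSeparable (fun x y => k x y + l x y) := by
  obtain ⟨J, _, φ, ψ, h⟩ := hk
  obtain ⟨J', _, φ', ψ', h'⟩ := hl
  exact ⟨J ⊕ J', inferInstance, Sum.elim φ φ', Sum.elim ψ ψ', by simp [h, h']⟩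

lemma IsSeparable.mul {k l : Torus n → Torus n → ℝ} (hk : IsSeparable k) (hl : IsSeparable l) :
    IsSeparable (fun x y => k x y * l x y) := by
  obtain ⟨J, _, φ, ψ, h⟩ := hk
  obtain ⟨J', _, φ', ψ', h'⟩ := hl
  refine ⟨J × J', inferInstance, fun p => smoothFun.mul (φ p.1) (φ' p.2),
    fun p => smoothFun.mul (ψ p.1) (ψ' p.2), fun x y => ?_⟩
  simp only [h, h']
  rw [Finset.sum_mul_sum, Fintype.sum_prod_type]
  refine Finset.sum_congr rfl fun _ _ => Finset.sum_congr rfl fun _ _ => ?_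
  simp only [smoothFun.coe_mul]; ring

lemma IsSeparable.pow {k : Torus n → Torus n → ℝ} (hk : IsSeparable k) (m : ℕ) :
    IsSeparable (fun x y => k x y ^ m) := by
  induction m with
  | zero => simpa using IsSeparable.const (n := n) 1
  | succ m ih => simpa [pow_succ] using ih.mul hk

lemma IsSeparable.prod {ι : Type*} (s : Finset ι) {k : ι → Torus n → Torus n → ℝ}
    (hk : ∀ i, IsSeparable (k i)) : IsSeparable (fun x y => ∏ i ∈ s, k i x y) := by
  classical
  induction s using Finset.induction_on with
  | empty => simpa using IsSeparable.const (n := n) 1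
  | insert a s ha ih => simpa [Finset.prod_insert ha] using (hk a).mul ih

/-- The function `cos (2 π xᵢ)` on the torus. -/
def cosCoord (i : Fin n) : smoothFun n :=
  ⟨fun x => (fourier 1 (x i) : ℂ).re, by
    show ContDiff ℝ ∞ _
    simp only [proj, fourier_coe_apply]
    apply Complex.reCLM.contDiff.comp
    apply ContDiff.cexp
    have : ContDiff ℝ ∞ fun y : Fin n → ℝ => ((y i : ℝ) : ℂ) :=
      Complex.ofRealCLM.contDiff.comp (contDiff_apply ℝ ℝ i)
    fun_prop⟩

/-- The function `sin (2 π xᵢ)` on the torus. -/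
def sinCoord (i : Fin n) : smoothFun n :=
  ⟨fun x => (fourier 1 (x i) : ℂ).im, by
    show ContDiff ℝ ∞ _
    simp only [proj, fourier_coe_apply]
    apply Complex.imCLM.contDiff.comp
    apply ContDiff.cexp
    have : ContDiff ℝ ∞ fun y : Fin n → ℝ => ((y i : ℝ) : ℂ) :=
      Complex.ofRealCLM.contDiff.comp (contDiff_apply ℝ ℝ i)
    fun_prop⟩

lemma cosCoord_apply (i : Fin n) (x : Torus n) :
    (cosCoord i : Torus n → ℝ) x = (AddCircle.toCircle (x i) : ℂ).re := by
  show (fourier 1 (x i) : ℂ).re = _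
  rw [fourier_one]

lemma cosCoord_sub (i : Fin n) (x y : Torus n) :
    (cosCoord i : Torus n → ℝ) (x - y) =
      (cosCoord i : Torus n → ℝ) x * (cosCoord i : Torus n → ℝ) y +
        (sinCoord i : Torus n → ℝ) x * (sinCoord i : Torus n → ℝ) y := by
  simp [cosCoord, sinCoord, sub_eq_add_neg, AddCircle.toCircle_add,
    AddCircle.toCircle_neg]

lemma cosCoord_le_one (i : Fin n) (x : Torus n) : (cosCoord i : Torus n → ℝ) x ≤ 1 := by
  rw [cosCoord_apply]
  exact (Complex.re_le_norm _).trans (Circle.norm_coe _).le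

lemma neg_one_le_cosCoord (i : Fin n) (x : Torus n) : -1 ≤ (cosCoord i : Torus n → ℝ) x := by
  rw [cosCoord_apply]
  have := Complex.abs_re_le_norm (AddCircle.toCircle (x i) : ℂ)
  simp only [Circle.norm_coe] at this
  linarith [neg_abs_le (AddCircle.toCircle (x i) : ℂ).re]

lemma eq_zero_of_cosCoord_eq_one {i : Fin n} {x : Torus n}
    (h : (cosCoord i : Torus n → ℝ) x = 1) : x i = 0 := by
  rw [cosCoord_apply] at h
  have h1 : (AddCircle.toCircle (x i) : ℂ) = 1 := by
    have h2 := Complex.sq_norm (AddCircle.toCircle (x i) : ℂ)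
    rw [Complex.normSq_apply, h] at h2
    simp only [Circle.norm_coe] at h2
    apply Complex.ext
    · simpa using h
    · have : (AddCircle.toCircle (x i) : ℂ).im * (AddCircle.toCircle (x i) : ℂ).im = 0 := by
        linarith
      simpa using this
  apply AddCircle.injective_toCircle one_ne_zero
  rw [AddCircle.toCircle_zero]
  exact Circle.ext (by simpa using h1)

/-- A continuous function on the torus with values in `[0,1]` whose only maximum is at `0`. -/
def peakFun (x : Torus n) : ℝ := ∏ i : Fin n, (1 + (cosCoord i : Torus n → ℝ) x) / 2

lemma continuous_peakFun : Continuous (peakFun : Torus n → ℝ) :=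
  continuous_finsetProd _ fun i _ => by
    have := smoothFun.continuous (cosCoord i)
    fun_prop

lemma peakFun_nonneg (x : Torus n) : 0 ≤ peakFun x :=
  Finset.prod_nonneg fun i _ => by linarith [neg_one_le_cosCoord i x]

lemma cosCoord_zero (i : Fin n) : (cosCoord i : Torus n → ℝ) 0 = 1 := by
  simp [cosCoord_apply]

lemma peakFun_zero : peakFun (0 : Torus n) = 1 := by
  simp [peakFun, cosCoord_zero]

lemma peakFun_lt_one {x : Torus n} (hx : x ≠ 0) : peakFun x < 1 := by
  obtain ⟨i, hi⟩ := Function.ne_iff.1 hx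
  have h0 : ∀ j : Fin n, 0 ≤ (1 + (cosCoord j : Torus n → ℝ) x) / 2 := fun j => by
    linarith [neg_one_le_cosCoord j x]
  have h1 : ∀ j : Fin n, (1 + (cosCoord j : Torus n → ℝ) x) / 2 ≤ 1 := fun j => by
    linarith [cosCoord_le_one j x]
  have h2 : (1 + (cosCoord i : Torus n → ℝ) x) / 2 < 1 := by
    have := lt_of_le_of_ne (cosCoord_le_one i x) (fun h => hi (eq_zero_of_cosCoord_eq_one h))
    linarith
  rw [peakFun, ← Finset.mul_prod_erase _ _ (Finset.mem_univ i)]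
  calc _ ≤ (1 + (cosCoord i : Torus n → ℝ) x) / 2 * 1 :=
        mul_le_mul_of_nonneg_left (Finset.prod_le_one (fun j _ => h0 j) fun j _ => h1 j) (h0 i)
    _ < 1 := by simpa using h2

lemma peakFun_neg (x : Torus n) : peakFun (-x) = peakFun x := by
  simp [peakFun, cosCoord_apply, AddCircle.toCircle_neg]

/-- The addition formula for the cosine makes each factor separable. This is the reason for a kernel
built from cosines: convolution with it has finite rank. -/
lemma isSeparable_peakFun : IsSeparable (fun x y : Torus n => peakFun (x - y)) := by
  have h : ∀ i : Fin n, IsSeparable (fun x y : Torus n =>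
      2⁻¹ * (1 + ((cosCoord i : Torus n → ℝ) x * (cosCoord i : Torus n → ℝ) y +
        (sinCoord i : Torus n → ℝ) x * (sinCoord i : Torus n → ℝ) y))) := fun i =>
    (IsSeparable.const _).mul ((IsSeparable.const _).add
      ((IsSeparable.mul_fun _ _).add (IsSeparable.mul_fun _ _)))
  have := IsSeparable.prod Finset.univ h
  simpa [peakFun, cosCoord_sub, div_eq_inv_mul] using this

variable (n) in
/-- A nonnegative even probability density `k` on the torus for which `k (x - y)` is a finite sum
of products of smooth functions. -/
structure SmoothingKernel where
  /-- The density. -/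
  k : Torus n → ℝ
  /-- The index set of the decomposition. -/
  J : Type
  fintypeJ : Fintype J
  /-- The left factors. -/
  φ : J → smoothFun n
  /-- The right factors. -/
  ψ : J → smoothFun n
  continuous_k : Continuous k
  nonneg : ∀ x, 0 ≤ k x
  even : ∀ x, k (-x) = k x
  integral_eq_one : ∫ x, k x = 1
  sub_eq : ∀ x y, k (x - y) = ∑ j, (φ j : Torus n → ℝ) x * (ψ j : Torus n → ℝ) y

instance : (volume : Measure (Torus n)).IsNegInvariant :=
  Measure.IsAddHaarMeasure.isNegInvariant_of_regular _

instance (K : SmoothingKernel n) : Fintype K.J := K.fintypeJ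

lemma integral_peakFun_pow_pos (m : ℕ) : 0 < ∫ x : Torus n, peakFun x ^ m := by
  refine Continuous.integral_pos_of_hasCompactSupport_nonneg_nonzero (x := (0 : Torus n))
    (continuous_peakFun.pow m) (HasCompactSupport.of_compactSpace _)
    (fun x => pow_nonneg (peakFun_nonneg x) m) ?_
  simp [peakFun_zero]

/-- The kernels `c ^ m / ∫ c ^ m`, for `c = peakFun`. -/
def peakKernel (m : ℕ) : SmoothingKernel n :=
  have h := (IsSeparable.const (∫ x : Torus n, peakFun x ^ m)⁻¹).mul
    ((isSeparable_peakFun (n := n)).pow m)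
  { k := fun x => (∫ x : Torus n, peakFun x ^ m)⁻¹ * peakFun x ^ m
    J := h.choose
    fintypeJ := h.choose_spec.choose
    φ := h.choose_spec.choose_spec.choose
    ψ := h.choose_spec.choose_spec.choose_spec.choose
    continuous_k := by have := continuous_peakFun (n := n); fun_prop
    nonneg := fun x => mul_nonneg (inv_nonneg.2 (integral_peakFun_pow_pos m).le)
      (pow_nonneg (peakFun_nonneg x) m)
    even := fun x => by rw [peakFun_neg]
    integral_eq_one := by
      rw [integral_const_mul]
      exact inv_mul_cancel₀ (integral_peakFun_pow_pos m).ne'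
    sub_eq := h.choose_spec.choose_spec.choose_spec.choose_spec }

/-- Convolution with a smoothing kernel. -/
def SmoothingKernel.avg (K : SmoothingKernel n) (f : Torus n → ℝ) : smoothFun n :=
  ∑ j, (∫ y, f y * (K.ψ j : Torus n → ℝ) y) • K.φ j

lemma integrable_mul_of_continuous {f g : Torus n → ℝ} (hf : Integrable f) (hg : Continuous g) :
    Integrable (fun y => f y * g y) := by
  obtain ⟨C, hC⟩ := isCompact_univ.exists_bound_of_continuousOn hg.continuousOn
  exact hf.mul_bdd hg.aestronglyMeasurable (.of_forall fun x => hC x trivial)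

lemma integrable_mul_smoothFun {f : Torus n → ℝ} (hf : Integrable f) (ψ : smoothFun n) :
    Integrable (fun y => f y * (ψ : Torus n → ℝ) y) :=
  integrable_mul_of_continuous hf (smoothFun.continuous ψ)

/-! ### Averaging against a finite-rank kernel. -/

namespace SmoothingKernel

variable (K : SmoothingKernel n)

lemma avg_apply_sum (f : Torus n → ℝ) (x : Torus n) :
    (K.avg f : Torus n → ℝ) x =
      ∑ j, (∫ y, f y * (K.ψ j : Torus n → ℝ) y) * (K.φ j : Torus n → ℝ) x :=
  smoothFun.sum_apply _ _ _

lemma avg_apply {f : Torus n → ℝ} (hf : Integrable f) (x : Torus n) :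
    (K.avg f : Torus n → ℝ) x = ∫ y, K.k (x - y) * f y := by
  simp only [avg_apply_sum, K.sub_eq, Finset.sum_mul]
  rw [integral_finsetSum _ fun j _ => by
    have := (integrable_mul_smoothFun hf (K.ψ j)).mul_const ((K.φ j : Torus n → ℝ) x)
    convert this using 2; ring]
  refine Finset.sum_congr rfl fun j _ => ?_
  rw [← integral_mul_const]
  congr 1; ext y; ring

lemma k_sub_comm (x y : Torus n) : K.k (x - y) = K.k (y - x) := by
  rw [← K.even, neg_sub]

lemma avg_apply_sum' {f : Torus n → ℝ} (hf : Integrable f) (x : Torus n) :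
    (K.avg f : Torus n → ℝ) x =
      ∑ j, (∫ y, f y * (K.φ j : Torus n → ℝ) y) * (K.ψ j : Torus n → ℝ) x := by
  rw [avg_apply K hf]
  simp only [K.k_sub_comm x, K.sub_eq, Finset.sum_mul]
  rw [integral_finsetSum _ fun j _ => by
    have := (integrable_mul_smoothFun hf (K.φ j)).mul_const ((K.ψ j : Torus n → ℝ) x)
    convert this using 2; ring]
  refine Finset.sum_congr rfl fun j _ => ?_
  rw [← integral_mul_const]
  congr 1; ext y; ring

/-- Evenness of the kernel lets the two families of factors trade places. A test function of the
form `K.avg f` is thereby a combination of the same `ψ j` whose moments define `K.avg u`. -/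
lemma avg_eq_sum' {f : Torus n → ℝ} (hf : Integrable f) :
    K.avg f = ∑ j, (∫ y, f y * (K.φ j : Torus n → ℝ) y) • K.ψ j := by
  apply Subtype.ext
  funext x
  rw [avg_apply_sum' K hf, smoothFun.sum_apply]

lemma integrable_k : Integrable K.k := integrable_of_continuous K.continuous_k

lemma integral_k_sub (x : Torus n) : ∫ y, K.k (x - y) = 1 := by
  rw [integral_sub_left_eq_self (μ := volume) K.k x, K.integral_eq_one]

lemma lintegral_k : ∫⁻ x, ENNReal.ofReal (K.k x) = 1 := by
  rw [← ofReal_integral_eq_lintegral_ofReal K.integrable_k (.of_forall K.nonneg),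
    K.integral_eq_one, ENNReal.ofReal_one]

lemma lintegral_k_sub (x : Torus n) : ∫⁻ y, ENNReal.ofReal (K.k (x - y)) = 1 := by
  rw [lintegral_sub_left_eq_self (μ := volume) (fun z => ENNReal.ofReal (K.k z)) x, K.lintegral_k]

lemma abs_avg_le {f : Torus n → ℝ} (hf : Integrable f) {C : ℝ} (hC : ∀ x, |f x| ≤ C)
    (x : Torus n) : |(K.avg f : Torus n → ℝ) x| ≤ C := by
  have hk : Continuous fun y => K.k (x - y) := K.continuous_k.comp (by fun_prop)
  rw [avg_apply K hf, ← Real.norm_eq_abs]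
  calc _ ≤ ∫ y, K.k (x - y) * C := norm_integral_le_of_norm_le
        ((integrable_of_continuous hk).mul_const C) (.of_forall fun y => by
          rw [norm_mul, Real.norm_of_nonneg (K.nonneg _)]
          exact mul_le_mul_of_nonneg_left (hC y) (K.nonneg _))
    _ = C := by rw [integral_mul_const, K.integral_k_sub, one_mul]

lemma eLpNorm_two_eq {α : Type*} [MeasurableSpace α] (μ : Measure α) (f : α → ℝ) :
    eLpNorm f 2 μ = (∫⁻ x, ‖f x‖ₑ ^ 2 ∂μ) ^ (1 / 2 : ℝ) := by
  rw [eLpNorm_eq_lintegral_rpow_enorm_toReal (by simp) (by simp)]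
  simp

/-- Cauchy–Schwarz for the probability density k(x - ·), followed by Tonelli. The constant one makes
the bound uniform in the kernel. -/
lemma eLpNorm_avg_le {f : Torus n → ℝ} (hf : MemLp f 2 volume) :
    eLpNorm (K.avg f : Torus n → ℝ) 2 volume ≤ eLpNorm f 2 volume := by
  have hfi : Integrable f := hf.integrable (by norm_num)
  have hk : Measurable fun p : Torus n × Torus n => ENNReal.ofReal (K.k (p.1 - p.2)) := by
    have : Continuous fun p : Torus n × Torus n => K.k (p.1 - p.2) :=
      K.continuous_k.comp (by fun_prop)
    exact this.measurable.ennreal_ofReal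
  have hfm : AEMeasurable (fun y => ‖f y‖ₑ ^ 2) volume := hf.1.enorm.pow_const 2
  rw [eLpNorm_two_eq, eLpNorm_two_eq]
  gcongr ?_ ^ _
  have key : ∀ x, ‖(K.avg f : Torus n → ℝ) x‖ₑ ^ 2 ≤
      ∫⁻ y, ENNReal.ofReal (K.k (x - y)) * ‖f y‖ₑ ^ 2 := by
    intro x
    have hkx : Measurable fun y => ENNReal.ofReal (K.k (x - y)) :=
      hk.comp (measurable_const.prodMk measurable_id)
    have h1 : ‖(K.avg f : Torus n → ℝ) x‖ₑ ≤ ∫⁻ y, ENNReal.ofReal (K.k (x - y)) * ‖f y‖ₑ := by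
      rw [avg_apply K hfi]
      refine (enorm_integral_le_lintegral_enorm _).trans (lintegral_mono fun y => ?_)
      rw [enorm_mul, Real.enorm_of_nonneg (K.nonneg _)]
    -- Splits k |f| as (k |f|²)^(1/2) k^(1/2); the second factor integrates to one.
    have h2 := ENNReal.lintegral_mul_norm_pow_le (μ := volume)
      (f := fun y => ENNReal.ofReal (K.k (x - y)) * ‖f y‖ₑ ^ 2)
      (g := fun y => ENNReal.ofReal (K.k (x - y))) (hkx.aemeasurable.mul hfm) hkx.aemeasurable
      (p := 1 / 2) (q := 1 / 2) (by norm_num) (by norm_num) (by norm_num)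
    rw [K.lintegral_k_sub, ENNReal.one_rpow, mul_one] at h2
    have h3 : ∀ y, (ENNReal.ofReal (K.k (x - y)) * ‖f y‖ₑ ^ 2) ^ (1 / 2 : ℝ) *
        ENNReal.ofReal (K.k (x - y)) ^ (1 / 2 : ℝ) = ENNReal.ofReal (K.k (x - y)) * ‖f y‖ₑ := by
      intro y
      rw [← ENNReal.mul_rpow_of_nonneg _ _ (by norm_num : (0 : ℝ) ≤ 1 / 2)]
      rw [show ENNReal.ofReal (K.k (x - y)) * ‖f y‖ₑ ^ 2 * ENNReal.ofReal (K.k (x - y)) =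
        (ENNReal.ofReal (K.k (x - y)) * ‖f y‖ₑ) ^ 2 by ring]
      rw [← ENNReal.rpow_natCast, ← ENNReal.rpow_mul]
      norm_num
    simp only [h3] at h2
    calc _ ≤ ((∫⁻ y, ENNReal.ofReal (K.k (x - y)) * ‖f y‖ₑ ^ 2) ^ (1 / 2 : ℝ)) ^ 2 := by
          gcongr; exact h1.trans h2
      _ = _ := by
          rw [← ENNReal.rpow_natCast, ← ENNReal.rpow_mul]
          norm_num
  calc _ ≤ ∫⁻ x, ∫⁻ y, ENNReal.ofReal (K.k (x - y)) * ‖f y‖ₑ ^ 2 := lintegral_mono key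
    _ = ∫⁻ y, ∫⁻ x, ENNReal.ofReal (K.k (x - y)) * ‖f y‖ₑ ^ 2 := by
        rw [lintegral_lintegral_swap]
        exact hk.aemeasurable.mul (hfm.comp_snd)
    _ = _ := by
        congr 1; ext y
        have hky : Measurable fun x => ENNReal.ofReal (K.k (x - y)) :=
          hk.comp (measurable_id.prodMk measurable_const)
        rw [lintegral_mul_const _ hky]
        rw [lintegral_sub_right_eq_self (μ := volume) (fun z => ENNReal.ofReal (K.k z)) y,
          K.lintegral_k, one_mul]

/-- A function of x - y satisfies ∂ₓ = -∂ᵧ: both sides are derivatives at s = 0 of k(x + s eᵢ - y),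
the shift being applied to x or, reversed, to y. -/
lemma sum_partialDeriv_mul (i : Fin n) (x y : Torus n) :
    ∑ j, partialDeriv i (K.φ j : Torus n → ℝ) x * (K.ψ j : Torus n → ℝ) y =
      -∑ j, (K.φ j : Torus n → ℝ) x * partialDeriv i (K.ψ j : Torus n → ℝ) y := by
  have h1 := HasDerivAt.fun_sum (u := Finset.univ)
    (fun j _ => (smoothFun.hasDerivAt_line_zero (K.φ j) i x).mul_const ((K.ψ j : Torus n → ℝ) y))
  have h2 := HasDerivAt.fun_sum (u := Finset.univ) (fun j _ =>
    (smoothFun.hasDerivAt_line_zero (K.ψ j) i y).const_mul ((K.φ j : Torus n → ℝ) x))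
  have hneg : ∀ s : ℝ, proj (Pi.single i (-s)) = -(proj (Pi.single i s) : Torus n) := by
    intro s
    rw [eq_neg_iff_add_eq_zero, ← proj_add, ← Pi.single_add]; simp
  have h3 : HasDerivAt (fun s : ℝ => K.k (x + proj (Pi.single i s) - y))
      (-∑ j, (K.φ j : Torus n → ℝ) x * partialDeriv i (K.ψ j : Torus n → ℝ) y) 0 := by
    have h4 := HasDerivAt.scomp (0 : ℝ) (by simpa using h2) (hasDerivAt_neg (0 : ℝ))
    simp only [Function.comp_def, ← K.sub_eq, hneg] at h4
    simpa [sub_neg_eq_add, sub_add_eq_sub_sub, add_sub_right_comm, sub_add] using h4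
  simp only [← K.sub_eq] at h1
  exact h1.unique h3

/-- The derivative moves from x to y on the kernel, where the definition of the weak derivative
applies. -/
lemma partialDeriv_avg {f g : Torus n → ℝ} (hf : Integrable f) {i : Fin n}
    (h : ∀ ψ : smoothFun n,
      ∫ x, f x * partialDeriv i (ψ : Torus n → ℝ) x = -∫ x, g x * (ψ : Torus n → ℝ) x)
    (x : Torus n) :
    partialDeriv i (K.avg f : Torus n → ℝ) x = (K.avg g : Torus n → ℝ) x := by
  rw [avg, smoothFun.partialDeriv_sum, avg_apply_sum]
  calc _ = ∫ y, f y * ∑ j, partialDeriv i (K.φ j : Torus n → ℝ) x * (K.ψ j : Torus n → ℝ) y := by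
        simp only [Finset.mul_sum]
        rw [integral_finsetSum _ fun j _ => by
          have := (integrable_mul_smoothFun hf (K.ψ j)).mul_const
            (partialDeriv i (K.φ j : Torus n → ℝ) x)
          convert this using 2; ring]
        refine Finset.sum_congr rfl fun j _ => ?_
        rw [← integral_mul_const]
        congr 1; ext y; ring
    _ = -∑ j, (∫ y, f y * partialDeriv i (K.ψ j : Torus n → ℝ) y) * (K.φ j : Torus n → ℝ) x := by
        simp only [sum_partialDeriv_mul, mul_neg, integral_neg, Finset.mul_sum]
        rw [integral_finsetSum _ fun j _ => by
          have := (integrable_mul_smoothFun hf (smoothFun.pderiv i (K.ψ j))).mul_const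
            ((K.φ j : Torus n → ℝ) x)
          convert this using 2; simp only [smoothFun.coe_pderiv]; ring]
        congr 1
        refine Finset.sum_congr rfl fun j _ => ?_
        rw [← integral_mul_const]
        congr 1; ext y; ring
    _ = _ := by simp [h]

end SmoothingKernel

/-- Bounded pointwise convergence implies convergence in `L²` for a finite measure. -/
lemma tendsto_eLpNorm_two_of_bounded {α : Type*} [MeasurableSpace α] {μ : Measure α}
    [IsFiniteMeasure μ] {f : ℕ → α → ℝ} {g : α → ℝ} {C : ℝ}
    (hf : ∀ m, AEStronglyMeasurable (f m) μ) (hg : AEStronglyMeasurable g μ)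
    (hC : ∀ m, ∀ᵐ x ∂μ, |f m x - g x| ≤ C)
    (h : ∀ᵐ x ∂μ, Filter.Tendsto (fun m => f m x) Filter.atTop (nhds (g x))) :
    Filter.Tendsto (fun m => eLpNorm (fun x => f m x - g x) 2 μ) Filter.atTop (nhds 0) := by
  simp only [SmoothingKernel.eLpNorm_two_eq]
  have h1 : Filter.Tendsto (fun m => ∫⁻ x, ‖f m x - g x‖ₑ ^ 2 ∂μ) Filter.atTop
      (nhds (∫⁻ _, 0 ∂μ)) := by
    refine tendsto_lintegral_of_dominated_convergence' (fun _ => ENNReal.ofReal C ^ 2)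
      (fun m => ((hf m).sub hg).enorm.pow_const 2) (fun m => ?_) ?_ ?_
    · filter_upwards [hC m] with x hx
      gcongr
      rw [← ofReal_norm, Real.norm_eq_abs]
      exact ENNReal.ofReal_le_ofReal hx
    · rw [lintegral_const]
      exact ENNReal.mul_ne_top (by simp) (measure_ne_top _ _)
    · filter_upwards [h] with x hx
      have h2 : Filter.Tendsto (fun m => f m x - g x) Filter.atTop (nhds 0) := by
        simpa using hx.sub_const (g x)
      simpa [Function.comp_def] using
        ((ENNReal.continuous_pow 2).comp continuous_enorm).tendsto 0 |>.comp h2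
  rw [lintegral_zero] at h1
  simpa using h1.ennrpow_const (1 / 2)

/-- Normalized powers of a function with a unique maximum at `0` concentrate at `0`. -/
lemma tendsto_avg_of_continuous {f : Torus n → ℝ} (hf : Continuous f) (x : Torus n) :
    Filter.Tendsto (fun m => ((peakKernel m).avg f : Torus n → ℝ) x) Filter.atTop
      (nhds (f x)) := by
  have h := tendsto_setIntegral_pow_smul_of_unique_maximum_of_isCompact_of_continuousOn
    (μ := (volume : Measure (Torus n))) (g := fun z => f (x - z)) (x₀ := 0) (s := univ)
    isCompact_univ (c := peakFun) continuous_peakFun.continuousOn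
    (fun y _ hy => by rw [peakFun_zero]; exact peakFun_lt_one hy) (fun y _ => peakFun_nonneg y)
    (by simp [peakFun_zero]) (by simp)
    (Continuous.continuousOn (hf.comp (by fun_prop)))
  simp only [Measure.restrict_univ, sub_zero] at h
  refine h.congr fun m => ?_
  rw [SmoothingKernel.avg_apply _ (integrable_of_continuous hf),
    ← integral_sub_left_eq_self (μ := volume) (fun y => (peakKernel m).k (x - y) * f y) x]
  simp only [sub_sub_cancel, peakKernel, smul_eq_mul]
  rw [← integral_const_mul]
  congr 1; ext y; ring

lemma SmoothingKernel.avg_sub (K : SmoothingKernel n) {f g : Torus n → ℝ} (hf : Integrable f)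
    (hg : Integrable g) (x : Torus n) :
    (K.avg (fun y => f y - g y) : Torus n → ℝ) x =
      (K.avg f : Torus n → ℝ) x - (K.avg g : Torus n → ℝ) x := by
  simp only [avg_apply_sum, sub_mul, ← Finset.sum_sub_distrib]
  refine Finset.sum_congr rfl fun j _ => ?_
  rw [integral_sub (integrable_mul_smoothFun hf _) (integrable_mul_smoothFun hg _), sub_mul]

/-- An ε/3 argument: continuous functions are dense in `L²`, averages of bounded continuous
functions converge boundedly, and averaging is a contraction. -/
lemma tendsto_eLpNorm_avg_sub {f : Torus n → ℝ} (hf : MemLp f 2 volume) :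
    Filter.Tendsto (fun m => eLpNorm (fun x => ((peakKernel m).avg f : Torus n → ℝ) x - f x) 2
      volume) Filter.atTop (nhds 0) := by
  rw [ENNReal.tendsto_nhds_zero]
  intro ε hε
  have hε3 : ε / 3 ≠ 0 := by simpa using hε.ne'
  obtain ⟨g, hg, -⟩ := hf.exists_boundedContinuous_eLpNorm_sub_le (by simp) hε3
  obtain ⟨g, hgc⟩ : ∃ g' : Torus n → ℝ, g' = g := ⟨_, rfl⟩
  rename_i g₀
  rw [← hgc] at hg
  replace hgc : Continuous g := hgc ▸ g₀.continuous
  have hgm := memLp_of_continuous hgc 2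
  have hgi := integrable_of_continuous hgc
  have hfi : Integrable f := hf.integrable (by norm_num)
  obtain ⟨C, hC⟩ := isCompact_univ.exists_bound_of_continuousOn hgc.continuousOn
  have hC' : ∀ x, |g x| ≤ C := fun x => hC x trivial
  have h1 := tendsto_eLpNorm_two_of_bounded (μ := volume) (C := C + C)
    (f := fun m => ((peakKernel m).avg g : Torus n → ℝ)) (g := g)
    (fun m => (smoothFun.continuous _).aestronglyMeasurable) hgc.aestronglyMeasurable
    (fun m => .of_forall fun x => (abs_sub _ _).trans
      (add_le_add (SmoothingKernel.abs_avg_le _ hgi hC' x) (hC' x)))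
    (.of_forall fun x => tendsto_avg_of_continuous hgc x)
  filter_upwards [ENNReal.tendsto_nhds_zero.1 h1 (ε / 3) (pos_iff_ne_zero.2 hε3)] with m hm
  have hA := SmoothingKernel.eLpNorm_avg_le (peakKernel m) (hf.sub hgm)
  have hB := fun x => (peakKernel m).avg_sub hfi hgi x
  have m1 : AEStronglyMeasurable ((peakKernel m).avg (f - g) : Torus n → ℝ) volume :=
    (smoothFun.continuous _).aestronglyMeasurable
  have m2 : AEStronglyMeasurable (fun x => ((peakKernel m).avg g : Torus n → ℝ) x - g x)
      volume :=
    (smoothFun.continuous _).aestronglyMeasurable.sub hgc.aestronglyMeasurable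
  have m3 : AEStronglyMeasurable (g - f) volume := hgc.aestronglyMeasurable.sub hf.1
  have e : (fun x => ((peakKernel m).avg f : Torus n → ℝ) x - f x) =
      ((peakKernel m).avg (f - g) : Torus n → ℝ) +
          (fun x => ((peakKernel m).avg g : Torus n → ℝ) x - g x) + (g - f) := by
    ext x
    have := hB x
    simp only [Pi.add_apply, Pi.sub_apply]
    rw [show (f - g) = fun y => f y - g y from rfl, this]; ring
  rw [e]
  calc _ ≤ eLpNorm ((peakKernel m).avg (f - g) : Torus n → ℝ) 2 volume +
          eLpNorm (fun x => ((peakKernel m).avg g : Torus n → ℝ) x - g x) 2 volume +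
          eLpNorm (g - f) 2 volume :=
        (eLpNorm_add_le (m1.add m2) m3 (by norm_num)).trans
          (add_le_add_left (eLpNorm_add_le m1 m2 (by norm_num)) _)
    _ ≤ ε / 3 + ε / 3 + ε / 3 :=
        add_le_add (add_le_add (hA.trans hg) hm) (by rw [eLpNorm_sub_comm]; exact hg)
    _ = ε := ENNReal.add_thirds ε

/-! ### Gagliardo–Nirenberg inequalities on the torus -/

lemma add_proj_single (x : Torus n) (i : Fin n) (s : ℝ) :
    x + proj (Pi.single i s) = update x i (x i + (s : UnitAddCircle)) := by
  funext j
  by_cases hj : j = i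
  · subst hj; simp [proj]
  · simp [proj, hj]

/-- On a circle there is no boundary point where f vanishes. Instead f(x) = f(x + b eᵢ) - ∫₀ᵇ ∂ᵢf is
averaged over b in one period; this is what brings in the term of order zero. -/
lemma enorm_le_lintegral_line {f f' : Torus n → ℝ} {D : Torus n → ℝ≥0∞} {i : Fin n}
    (hf : Continuous f) (hf' : Continuous f')
    (hd : ∀ x s, HasDerivAt (fun s : ℝ => f (x + proj (Pi.single i s)))
      (f' (x + proj (Pi.single i s))) s)
    (hD : ∀ x, ‖f x‖ₑ + ‖f' x‖ₑ ≤ D x) (x : Torus n) :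
    ‖f x‖ₑ ≤ ∫⁻ z : UnitAddCircle, D (update x i z) := by
  have hline : Continuous fun s : ℝ => x + proj (Pi.single i s) :=
    continuous_const.add
      (continuous_proj.comp (continuous_single (A := fun _ : Fin n => ℝ) i))
  have hc : Continuous fun s : ℝ => f (x + proj (Pi.single i s)) := hf.comp hline
  have hc' : Continuous fun s : ℝ => f' (x + proj (Pi.single i s)) := hf'.comp hline
  have h1 : ∀ b ∈ Ioc (0 : ℝ) 1, ‖f x‖ₑ ≤ ‖f (x + proj (Pi.single i b))‖ₑ +
      ∫⁻ s in Ioc (0 : ℝ) 1, ‖f' (x + proj (Pi.single i s))‖ₑ := by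
    intro b hb
    have h2 := intervalIntegral.integral_eq_sub_of_hasDerivAt (a := 0) (b := b)
      (fun s _ => hd x s) (hc'.intervalIntegrable _ _)
    have h3 : f x = f (x + proj (Pi.single i b)) -
        ∫ s in (0 : ℝ)..b, f' (x + proj (Pi.single i s)) := by
      rw [h2]; simp
    rw [h3]
    refine enorm_sub_le.trans ?_
    gcongr
    rw [intervalIntegral.integral_of_le hb.1.le]
    refine (enorm_integral_le_lintegral_enorm _).trans (lintegral_mono_set ?_)
    exact Ioc_subset_Ioc_right hb.2
  calc ‖f x‖ₑ = ∫⁻ _ in Ioc (0 : ℝ) 1, ‖f x‖ₑ := by simp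
    _ ≤ ∫⁻ b in Ioc (0 : ℝ) 1, (‖f (x + proj (Pi.single i b))‖ₑ +
          ∫⁻ s in Ioc (0 : ℝ) 1, ‖f' (x + proj (Pi.single i s))‖ₑ) :=
        setLIntegral_mono' measurableSet_Ioc h1
    _ = ∫⁻ b in Ioc (0 : ℝ) 1, (‖f (x + proj (Pi.single i b))‖ₑ +
          ‖f' (x + proj (Pi.single i b))‖ₑ) := by
        rw [lintegral_add_right _ measurable_const, lintegral_add_left hc.enorm.measurable]
        simp
    _ ≤ ∫⁻ b in Ioc (0 : ℝ) 1, D (update x i (x i + (b : UnitAddCircle))) := by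
        refine lintegral_mono fun b => ?_
        rw [← add_proj_single]; exact hD _
    _ = ∫⁻ z : UnitAddCircle, D (update x i (x i + z)) := by
        have := UnitAddCircle.lintegral_preimage 0 (fun z => D (update x i (x i + z)))
        simpa using this
    _ = _ := lintegral_add_left_eq_self (fun z => D (update x i z)) (x i)

/-- The Gagliardo–Nirenberg–Sobolev argument: the n bounds along coordinate lines, each to the power
1/(n-1), are multiplied, and the grid-lines inequality `lintegral_prod_lintegral_pow_le` integrates
the product. -/
lemma lintegral_rpow_le_of_line (hn : 2 ≤ n) {f : Torus n → ℝ} {f' : Fin n → Torus n → ℝ}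
    {D : Torus n → ℝ≥0∞} (hf : Continuous f) (hf' : ∀ i, Continuous (f' i))
    (hd : ∀ i x s, HasDerivAt (fun s : ℝ => f (x + proj (Pi.single i s)))
      (f' i (x + proj (Pi.single i s))) s)
    (hDm : Measurable D) (hD : ∀ i x, ‖f x‖ₑ + ‖f' i x‖ₑ ≤ D x) :
    (∫⁻ x, ‖f x‖ₑ ^ ((n : ℝ) / (n - 1))) ^ (((n : ℝ) - 1) / n) ≤ ∫⁻ x, D x := by
  have hn' : (2 : ℝ) ≤ n := by exact_mod_cast hn
  have hp : ((Fintype.card (Fin n) : ℕ) : ℝ).HolderConjugate ((n : ℝ) / (n - 1)) := by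
    rw [Fintype.card_fin, Real.holderConjugate_iff]
    constructor
    · linarith
    · field_simp; ring
  have h1 := lintegral_prod_lintegral_pow_le (fun _ : Fin n => (volume : Measure UnitAddCircle))
    hp hDm
  rw [Fintype.card_fin] at h1
  have h2 : ∫⁻ x, ‖f x‖ₑ ^ ((n : ℝ) / (n - 1)) ≤ (∫⁻ x, D x) ^ ((n : ℝ) / (n - 1)) := by
    refine le_trans (lintegral_mono fun x => ?_) h1
    calc ‖f x‖ₑ ^ ((n : ℝ) / (n - 1)) = ∏ _i : Fin n, ‖f x‖ₑ ^ ((1 : ℝ) / (n - 1)) := by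
          rw [Finset.prod_const, Finset.card_univ, Fintype.card_fin, ← ENNReal.rpow_natCast,
            ← ENNReal.rpow_mul]
          congr 1; ring
      _ ≤ _ := by
          refine Finset.prod_le_prod' fun i _ => ?_
          have h4 : (0 : ℝ) ≤ 1 / (n - 1) := by
            apply div_nonneg <;> linarith
          exact ENNReal.rpow_le_rpow
            (enorm_le_lintegral_line hf (hf' i) (hd i) (hD i) x) h4
  calc _ ≤ ((∫⁻ x, D x) ^ ((n : ℝ) / (n - 1))) ^ (((n : ℝ) - 1) / n) := by
        refine ENNReal.rpow_le_rpow h2 ?_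
        apply div_nonneg <;> linarith
    _ = _ := by
        rw [← ENNReal.rpow_mul]
        rw [show (n : ℝ) / (n - 1) * (((n : ℝ) - 1) / n) = 1 by
          have : (n : ℝ) - 1 ≠ 0 := by linarith
          field_simp, ENNReal.rpow_one]

/-- The sum of the absolute values of a smooth function and of its partial derivatives. -/
def jetNorm (w : smoothFun n) (x : Torus n) : ℝ≥0∞ :=
  ‖(w : Torus n → ℝ) x‖ₑ + ∑ i, ‖partialDeriv i (w : Torus n → ℝ) x‖ₑ

lemma measurable_jetNorm (w : smoothFun n) : Measurable (jetNorm w) := by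
  have h1 := (smoothFun.continuous w).measurable.enorm
  have h2 : ∀ i, Measurable fun x => ‖partialDeriv i (w : Torus n → ℝ) x‖ₑ := fun i =>
    (smoothFun.continuous_partialDeriv w i).measurable.enorm
  exact h1.add (Finset.measurable_sum _ fun i _ => h2 i)

lemma enorm_add_enorm_le_jetNorm (w : smoothFun n) (i : Fin n) (x : Torus n) :
    ‖(w : Torus n → ℝ) x‖ₑ + ‖partialDeriv i (w : Torus n → ℝ) x‖ₑ ≤ jetNorm w x := by
  unfold jetNorm
  gcongr
  exact Finset.single_le_sum (f := fun i => ‖partialDeriv i (w : Torus n → ℝ) x‖ₑ)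
    (fun _ _ => zero_le) (Finset.mem_univ i)

/-! ### The Sobolev inequality applied to powers. -/

section power

variable (w : smoothFun n) {s : ℝ}

lemma hasDerivAt_abs_rpow_line (hs : 2 ≤ s) (i : Fin n) (x : Torus n) (t : ℝ) :
    HasDerivAt (fun t : ℝ => |(w : Torus n → ℝ) (x + proj (Pi.single i t))| ^ s)
      ((fun y => s * |(w : Torus n → ℝ) y| ^ (s - 2) * (w : Torus n → ℝ) y *
        partialDeriv i (w : Torus n → ℝ) y) (x + proj (Pi.single i t))) t :=
  (hasDerivAt_abs_rpow _ (by linarith)).comp t (smoothFun.hasDerivAt_line w i x t)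

lemma continuous_deriv_abs_rpow (hs : 2 ≤ s) (i : Fin n) :
    Continuous (fun y => s * |(w : Torus n → ℝ) y| ^ (s - 2) * (w : Torus n → ℝ) y *
        partialDeriv i (w : Torus n → ℝ) y) := by
  have h1 := smoothFun.continuous w
  have h2 := smoothFun.continuous_partialDeriv w i
  have h3 : Continuous fun y => |(w : Torus n → ℝ) y| ^ (s - 2) :=
    h1.abs.rpow_const fun _ => Or.inr (by linarith)
  fun_prop

lemma enorm_abs_rpow (hs : 0 ≤ s) (a : ℝ) : ‖|a| ^ s‖ₑ = ‖a‖ₑ ^ s := by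
  rw [Real.enorm_rpow_of_nonneg (abs_nonneg _) hs]; simp

lemma enorm_jet_abs_rpow_le (hs : 2 ≤ s) (i : Fin n) (x : Torus n) :
    ‖|(w : Torus n → ℝ) x| ^ s‖ₑ + ‖s * |(w : Torus n → ℝ) x| ^ (s - 2) * (w : Torus n → ℝ) x *
        partialDeriv i (w : Torus n → ℝ) x‖ₑ ≤
      ENNReal.ofReal s * (‖(w : Torus n → ℝ) x‖ₑ ^ (s - 1) * jetNorm w x) := by
  rw [enorm_abs_rpow (by linarith), enorm_mul, enorm_mul, enorm_mul,
    enorm_abs_rpow (by linarith), Real.enorm_of_nonneg (by linarith : 0 ≤ s)]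
  set a := ‖(w : Torus n → ℝ) x‖ₑ
  set d := ‖partialDeriv i (w : Torus n → ℝ) x‖ₑ
  have e1 : a ^ s = a ^ (s - 1) * a := by
    conv_rhs => rw [← ENNReal.rpow_one a, ← ENNReal.rpow_mul, one_mul]
    rw [← ENNReal.rpow_add_of_nonneg _ _ (by linarith) zero_le_one]; congr 1; ring
  have e2 : a ^ (s - 1) = a ^ (s - 2) * a := by
    conv_rhs => rw [← ENNReal.rpow_one a, ← ENNReal.rpow_mul, one_mul]
    rw [← ENNReal.rpow_add_of_nonneg _ _ (by linarith) zero_le_one]; congr 1; ring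
  have h1 : (1 : ℝ≥0∞) ≤ ENNReal.ofReal s := by
    rw [← ENNReal.ofReal_one]; exact ENNReal.ofReal_le_ofReal (by linarith)
  calc a ^ s + ENNReal.ofReal s * a ^ (s - 2) * a * d
      ≤ ENNReal.ofReal s * (a ^ (s - 1) * a) + ENNReal.ofReal s * (a ^ (s - 1) * d) := by
        refine add_le_add ?_ (le_of_eq ?_)
        · rw [e1]; exact le_mul_of_one_le_left' h1
        · rw [e2]; ring
    _ = ENNReal.ofReal s * (a ^ (s - 1) * (a + d)) := by ring
    _ ≤ _ := by gcongr; exact enorm_add_enorm_le_jetNorm w i x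

lemma lintegral_rpow_mul_jetNorm_le (s : ℝ) :
    ∫⁻ x, ENNReal.ofReal s * (‖(w : Torus n → ℝ) x‖ₑ ^ (s - 1) * jetNorm w x) ≤
      ENNReal.ofReal s * ((∫⁻ x, ‖(w : Torus n → ℝ) x‖ₑ ^ (2 * (s - 1))) ^ (1 / 2 : ℝ) *
        (∫⁻ x, jetNorm w x ^ 2) ^ (1 / 2 : ℝ)) := by
  have hw := (smoothFun.continuous w).measurable.enorm
  have hj := measurable_jetNorm w
  have hm : Measurable fun x => ‖(w : Torus n → ℝ) x‖ₑ ^ (s - 1) * jetNorm w x :=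
    (hw.pow_const _).mul hj
  rw [lintegral_const_mul _ hm]
  gcongr
  have h := ENNReal.lintegral_mul_norm_pow_le (μ := volume)
    (hw.pow_const (2 * (s - 1))).aemeasurable (hj.pow_const 2).aemeasurable
    (p := 1 / 2) (q := 1 / 2) (by norm_num) (by norm_num) (by norm_num)
  refine le_trans (le_of_eq ?_) h
  congr 1; ext x
  rw [← ENNReal.rpow_mul, ← ENNReal.rpow_natCast (jetNorm w x), ← ENNReal.rpow_mul]
  congr 2
  · ring
  · norm_num

/-- The `W^{1,1}` Sobolev inequality for |w|^s, whose jet is at most s |w|^(s-1) times that of w;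
Cauchy–Schwarz then separates the two factors. -/
lemma lintegral_rpow_le (hn : 2 ≤ n) (hs : 2 ≤ s) :
    (∫⁻ x, ‖(w : Torus n → ℝ) x‖ₑ ^ (s * (n / (n - 1)))) ^ (((n : ℝ) - 1) / n) ≤
      ENNReal.ofReal s * ((∫⁻ x, ‖(w : Torus n → ℝ) x‖ₑ ^ (2 * (s - 1))) ^ (1 / 2 : ℝ) *
        (∫⁻ x, jetNorm w x ^ 2) ^ (1 / 2 : ℝ)) := by
  have hw := (smoothFun.continuous w).measurable.enorm
  have hj := measurable_jetNorm w
  have h := lintegral_rpow_le_of_line hn (f := fun x => |(w : Torus n → ℝ) x| ^ s)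
    (D := fun x => ENNReal.ofReal s * (‖(w : Torus n → ℝ) x‖ₑ ^ (s - 1) * jetNorm w x))
    ((smoothFun.continuous w).abs.rpow_const fun _ => Or.inr (by linarith))
    (continuous_deriv_abs_rpow w hs)
    (fun i x t => hasDerivAt_abs_rpow_line w hs i x t)
    (((hw.pow_const _).mul hj).const_mul _)
    (enorm_jet_abs_rpow_le w hs)
  simp only [enorm_abs_rpow (by linarith : 0 ≤ s), ← ENNReal.rpow_mul] at h
  exact h.trans (lintegral_rpow_mul_jetNorm_le w s)

end power

lemma lintegral_rpow_enorm_ne_top (w : smoothFun n) {p : ℝ} (hp : 0 ≤ p) :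
    ∫⁻ x, ‖(w : Torus n → ℝ) x‖ₑ ^ p ≠ ⊤ := by
  obtain ⟨C, hC⟩ := isCompact_univ.exists_bound_of_continuousOn
    (smoothFun.continuous w).continuousOn
  refine ne_top_of_le_ne_top (b := ∫⁻ _ : Torus n, ENNReal.ofReal C ^ p) ?_
    (lintegral_mono fun x => ?_)
  · simp [hp]
  · refine ENNReal.rpow_le_rpow ?_ hp
    rw [← ofReal_norm]
    exact ENNReal.ofReal_le_ofReal (hC x trivial)

/-- The Gagliardo–Nirenberg inequality that bounds `∫ g w²` by the `L^q` norm of `g`. -/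
def IsGNConstant (n : ℕ) (q : ℝ) (C : ℝ≥0∞) : Prop :=
  C ≠ ⊤ ∧ ∀ (w : smoothFun n) (g : Torus n → ℝ≥0∞), AEMeasurable g volume →
    ∫⁻ x, g x * ‖(w : Torus n → ℝ) x‖ₑ ^ 2 ≤
      C * (∫⁻ x, g x ^ q) ^ (1 / q) * ((∫⁻ x, ‖(w : Torus n → ℝ) x‖ₑ ^ 2) ^ (1 - n / (2 * q)) *
        (∫⁻ x, jetNorm w x ^ 2) ^ (n / (2 * q)))

/-- In the Sobolev inequality for |w|^s the exponent 2(s-1) on the right lies between 2 and the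
exponent on the left. Hölder interpolates it, and the power of the left side so produced is
absorbed. -/
lemma lintegral_rpow_le_interpolated (hn : 2 ≤ n) {q : ℝ} (hq : (n : ℝ) / 2 < q) (hqn : q ≤ n)
    (w : smoothFun n) :
    (∫⁻ x, ‖(w : Torus n → ℝ) x‖ₑ ^ (2 * q / (q - 1))) ^ ((q - 1) / q) ≤
      ENNReal.ofReal (2 * q * (n - 1) / (n * (q - 1))) ^ (n / q) *
      ((∫⁻ x, ‖(w : Torus n → ℝ) x‖ₑ ^ 2) ^ (1 - n / (2 * q)) *
        (∫⁻ x, jetNorm w x ^ 2) ^ (n / (2 * q))) := by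
  have hn' : (2 : ℝ) ≤ n := by exact_mod_cast hn
  have hq1 : 0 < q - 1 := by linarith
  have hq0 : 0 < q := by linarith
  have hn1 : (0 : ℝ) < n - 1 := by linarith
  have hn0 : (0 : ℝ) < n := by linarith
  have hw := (smoothFun.continuous w).measurable.enorm
  -- The choice makes s n/(n-1) = 2q/(q-1), twice the exponent conjugate to q. The requirement s ≥ 2
  -- is then equivalent to q ≤ n.
  set s : ℝ := 2 * q * (n - 1) / (n * (q - 1)) with hs
  have hs2 : 2 ≤ s := by
    rw [hs, le_div_iff₀ (by positivity)]; nlinarith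
  have h1 := lintegral_rpow_le w hn hs2
  set X := ∫⁻ x, ‖(w : Torus n → ℝ) x‖ₑ ^ (2 * q / (q - 1)) with hX
  set I := ∫⁻ x, ‖(w : Torus n → ℝ) x‖ₑ ^ 2 with hI
  set H := ∫⁻ x, jetNorm w x ^ 2
  have e1 : s * ((n : ℝ) / (n - 1)) = 2 * q / (q - 1) := by rw [hs]; field_simp
  rw [e1, ← hX] at h1
  have hμ0 : 0 ≤ 2 * (n - q) / n := by
    apply div_nonneg <;> linarith
  have hμ1 : 0 ≤ (2 * q - n) / n := by
    apply div_nonneg <;> linarith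
  have h2 : ∫⁻ x, ‖(w : Torus n → ℝ) x‖ₑ ^ (2 * (s - 1)) ≤
      I ^ ((2 * q - n) / n) * X ^ (2 * (n - q) / n) := by
    have h := ENNReal.lintegral_mul_norm_pow_le (μ := volume)
      (hw.pow_const 2).aemeasurable (hw.pow_const (2 * q / (q - 1))).aemeasurable
      hμ1 hμ0 (by field_simp; ring)
    refine le_trans (le_of_eq ?_) h
    congr 1; ext x
    rw [← ENNReal.rpow_natCast, ← ENNReal.rpow_mul, ← ENNReal.rpow_mul,
      ← ENNReal.rpow_add_of_nonneg]
    · congr 1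
      rw [hs]; push_cast; field_simp; ring
    · positivity
    · positivity
  have hXt : X ≠ ⊤ := lintegral_rpow_enorm_ne_top w (by positivity)
  have h3 : X ^ ((q - 1) / n) ≤ ENNReal.ofReal s * (I ^ ((2 * q - n) / (2 * n)) *
      H ^ (1 / 2 : ℝ)) := by
    -- A power of X is to be cancelled, which needs X nonzero and finite; for X = 0 the claim is
    -- trivial.
    rcases eq_or_ne X 0 with hX0 | hX0
    · rw [hX0, ENNReal.zero_rpow_of_pos (by positivity)]; exact zero_le
    have h4 : X ^ ((n - q) / n) ≠ 0 := by
      simp [hX0, hXt]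
    have h5 : X ^ ((n - q) / n) ≠ ⊤ := by
      refine ENNReal.rpow_ne_top_of_nonneg ?_ hXt
      apply div_nonneg <;> linarith
    rw [← ENNReal.mul_le_mul_iff_left h4 h5]
    calc _ = X ^ (((n : ℝ) - 1) / n) := by
          rw [← ENNReal.rpow_add _ _ hX0 hXt]
          congr 1; field_simp; ring
      _ ≤ _ := h1
      _ ≤ ENNReal.ofReal s * ((I ^ ((2 * q - n) / n) * X ^ (2 * (n - q) / n)) ^ (1 / 2 : ℝ) *
            H ^ (1 / 2 : ℝ)) := by gcongr
      _ = _ := by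
          rw [ENNReal.mul_rpow_of_nonneg _ _ (by norm_num), ← ENNReal.rpow_mul,
            ← ENNReal.rpow_mul]
          rw [show (2 * q - n) / n * (1 / 2) = (2 * q - n) / (2 * n) by field_simp,
            show 2 * (n - q) / n * (1 / 2) = (n - q) / n by field_simp]
          ring
  calc X ^ ((q - 1) / q) = (X ^ ((q - 1) / n)) ^ (n / q) := by
        rw [← ENNReal.rpow_mul]; congr 1; field_simp
    _ ≤ (ENNReal.ofReal s * (I ^ ((2 * q - n) / (2 * n)) * H ^ (1 / 2 : ℝ))) ^ (n / q) :=
        ENNReal.rpow_le_rpow h3 (by positivity)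
    _ = _ := by
        rw [ENNReal.mul_rpow_of_nonneg _ _ (by positivity),
          ENNReal.mul_rpow_of_nonneg _ _ (by positivity), ← ENNReal.rpow_mul, ← ENNReal.rpow_mul]
        congr 3
        · field_simp
        · field_simp

/-- Hölder with exponents q and q/(q-1) separates g from w². -/
lemma exists_isGNConstant_of_le (hn : 2 ≤ n) {q : ℝ} (hq : (n : ℝ) / 2 < q) (hqn : q ≤ n) :
    ∃ C, IsGNConstant n q C := by
  have hn' : (2 : ℝ) ≤ n := by exact_mod_cast hn
  have hq1 : 0 < q - 1 := by linarith
  have hq0 : 0 < q := by linarith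
  refine ⟨ENNReal.ofReal (2 * q * (n - 1) / (n * (q - 1))) ^ (n / q),
    ENNReal.rpow_ne_top_of_nonneg (by positivity) (by simp), fun w g hg => ?_⟩
  have hw := (smoothFun.continuous w).measurable.enorm
  have h := ENNReal.lintegral_mul_norm_pow_le (μ := volume)
      (hg.pow_const q) (hw.pow_const (2 * q / (q - 1))).aemeasurable
      (p := 1 / q) (q := (q - 1) / q) (by positivity) (by positivity) (by field_simp; ring)
  calc _ = ∫⁻ x, (g x ^ q) ^ (1 / q) *
          (‖(w : Torus n → ℝ) x‖ₑ ^ (2 * q / (q - 1))) ^ ((q - 1) / q) := by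
        congr 1; ext x
        rw [← ENNReal.rpow_natCast, ← ENNReal.rpow_mul, ← ENNReal.rpow_mul,
          mul_one_div_cancel hq0.ne', ENNReal.rpow_one]
        congr 2
        push_cast; field_simp
    _ ≤ _ := h
    _ ≤ _ := by
        rw [mul_right_comm, mul_comm]
        gcongr
        exact (lintegral_rpow_le_interpolated hn hq hqn w)

/-- In dimension one the line estimate for w² is already a bound on its supremum, which comes out of
the integral and leaves ∫ g. -/
lemma exists_isGNConstant_one : ∃ C, IsGNConstant 1 1 C := by
  refine ⟨ENNReal.ofReal 2, by simp, fun w g hg => ?_⟩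
  have hw := (smoothFun.continuous w).measurable.enorm
  have hj := measurable_jetNorm w
  have h1 : ∀ x, ‖(w : Torus 1 → ℝ) x‖ₑ ^ 2 ≤ ENNReal.ofReal 2 *
      ((∫⁻ x, ‖(w : Torus 1 → ℝ) x‖ₑ ^ 2) ^ (1 / 2 : ℝ) *
        (∫⁻ x, jetNorm w x ^ 2) ^ (1 / 2 : ℝ)) := by
    intro x
    have h2 := enorm_le_lintegral_line (f := fun x => |(w : Torus 1 → ℝ) x| ^ (2 : ℝ))
      (D := fun x => ENNReal.ofReal 2 * (‖(w : Torus 1 → ℝ) x‖ₑ ^ ((2 : ℝ) - 1) * jetNorm w x))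
      ((smoothFun.continuous w).abs.rpow_const fun _ => Or.inr (by norm_num))
      (continuous_deriv_abs_rpow w le_rfl 0)
      (fun x t => hasDerivAt_abs_rpow_line w le_rfl 0 x t)
      (enorm_jet_abs_rpow_le w le_rfl 0) x
    rw [enorm_abs_rpow (by norm_num)] at h2
    have h3 := lintegral_rpow_mul_jetNorm_le w 2
    -- Varying the only coordinate runs over the whole torus.
    have h4 : ∀ F : Torus 1 → ℝ≥0∞, ∫⁻ z : UnitAddCircle, F (update x 0 z) = ∫⁻ y, F y := by
      intro F
      have := (volume_preserving_funUnique (Fin 1) UnitAddCircle).symm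
      refine Eq.trans ?_ (this.lintegral_comp_emb (MeasurableEquiv.measurableEmbedding _) F)
      congr 1; ext z; congr 1; ext i
      rw [Subsingleton.elim i 0]; simp
    rw [h4 (fun x => ENNReal.ofReal 2 * (‖(w : Torus 1 → ℝ) x‖ₑ ^ ((2 : ℝ) - 1) * jetNorm w x))]
      at h2
    have h5 := h2.trans h3
    norm_num at h5 ⊢
    exact h5
  calc _ ≤ ∫⁻ x, g x * (ENNReal.ofReal 2 *
      ((∫⁻ x, ‖(w : Torus 1 → ℝ) x‖ₑ ^ 2) ^ (1 / 2 : ℝ) *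
        (∫⁻ x, jetNorm w x ^ 2) ^ (1 / 2 : ℝ))) := by
        gcongr with x; exact h1 x
    _ = _ := by
        rw [lintegral_mul_const'' _ hg]
        norm_num
        ring

/-- Large q reduces to q = n: write g w² = (g^(q/n) w²)^(n/q) (w²)^(1-n/q) and apply Hölder. -/
lemma exists_isGNConstant_of_ge {q : ℝ} (hn : 1 ≤ n) (hq : n ≤ q)
    (h : ∃ C, IsGNConstant n n C) : ∃ C, IsGNConstant n q C := by
  obtain ⟨C, hC, h⟩ := h
  have hn0 : (0 : ℝ) < n := by exact_mod_cast hn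
  have hq0 : 0 < q := by linarith
  have hθ : n / q ≤ 1 := by rw [div_le_one hq0]; exact hq
  refine ⟨C ^ (n / q), ENNReal.rpow_ne_top_of_nonneg (by positivity) hC, fun w g hg => ?_⟩
  have hw := (smoothFun.continuous w).measurable.enorm
  have h1 := h w (fun x => g x ^ (q / n)) (hg.pow_const _)
  set I := ∫⁻ x, ‖(w : Torus n → ℝ) x‖ₑ ^ 2 with hI
  set H := ∫⁻ x, jetNorm w x ^ 2
  have h2 := ENNReal.lintegral_mul_norm_pow_le (μ := volume)
    (f := fun x => g x ^ (q / n) * ‖(w : Torus n → ℝ) x‖ₑ ^ 2)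
    ((hg.pow_const (q / n)).mul (hw.pow_const 2).aemeasurable) (hw.pow_const 2).aemeasurable
    (p := n / q) (q := 1 - n / q) (by positivity) (by linarith) (by ring)
  calc _ = ∫⁻ x, (g x ^ (q / n) * ‖(w : Torus n → ℝ) x‖ₑ ^ 2) ^ (n / q) *
          (‖(w : Torus n → ℝ) x‖ₑ ^ 2) ^ (1 - n / q) := by
        congr 1; ext x
        rw [ENNReal.mul_rpow_of_nonneg _ _ (by positivity), ← ENNReal.rpow_mul, mul_assoc,
          ← ENNReal.rpow_add_of_nonneg _ _ (by positivity) (by linarith)]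
        rw [show q / n * (n / q) = 1 by field_simp]
        simp
    _ ≤ _ := h2
    _ ≤ (C * (∫⁻ x, (g x ^ (q / n)) ^ (n : ℝ)) ^ (1 / (n : ℝ)) *
          (I ^ (1 - (n : ℝ) / (2 * n)) * H ^ ((n : ℝ) / (2 * n)))) ^ (n / q) *
          I ^ (1 - n / q) := by gcongr
    _ = _ := by
        simp only [← ENNReal.rpow_mul]
        rw [show q / n * n = q by field_simp, show (n : ℝ) / (2 * n) = 1 / 2 by field_simp]
        rw [ENNReal.mul_rpow_of_nonneg _ _ (by positivity),
          ENNReal.mul_rpow_of_nonneg _ _ (by positivity),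
          ENNReal.mul_rpow_of_nonneg _ _ (by positivity), ← ENNReal.rpow_mul,
          ← ENNReal.rpow_mul, ← ENNReal.rpow_mul]
        rw [show 1 - n / (2 * q) = (1 - 1 / 2) * (n / q) + (1 - n / q) by field_simp; ring]
        rw [ENNReal.rpow_add_of_nonneg _ _ (by positivity) (by linarith)]
        rw [show 1 / (n : ℝ) * (n / q) = 1 / q by field_simp,
          show 1 / 2 * (n / q) = n / (2 * q) by field_simp]
        ring

lemma exists_isGNConstant {q : ℝ} (h : (2 ≤ n ∧ (n : ℝ) / 2 < q) ∨ (n = 1 ∧ 1 ≤ q)) :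
    ∃ C, IsGNConstant n q C := by
  rcases h with ⟨hn, hq⟩ | ⟨rfl, hq⟩
  · rcases le_total q n with hqn | hqn
    · exact exists_isGNConstant_of_le hn hq hqn
    · refine exists_isGNConstant_of_ge (by omega) hqn (exists_isGNConstant_of_le hn ?_ le_rfl)
      have : (2 : ℝ) ≤ n := by exact_mod_cast hn
      linarith
  · exact exists_isGNConstant_of_ge le_rfl (by simpa using hq)
      (by simpa using exists_isGNConstant_one)

end

end FokkerPlanck

namespace FokkerPlanck

noncomputable section

/-! ### Convergence in `L²` -/

section L2

variable {α : Type*} [MeasurableSpace α] {μ : Measure α}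

/-- `fm m` converges to `f` in `L²`. -/
structure L2Lim (μ : Measure α) (fm : ℕ → α → ℝ) (f : α → ℝ) : Prop where
  memLp_seq : ∀ m, MemLp (fm m) 2 μ
  memLp : MemLp f 2 μ
  tendsto : Filter.Tendsto (fun m => eLpNorm (fun x => fm m x - f x) 2 μ) Filter.atTop (nhds 0)

namespace L2Lim

variable {fm gm : ℕ → α → ℝ} {f g : α → ℝ}

lemma comp_tendsto (h : L2Lim μ fm f) {ns : ℕ → ℕ}
    (hns : Filter.Tendsto ns Filter.atTop Filter.atTop) :
    L2Lim μ (fun m => fm (ns m)) f :=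
  ⟨fun _ => h.1 _, h.2, h.3.comp hns⟩

lemma exists_ae_subseq (h : L2Lim μ fm f) : ∃ ns : ℕ → ℕ, StrictMono ns ∧
    ∀ᵐ x ∂μ, Filter.Tendsto (fun m => fm (ns m) x) Filter.atTop (nhds (f x)) :=
  (tendstoInMeasure_of_tendsto_eLpNorm (by simp) (fun m => (h.1 m).1) h.2.1
    h.3).exists_seq_tendsto_ae

lemma of_le {C : ℝ} (hf : ∀ m, MemLp (fm m) 2 μ) (hf' : MemLp f 2 μ) (hg : L2Lim μ gm g)
    (h : ∀ m, ∀ᵐ x ∂μ, |fm m x - f x| ≤ C * |gm m x - g x|) : L2Lim μ fm f := by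
  refine ⟨hf, hf', ?_⟩
  have h1 : Filter.Tendsto (fun m => ENNReal.ofReal C *
      eLpNorm (fun x => gm m x - g x) 2 μ) Filter.atTop (nhds (ENNReal.ofReal C * 0)) :=
    ENNReal.Tendsto.const_mul hg.3 (Or.inr (by simp))
  rw [mul_zero] at h1
  exact tendsto_of_tendsto_of_tendsto_of_le_of_le tendsto_const_nhds h1 (fun _ => zero_le)
    fun m => eLpNorm_le_mul_eLpNorm_of_ae_le_mul (h m) 2

lemma add (h : L2Lim μ fm f) (h' : L2Lim μ gm g) :
    L2Lim μ (fun m x => fm m x + gm m x) (fun x => f x + g x) := by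
  refine ⟨fun m => (h.1 m).add (h'.1 m), h.2.add h'.2, ?_⟩
  have h1 := h.3.add h'.3
  rw [add_zero] at h1
  refine tendsto_of_tendsto_of_tendsto_of_le_of_le tendsto_const_nhds h1 (fun _ => zero_le)
    fun m => ?_
  have h2 := eLpNorm_add_le ((h.1 m).sub h.2).1 ((h'.1 m).sub h'.2).1 (p := 2) (by norm_num)
  refine le_trans (le_of_eq ?_) h2
  congr 1; ext x; simp only [Pi.add_apply, Pi.sub_apply]; ring

lemma const (hf : MemLp f 2 μ) : L2Lim μ (fun _ => f) f :=
  ⟨fun _ => hf, hf, by simp⟩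

lemma mul_bdd (h : L2Lim μ fm f) {c : α → ℝ} {C : ℝ} (hc : AEStronglyMeasurable c μ)
    (hC : ∀ x, |c x| ≤ C) : L2Lim μ (fun m x => c x * fm m x) (fun x => c x * f x) := by
  have h1 : ∀ {u : α → ℝ}, MemLp u 2 μ → MemLp (fun x => c x * u x) 2 μ := fun hu =>
    hu.of_le_mul (c := C) (hc.mul hu.1) (.of_forall fun x => by
      rw [norm_mul]; exact mul_le_mul_of_nonneg_right (hC x) (norm_nonneg _))
  refine of_le (C := C) (fun m => h1 (h.1 m)) (h1 h.2) h fun m => .of_forall fun x => ?_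
  rw [← mul_sub, abs_mul]
  exact mul_le_mul_of_nonneg_right (hC x) (abs_nonneg _)

lemma neg (h : L2Lim μ fm f) : L2Lim μ (fun m x => -fm m x) (fun x => -f x) := by
  have := h.mul_bdd (c := fun _ => -1) (C := 1) aestronglyMeasurable_const (by simp)
  simpa using this

lemma sub (h : L2Lim μ fm f) (h' : L2Lim μ gm g) :
    L2Lim μ (fun m x => fm m x - gm m x) (fun x => f x - g x) := by
  simpa [sub_eq_add_neg] using h.add h'.neg

lemma tendsto_eLpNorm (h : L2Lim μ fm f) :
    Filter.Tendsto (fun m => eLpNorm (fm m) 2 μ) Filter.atTop (nhds (eLpNorm f 2 μ)) := by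
  have h1 : Filter.Tendsto (fun m => eLpNorm f 2 μ - eLpNorm (fun x => fm m x - f x) 2 μ)
      Filter.atTop (nhds (eLpNorm f 2 μ - 0)) :=
    ENNReal.Tendsto.sub tendsto_const_nhds h.3 (Or.inr (by simp))
  have h2 : Filter.Tendsto (fun m => eLpNorm f 2 μ + eLpNorm (fun x => fm m x - f x) 2 μ)
      Filter.atTop (nhds (eLpNorm f 2 μ + 0)) := tendsto_const_nhds.add h.3
  rw [tsub_zero] at h1
  rw [add_zero] at h2
  refine tendsto_of_tendsto_of_tendsto_of_le_of_le h1 h2 (fun m => ?_) fun m => ?_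
  · rw [tsub_le_iff_right]
    have h3 := eLpNorm_sub_le (h.1 m).1 ((h.1 m).sub h.2).1 (p := 2) (by norm_num)
    refine le_trans (le_of_eq ?_) h3
    congr 1; ext x; simp
  · have h3 := eLpNorm_add_le h.2.1 ((h.1 m).sub h.2).1 (p := 2) (by norm_num)
    refine le_trans (le_of_eq ?_) h3
    congr 1; ext x; simp

lemma tendsto_integral_mul (h : L2Lim μ fm f) (hg : MemLp g 2 μ) :
    Filter.Tendsto (fun m => ∫ x, g x * fm m x ∂μ) Filter.atTop (nhds (∫ x, g x * f x ∂μ)) := by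
  refine tendsto_integral_of_L1' _ (hg.1.mul h.2.1)
    (.of_forall fun m => hg.integrable_mul (h.1 m)) ?_
  have h1 : Filter.Tendsto (fun m => eLpNorm g 2 μ * eLpNorm (fun x => fm m x - f x) 2 μ)
      Filter.atTop (nhds (eLpNorm g 2 μ * 0)) :=
    ENNReal.Tendsto.const_mul h.3 (Or.inr hg.2.ne)
  rw [mul_zero] at h1
  refine tendsto_of_tendsto_of_tendsto_of_le_of_le tendsto_const_nhds h1 (fun _ => zero_le)
    fun m => ?_
  have h2 := eLpNorm_smul_le_mul_eLpNorm (p := 2) (q := 2) (r := 1) ((h.1 m).sub h.2).1 hg.1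
  refine le_trans (le_of_eq ?_) h2
  congr 1; ext x; simp only [Pi.sub_apply, Pi.mul_apply, Pi.smul_apply', smul_eq_mul]; ring

/-- As g is only integrable, `L²` convergence is not enough by itself. Boundedness of κ allows
dominated convergence along subsequences that converge almost everywhere, which suffices. -/
lemma tendsto_integral_mul_comp (h : L2Lim μ fm f) (hg : Integrable g μ) {κ : ℝ → ℝ}
    (hκ : Continuous κ) {C : ℝ} (hC : ∀ s, |κ s| ≤ C) :
    Filter.Tendsto (fun m => ∫ x, g x * κ (fm m x) ∂μ) Filter.atTop
      (nhds (∫ x, g x * κ (f x) ∂μ)) := by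
  refine Filter.tendsto_of_subseq_tendsto fun ns hns => ?_
  obtain ⟨ms, -, hms⟩ := (h.comp_tendsto hns).exists_ae_subseq
  refine ⟨ms, tendsto_integral_of_dominated_convergence (fun x => ‖g x‖ * C)
    (fun m => hg.1.mul (hκ.comp_aestronglyMeasurable (h.1 _).1)) (hg.norm.mul_const C)
    (fun m => .of_forall fun x => ?_) ?_⟩
  · rw [norm_mul]
    exact mul_le_mul_of_nonneg_left (hC _) (norm_nonneg _)
  · filter_upwards [hms] with x hx
    exact ((hκ.tendsto _).comp hx).const_mul _

/-- The difference splits as κ(fₘ)(gₘ - g) + (κ(fₘ) - κ(f)) g: the first part is controlled by the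
bound on κ, the second by dominated convergence along subsequences. This gives convergence of
gradients in the chain rule. -/
lemma comp_mul (h : L2Lim μ fm f) (hg : L2Lim μ gm g) {κ : ℝ → ℝ} (hκ : Continuous κ) {C : ℝ}
    (hC : ∀ s, |κ s| ≤ C) :
    L2Lim μ (fun m x => κ (fm m x) * gm m x) (fun x => κ (f x) * g x) := by
  have hb : ∀ {u v : α → ℝ}, AEStronglyMeasurable u μ → MemLp v 2 μ →
      MemLp (fun x => κ (u x) * v x) 2 μ := fun hu hv =>
    hv.of_le_mul (c := C) ((hκ.comp_aestronglyMeasurable hu).mul hv.1) (.of_forall fun x => by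
      rw [norm_mul]; exact mul_le_mul_of_nonneg_right (hC _) (norm_nonneg _))
  have h1 : L2Lim μ (fun m x => κ (fm m x) * (gm m x - g x)) (fun x => 0) :=
    of_le (C := C) (fun m => hb (h.1 m).1 ((hg.1 m).sub hg.2)) MemLp.zero hg
      fun m => .of_forall fun x => by
        rw [sub_zero, abs_mul]; exact mul_le_mul_of_nonneg_right (hC _) (abs_nonneg _)
  have h2 : L2Lim μ (fun m x => κ (fm m x) * g x) (fun x => κ (f x) * g x) := by
    refine ⟨fun m => hb (h.1 m).1 hg.2, hb h.2.1 hg.2,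
      Filter.tendsto_of_subseq_tendsto fun ns hns => ?_⟩
    obtain ⟨ms, -, hms⟩ := (h.comp_tendsto hns).exists_ae_subseq
    refine ⟨ms, ?_⟩
    simp only [SmoothingKernel.eLpNorm_two_eq]
    have h3 : Filter.Tendsto (fun m => ∫⁻ x, ‖κ (fm (ns (ms m)) x) * g x - κ (f x) * g x‖ₑ ^ 2 ∂μ)
        Filter.atTop (nhds (∫⁻ _, 0 ∂μ)) := by
      refine tendsto_lintegral_of_dominated_convergence'
        (fun x => (ENNReal.ofReal (2 * C) * ‖g x‖ₑ) ^ 2)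
        (fun m => ((hb (h.1 _).1 hg.2).sub (hb h.2.1 hg.2)).1.enorm.pow_const 2)
        (fun m => .of_forall fun x => ?_) ?_ ?_
      · simp only
        gcongr
        rw [← sub_mul, enorm_mul]
        gcongr
        rw [← ofReal_norm, Real.norm_eq_abs]
        refine ENNReal.ofReal_le_ofReal ((abs_sub _ _).trans ?_)
        linarith [hC (κ (fm (ns (ms m)) x)), hC (fm (ns (ms m)) x), hC (f x)]
      · simp only [mul_pow]
        have hc : ENNReal.ofReal (2 * C) ^ 2 ≠ ⊤ := ENNReal.pow_ne_top ENNReal.ofReal_ne_top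
        rw [lintegral_const_mul' _ _ hc]
        refine ENNReal.mul_ne_top hc ?_
        have := hg.2.2
        rw [SmoothingKernel.eLpNorm_two_eq] at this
        intro ht
        rw [ht] at this
        simp at this
      · filter_upwards [hms] with x hx
        have h4 : Filter.Tendsto (fun m => κ (fm (ns (ms m)) x) * g x - κ (f x) * g x)
            Filter.atTop (nhds 0) := by
          have := (((hκ.tendsto _).comp hx).mul_const (g x)).sub_const (κ (f x) * g x)
          simpa using this
        simpa [Function.comp_def] using
          ((ENNReal.continuous_pow 2).comp continuous_enorm).tendsto 0 |>.comp h4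
    rw [lintegral_zero] at h3
    simpa using h3.ennrpow_const (1 / 2)
  have h3 := h1.add h2
  convert h3 using 3 <;> ring

lemma comp_lipschitz [IsFiniteMeasure μ] (h : L2Lim μ fm f) {κ : ℝ → ℝ} {C : NNReal}
    (hκ : LipschitzWith C κ) : L2Lim μ (fun m x => κ (fm m x)) (fun x => κ (f x)) := by
  have hb : ∀ {u : α → ℝ}, MemLp u 2 μ → MemLp (fun x => κ (u x)) 2 μ := fun {u} hu => by
    have h1 : MemLp (fun x => κ (u x) - κ 0) 2 μ :=
      hu.of_le_mul (c := C) ((hκ.continuous.comp_aestronglyMeasurable hu.1).sub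
        aestronglyMeasurable_const) (.of_forall fun x => by
          simpa [Real.dist_eq] using hκ.dist_le_mul (u x) 0)
    simpa [Pi.add_def] using h1.add (memLp_const (κ 0))
  refine of_le (C := C) (fun m => hb (h.1 m)) (hb h.2) h fun m => .of_forall fun x => ?_
  simpa [Real.dist_eq] using hκ.dist_le_mul (fm m x) (f x)

end L2Lim

end L2

variable {n : ℕ}

lemma L2Lim.avg {f : Torus n → ℝ} (hf : MemLp f 2 volume) :
    L2Lim volume (fun m => ((peakKernel m).avg f : Torus n → ℝ)) f :=
  ⟨fun _ => smoothFun.memLp _ 2, hf, tendsto_eLpNorm_avg_sub hf⟩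

/-- Averaging is a contraction uniformly in m, so averaging the error fₘ - f does no harm. It serves
the test functions, which are averaged twice. -/
lemma L2Lim.avg_seq {fm : ℕ → Torus n → ℝ} {f : Torus n → ℝ} (h : L2Lim volume fm f) :
    L2Lim volume (fun m => ((peakKernel m).avg (fm m) : Torus n → ℝ)) f := by
  have h1 : L2Lim volume (fun m => ((peakKernel m).avg (fun x => fm m x - f x) : Torus n → ℝ))
      (fun _ => 0) := by
    refine ⟨fun _ => smoothFun.memLp _ 2, MemLp.zero, ?_⟩
    refine tendsto_of_tendsto_of_tendsto_of_le_of_le tendsto_const_nhds h.3 (fun _ => zero_le)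
      fun m => ?_
    have h2 := SmoothingKernel.eLpNorm_avg_le (peakKernel m) ((h.1 m).sub h.2)
    simp only [sub_zero]
    exact h2
  have h2 := h1.add (L2Lim.avg h.2)
  have h3 : ∀ m x, ((peakKernel m).avg (fun x => fm m x - f x) : Torus n → ℝ) x +
      ((peakKernel m).avg f : Torus n → ℝ) x = ((peakKernel m).avg (fm m) : Torus n → ℝ) x := by
    intro m x
    rw [SmoothingKernel.avg_sub _ ((h.1 m).integrable (by norm_num))
      (h.2.integrable (by norm_num))]
    ring
  simpa [h3] using h2

/-! ### Strong limits of smooth functions in `H¹` -/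

/-- The smooth functions `wm m` converge to `w` in `H¹`, and `W` is the gradient of `w`. -/
structure H1Lim (wm : ℕ → smoothFun n) (w : Torus n → ℝ) (W : Fin n → Torus n → ℝ) : Prop where
  fn : L2Lim volume (fun m => (wm m : Torus n → ℝ)) w
  grad : ∀ i, L2Lim volume (fun m => partialDeriv i (wm m : Torus n → ℝ)) (W i)

lemma H1Lim.avg {u : Torus n → ℝ} {G : Fin n → Torus n → ℝ} (hu : MemLp u 2 volume)
    (hG : ∀ i, MemLp (G i) 2 volume)
    (h : ∀ ψ : smoothFun n, ∀ i,
      ∫ x, u x * partialDeriv i (ψ : Torus n → ℝ) x = -∫ x, G i x * (ψ : Torus n → ℝ) x) :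
    H1Lim (fun m => (peakKernel m).avg u) u G := by
  refine ⟨L2Lim.avg hu, fun i => ?_⟩
  have := L2Lim.avg (hG i)
  have h1 : ∀ m, partialDeriv i ((peakKernel m).avg u : Torus n → ℝ) =
      ((peakKernel m).avg (G i) : Torus n → ℝ) := fun m => funext fun x =>
    SmoothingKernel.partialDeriv_avg _ (hu.integrable (by norm_num)) (fun ψ => h ψ i) x
  simpa [h1] using this

lemma lipschitzWith_of_abs_deriv_le {γ : ℝ → ℝ} (hγ : ContDiff ℝ ∞ γ) {C : ℝ}
    (hC : ∀ s, |deriv γ s| ≤ C) : LipschitzWith C.toNNReal γ :=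
  lipschitzWith_of_nnnorm_deriv_le (hγ.differentiable (by simp)) fun s => by
    rw [← NNReal.coe_le_coe, coe_nnnorm, Real.coe_toNNReal _ ((abs_nonneg _).trans (hC 0))]
    exact hC s

lemma H1Lim.comp {wm : ℕ → smoothFun n} {w : Torus n → ℝ} {W : Fin n → Torus n → ℝ}
    (h : H1Lim wm w W) {γ : ℝ → ℝ} (hγ : ContDiff ℝ ∞ γ) {C : ℝ} (hC : ∀ s, |deriv γ s| ≤ C) :
    H1Lim (fun m => smoothFun.comp γ hγ (wm m)) (fun x => γ (w x))
      (fun i x => deriv γ (w x) * W i x) := by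
  refine ⟨h.fn.comp_lipschitz (lipschitzWith_of_abs_deriv_le hγ hC), fun i => ?_⟩
  have h1 := h.fn.comp_mul (h.grad i) (hγ.continuous_deriv (by simp)) hC
  have h2 : ∀ m, partialDeriv i (smoothFun.comp γ hγ (wm m) : Torus n → ℝ) =
      fun x => deriv γ ((wm m : Torus n → ℝ) x) * partialDeriv i (wm m : Torus n → ℝ) x :=
    fun m => funext fun x => smoothFun.partialDeriv_comp γ hγ (wm m) i x
  simpa [h2] using h1

lemma smoothFun.exists_bound (ψ : smoothFun n) : ∃ C, ∀ x, |(ψ : Torus n → ℝ) x| ≤ C := by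
  obtain ⟨C, hC⟩ := isCompact_univ.exists_bound_of_continuousOn
    (smoothFun.continuous ψ).continuousOn
  exact ⟨C, fun x => hC x trivial⟩

lemma H1Lim.mul {wm : ℕ → smoothFun n} {w : Torus n → ℝ} {W : Fin n → Torus n → ℝ}
    (h : H1Lim wm w W) (ψ : smoothFun n) :
    H1Lim (fun m => smoothFun.mul ψ (wm m)) (fun x => (ψ : Torus n → ℝ) x * w x)
      (fun i x => partialDeriv i (ψ : Torus n → ℝ) x * w x + (ψ : Torus n → ℝ) x * W i x) := by
  obtain ⟨C, hC⟩ := smoothFun.exists_bound ψ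
  refine ⟨h.fn.mul_bdd (smoothFun.continuous ψ).aestronglyMeasurable hC, fun i => ?_⟩
  obtain ⟨C', hC'⟩ := smoothFun.exists_bound (smoothFun.pderiv i ψ)
  have h1 := (h.fn.mul_bdd (smoothFun.continuous_partialDeriv ψ i).aestronglyMeasurable hC').add
    ((h.grad i).mul_bdd (smoothFun.continuous ψ).aestronglyMeasurable hC)
  have h2 : ∀ m, partialDeriv i (smoothFun.mul ψ (wm m) : Torus n → ℝ) = fun x =>
      partialDeriv i (ψ : Torus n → ℝ) x * (wm m : Torus n → ℝ) x +
        (ψ : Torus n → ℝ) x * partialDeriv i (wm m : Torus n → ℝ) x :=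
    fun m => funext fun x => smoothFun.partialDeriv_mul ψ (wm m) i x
  simpa [h2] using h1

lemma partialDeriv_sub (ψ φ : smoothFun n) (i : Fin n) (x : Torus n) :
    partialDeriv i ((ψ - φ : smoothFun n) : Torus n → ℝ) x =
      partialDeriv i (ψ : Torus n → ℝ) x - partialDeriv i (φ : Torus n → ℝ) x := by
  simpa [partialDeriv, Pi.sub_def] using
    ((smoothFun.hasDerivAt_line_zero ψ i x).sub (smoothFun.hasDerivAt_line_zero φ i x)).deriv

lemma H1Lim.const_sub {wm : ℕ → smoothFun n} {w : Torus n → ℝ} {W : Fin n → Torus n → ℝ}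
    (h : H1Lim wm w W) (ψ : smoothFun n) :
    H1Lim (fun m => ψ - wm m) (fun x => (ψ : Torus n → ℝ) x - w x)
      (fun i x => partialDeriv i (ψ : Torus n → ℝ) x - W i x) := by
  refine ⟨(L2Lim.const (smoothFun.memLp ψ 2)).sub h.fn, fun i => ?_⟩
  have h1 := (L2Lim.const (smoothFun.memLp_partialDeriv ψ i 2)).sub (h.grad i)
  have h2 : ∀ m, partialDeriv i ((ψ - wm m : smoothFun n) : Torus n → ℝ) = fun x =>
      partialDeriv i (ψ : Torus n → ℝ) x - partialDeriv i (wm m : Torus n → ℝ) x :=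
    fun m => funext fun x => partialDeriv_sub ψ (wm m) i x
  simp only [h2]
  exact h1

/-! ### Gagliardo–Nirenberg inequalities in `H¹` -/

/-- The sum of the `L²` norms of a function and of the components of its gradient. -/
def h1Size (w : Torus n → ℝ) (W : Fin n → Torus n → ℝ) : ℝ≥0∞ :=
  eLpNorm w 2 volume + ∑ i, eLpNorm (W i) 2 volume

lemma lintegral_enorm_sq {α : Type*} [MeasurableSpace α] (μ : Measure α) (f : α → ℝ) :
    ∫⁻ x, ‖f x‖ₑ ^ 2 ∂μ = eLpNorm f 2 μ ^ 2 := by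
  rw [SmoothingKernel.eLpNorm_two_eq, ← ENNReal.rpow_natCast, ← ENNReal.rpow_mul]
  norm_num

lemma lintegral_jetNorm_sq_le (w : smoothFun n) :
    ∫⁻ x, jetNorm w x ^ 2 ≤ h1Size w (fun i => partialDeriv i (w : Torus n → ℝ)) ^ 2 := by
  have h1 : ∀ x, jetNorm w x = ‖(fun x => ‖(w : Torus n → ℝ) x‖) x +
      (∑ i, fun x => ‖partialDeriv i (w : Torus n → ℝ) x‖) x‖ₑ := by
    intro x
    rw [Finset.sum_apply, Real.enorm_of_nonneg (by positivity),
      ENNReal.ofReal_add (by positivity) (by positivity),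
      ENNReal.ofReal_sum_of_nonneg fun _ _ => by positivity]
    simp only [ofReal_norm, jetNorm]
  simp only [h1]
  have h2 := lintegral_enorm_sq volume ((fun x => ‖(w : Torus n → ℝ) x‖) +
      (∑ i, fun x => ‖partialDeriv i (w : Torus n → ℝ) x‖))
  simp only [Pi.add_apply] at h2
  rw [h2]
  have h3 : AEStronglyMeasurable (fun x => ‖(w : Torus n → ℝ) x‖) volume :=
    (smoothFun.continuous w).norm.aestronglyMeasurable
  have h4 : ∀ i, AEStronglyMeasurable (fun x => ‖partialDeriv i (w : Torus n → ℝ) x‖) volume :=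
    fun i => (smoothFun.continuous_partialDeriv w i).norm.aestronglyMeasurable
  gcongr
  refine (eLpNorm_add_le h3 (Finset.aestronglyMeasurable_sum _ fun i _ => h4 i)
    (by norm_num)).trans (add_le_add (eLpNorm_norm _).le ?_)
  refine (eLpNorm_sum_le (fun i _ => h4 i) (by norm_num)).trans (Finset.sum_le_sum fun i _ => ?_)
  exact (eLpNorm_norm _).le

lemma H1Lim.tendsto_h1Size {wm : ℕ → smoothFun n} {w : Torus n → ℝ} {W : Fin n → Torus n → ℝ}
    (h : H1Lim wm w W) :
    Filter.Tendsto (fun m => h1Size (wm m) (fun i => partialDeriv i (wm m : Torus n → ℝ)))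
      Filter.atTop (nhds (h1Size w W)) :=
  h.fn.tendsto_eLpNorm.add (tendsto_finsetSum _ fun i _ => (h.grad i).tendsto_eLpNorm)

lemma H1Lim.h1Size_ne_top {wm : ℕ → smoothFun n} {w : Torus n → ℝ} {W : Fin n → Torus n → ℝ}
    (h : H1Lim wm w W) : h1Size w W ≠ ⊤ := by
  simp only [h1Size, ne_eq, ENNReal.add_eq_top, ENNReal.sum_eq_top, not_or, not_exists]
  exact ⟨h.fn.2.2.ne, fun i hi => (h.grad i).2.2.ne hi.2⟩

/-- The Gagliardo–Nirenberg inequality for functions in `H¹`. -/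
def HasGN (n : ℕ) (q : ℝ≥0∞) (θ : ℝ) (C : ℝ≥0∞) : Prop :=
  C ≠ ⊤ ∧ ∀ (wm : ℕ → smoothFun n) (w : Torus n → ℝ) (W : Fin n → Torus n → ℝ), H1Lim wm w W →
    ∀ g : Torus n → ℝ, AEStronglyMeasurable g volume → eLpNorm g q volume ≠ ⊤ →
      ∫⁻ x, ‖g x‖ₑ * ‖w x‖ₑ ^ 2 ≤ C * eLpNorm g q volume *
        ((eLpNorm w 2 volume ^ 2) ^ (1 - θ) * (h1Size w W ^ 2) ^ θ)

/-- Fatou's lemma along an almost everywhere convergent subsequence; nothing beyond measurability is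
needed of g. -/
lemma lintegral_mul_sq_le_liminf {wm : ℕ → Torus n → ℝ} {w : Torus n → ℝ}
    (h : L2Lim volume wm w) {g : Torus n → ℝ} (hg : AEStronglyMeasurable g volume)
    {R : ℕ → ℝ≥0∞} {R' : ℝ≥0∞} (hR : Filter.Tendsto R Filter.atTop (nhds R'))
    (hle : ∀ m, ∫⁻ x, ‖g x‖ₑ * ‖wm m x‖ₑ ^ 2 ≤ R m) :
    ∫⁻ x, ‖g x‖ₑ * ‖w x‖ₑ ^ 2 ≤ R' := by
  obtain ⟨ns, hns, hae⟩ := h.exists_ae_subseq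
  calc ∫⁻ x, ‖g x‖ₑ * ‖w x‖ₑ ^ 2
      = ∫⁻ x, Filter.liminf (fun m => ‖g x‖ₑ * ‖wm (ns m) x‖ₑ ^ 2) Filter.atTop := by
        refine lintegral_congr_ae ?_
        filter_upwards [hae] with x hx
        have h1 : Filter.Tendsto (fun m => ‖wm (ns m) x‖ₑ ^ 2) Filter.atTop
            (nhds (‖w x‖ₑ ^ 2)) :=
          (((ENNReal.continuous_pow 2).comp continuous_enorm).tendsto (w x)).comp hx
        exact (ENNReal.Tendsto.const_mul h1 (Or.inr (by simp))).liminf_eq.symm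
    _ ≤ Filter.liminf (fun m => ∫⁻ x, ‖g x‖ₑ * ‖wm (ns m) x‖ₑ ^ 2) Filter.atTop :=
        lintegral_liminf_le' fun m => hg.enorm.mul ((h.1 _).1.enorm.pow_const 2)
    _ ≤ Filter.liminf (fun m => R (ns m)) Filter.atTop :=
        Filter.liminf_le_liminf (.of_forall fun m => hle _)
    _ = R' := (hR.comp hns.tendsto_atTop).liminf_eq

lemma IsGNConstant.hasGN {q : ℝ≥0∞} (hq0 : q ≠ 0) (hq : q ≠ ⊤) {C : ℝ≥0∞}
    (h : IsGNConstant n q.toReal C) (hθ : (n : ℝ) / (2 * q.toReal) ≤ 1) :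
    HasGN n q (n / (2 * q.toReal)) C := by
  refine ⟨h.1, fun wm w W hw g hg hgt => ?_⟩
  have hθ0 : 0 ≤ (n : ℝ) / (2 * q.toReal) := by positivity
  set θ := (n : ℝ) / (2 * q.toReal) with hθd
  refine lintegral_mul_sq_le_liminf hw.fn hg
    (R := fun m => C * eLpNorm g q volume * ((eLpNorm (wm m : Torus n → ℝ) 2 volume ^ 2) ^ (1 - θ) *
      (h1Size (wm m) (fun i => partialDeriv i (wm m : Torus n → ℝ)) ^ 2) ^ θ)) ?_ fun m => ?_
  · refine ENNReal.Tendsto.const_mul ?_ (Or.inr (ENNReal.mul_ne_top h.1 hgt))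
    have hA : eLpNorm w 2 volume ^ 2 ≠ ⊤ := ENNReal.pow_ne_top hw.fn.2.2.ne
    have hB : h1Size w W ^ 2 ≠ ⊤ := ENNReal.pow_ne_top hw.h1Size_ne_top
    refine ENNReal.Tendsto.mul ?_ (Or.inr ?_) ?_ (Or.inr ?_)
    · exact (((ENNReal.continuous_pow 2).tendsto _).comp hw.fn.tendsto_eLpNorm).ennrpow_const _
    · exact ENNReal.rpow_ne_top_of_nonneg hθ0 hB
    · exact (((ENNReal.continuous_pow 2).tendsto _).comp hw.tendsto_h1Size).ennrpow_const _
    · exact ENNReal.rpow_ne_top_of_nonneg (by linarith) hA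
  · refine (h.2 (wm m) (fun x => ‖g x‖ₑ) hg.enorm).trans ?_
    rw [← eLpNorm_eq_lintegral_rpow_enorm_toReal hq0 hq, lintegral_enorm_sq]
    gcongr
    exact lintegral_jetNorm_sq_le _

lemma hasGN_top : HasGN n ⊤ 0 1 := by
  refine ⟨by simp, fun wm w W hw g hg hgt => ?_⟩
  simp only [sub_zero, ENNReal.rpow_one, ENNReal.rpow_zero, mul_one, one_mul]
  rw [← lintegral_enorm_sq, ← lintegral_const_mul'' _ (hw.fn.2.1.enorm.pow_const 2)]
  refine lintegral_mono_ae ?_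
  filter_upwards [enorm_ae_le_eLpNormEssSup g volume] with x hx
  rw [eLpNorm_exponent_top]
  gcongr

/-- The exponent is θ = n/(2q), and 0 for q = ∞. The condition n/(2q) + 1/r ≤ 1 is exactly 1/(1-θ) ≤
r. -/
lemma AdmissibleExponents.exists_hasGN {r q : ℝ≥0∞} (h : AdmissibleExponents n r q) :
    1 ≤ q ∧ ∃ θ : ℝ, 0 ≤ θ ∧ θ < 1 ∧ ENNReal.ofReal (1 / (1 - θ)) ≤ r ∧ ∃ C, HasGN n q θ C := by
  obtain ⟨h1, h2⟩ := h
  have hr1 : 1 ≤ r := by rcases h2 with h2 | h2 <;> exact h2.2.1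
  rcases eq_or_ne q ⊤ with rfl | hq
  · exact ⟨le_top, 0, le_rfl, zero_lt_one, by simpa using hr1, 1, hasGN_top⟩
  have hq1 : 1 ≤ q := by
    rcases h2 with h2 | h2
    · refine le_trans ?_ h2.2.2.2.le
      rw [ENNReal.le_div_iff_mul_le (by simp) (by simp), one_mul]
      exact_mod_cast h2.1
    · exact h2.2.2.2
  have hq0 : q ≠ 0 := (zero_lt_one.trans_le hq1).ne'
  have hqr : 0 < q.toReal := ENNReal.toReal_pos hq0 hq
  have h3 : (2 ≤ n ∧ (n : ℝ) / 2 < q.toReal) ∨ (n = 1 ∧ 1 ≤ q.toReal) := by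
    rcases h2 with h2 | h2
    · refine Or.inl ⟨h2.1, ?_⟩
      have := (ENNReal.toReal_lt_toReal (ENNReal.div_ne_top (by simp) (by simp)) hq).2 h2.2.2.2
      simpa using this
    · refine Or.inr ⟨h2.1, ?_⟩
      simpa using (ENNReal.toReal_le_toReal (by simp) hq).2 hq1
  have hθ : (n : ℝ) / (2 * q.toReal) < 1 := by
    rw [div_lt_one (by positivity)]
    rcases h3 with h3 | h3
    · linarith [h3.2]
    · rw [h3.1]; push_cast; linarith [h3.2]
  obtain ⟨C, hC⟩ := exists_isGNConstant h3
  refine ⟨hq1, n / (2 * q.toReal), by positivity, hθ, ?_, C, hC.hasGN hq0 hq hθ.le⟩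
  have e : (n : ℝ≥0∞) / (2 * q) = ENNReal.ofReal (n / (2 * q.toReal)) := by
    rw [ENNReal.ofReal_div_of_pos (by positivity), ENNReal.ofReal_mul (by norm_num),
      ENNReal.ofReal_toReal hq]
    simp
  rw [e] at h1
  have h4 : r⁻¹ ≤ ENNReal.ofReal (1 - n / (2 * q.toReal)) := by
    rw [ENNReal.ofReal_sub _ (by positivity), ENNReal.ofReal_one]
    rw [one_div] at h1
    exact ENNReal.le_sub_of_add_le_left ENNReal.ofReal_ne_top h1
  rw [one_div, ENNReal.ofReal_inv_of_pos (by linarith)]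
  exact ENNReal.inv_le_iff_inv_le.1 h4

/-- Young's inequality without sharp constants: P^(1-θ) R^θ ≤ P + R because both P and R are at most
P + R. The weight N makes the coefficient of B as small as desired. -/
lemma mul_rpow_mul_rpow_le {k A B N : ℝ≥0∞} {θ : ℝ} (hθ0 : 0 ≤ θ) (hθ1 : θ < 1) (hN0 : N ≠ 0)
    (hN : N ≠ ⊤) :
    k * (A ^ (1 - θ) * B ^ θ) ≤ N ^ (θ / (1 - θ)) * k ^ (1 / (1 - θ)) * A + N⁻¹ * B := by
  have h1θ : 0 < 1 - θ := by linarith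
  set P := N ^ (θ / (1 - θ)) * k ^ (1 / (1 - θ)) * A
  set R := N⁻¹ * B
  have h1 : k * (A ^ (1 - θ) * B ^ θ) = P ^ (1 - θ) * R ^ θ := by
    simp only [P, R]
    rw [ENNReal.mul_rpow_of_nonneg _ _ h1θ.le, ENNReal.mul_rpow_of_nonneg _ _ h1θ.le,
      ENNReal.mul_rpow_of_nonneg _ _ hθ0, ← ENNReal.rpow_mul, ← ENNReal.rpow_mul,
      div_mul_cancel₀ _ h1θ.ne', div_mul_cancel₀ _ h1θ.ne', ENNReal.rpow_one, ENNReal.inv_rpow]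
    have h2 : N ^ θ * (N ^ θ)⁻¹ = 1 :=
      ENNReal.mul_inv_cancel (by simp [hN0, hN]) (ENNReal.rpow_ne_top_of_nonneg hθ0 hN)
    calc _ = (N ^ θ * (N ^ θ)⁻¹) * (k * (A ^ (1 - θ) * B ^ θ)) := by rw [h2, one_mul]
      _ = _ := by ring
  rw [h1]
  calc P ^ (1 - θ) * R ^ θ ≤ (P + R) ^ (1 - θ) * (P + R) ^ θ :=
        mul_le_mul' (ENNReal.rpow_le_rpow le_self_add h1θ.le)
          (ENNReal.rpow_le_rpow le_add_self hθ0)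
    _ = P + R := by
        rw [← ENNReal.rpow_add_of_nonneg _ _ h1θ.le hθ0]
        simp

lemma h1Size_sq_le (w : Torus n → ℝ) (W : Fin n → Torus n → ℝ) :
    h1Size w W ^ 2 ≤ (2 * (n + 1) : ℝ≥0∞) *
      (eLpNorm w 2 volume ^ 2 + ∑ i, eLpNorm (W i) 2 volume ^ 2) := by
  have h1 := ENNReal.rpow_sum_le_const_mul_sum_rpow Finset.univ
    (fun i => eLpNorm (W i) 2 volume) (p := 2) (by norm_num)
  have h2 := ENNReal.rpow_add_le_mul_rpow_add_rpow (eLpNorm w 2 volume)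
    (∑ i, eLpNorm (W i) 2 volume) (p := 2) (by norm_num)
  norm_num at h1 h2
  calc _ ≤ 2 * (eLpNorm w 2 volume ^ 2 + (∑ i, eLpNorm (W i) 2 volume) ^ 2) := h2
    _ ≤ 2 * (eLpNorm w 2 volume ^ 2 + n * ∑ i, eLpNorm (W i) 2 volume ^ 2) := by gcongr
    _ ≤ 2 * ((n + 1) * eLpNorm w 2 volume ^ 2 + (n + 1) * ∑ i, eLpNorm (W i) 2 volume ^ 2) := by
        gcongr
        · exact le_mul_of_one_le_left' le_add_self
        · exact le_self_add
    _ = _ := by ring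

/-- The form in which the Gagliardo–Nirenberg inequality enters the energy estimate. -/
def HasFormBound (n : ℕ) (q : ℝ≥0∞) (p : ℝ) (C : ℝ≥0∞) : Prop :=
  C ≠ ⊤ ∧ ∀ (wm : ℕ → smoothFun n) (w : Torus n → ℝ) (W : Fin n → Torus n → ℝ), H1Lim wm w W →
    ∀ g : Torus n → ℝ, AEStronglyMeasurable g volume → eLpNorm g q volume ≠ ⊤ →
      ∫⁻ x, ‖g x‖ₑ * ‖w x‖ₑ ^ 2 ≤ C * (eLpNorm g q volume ^ p + 1) * eLpNorm w 2 volume ^ 2 +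
        ∑ i, eLpNorm (W i) 2 volume ^ 2

lemma HasGN.hasFormBound {q : ℝ≥0∞} {θ : ℝ} {C : ℝ≥0∞} (h : HasGN n q θ C) (hθ0 : 0 ≤ θ)
    (hθ1 : θ < 1) : ∃ C', HasFormBound n q (1 / (1 - θ)) C' := by
  have h1θ : 0 < 1 - θ := by linarith
  -- This weight cancels the constant of `h1Size_sq_le`, so the gradient term appears with
  -- coefficient one and fits under the dissipation.
  set N : ℝ≥0∞ := 2 * (n + 1) with hN
  have hN0 : N ≠ 0 := by simp [hN]
  have hNt : N ≠ ⊤ := ENNReal.mul_ne_top (by simp) (by simp)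
  refine ⟨N ^ (θ / (1 - θ)) * C ^ (1 / (1 - θ)) + 1, ?_, fun wm w W hw g hg hgt => ?_⟩
  · refine ENNReal.add_ne_top.2 ⟨ENNReal.mul_ne_top ?_ ?_, by simp⟩
    · exact ENNReal.rpow_ne_top_of_nonneg (by positivity) hNt
    · exact ENNReal.rpow_ne_top_of_nonneg (by positivity) h.1
  set e := eLpNorm g q volume
  set A := eLpNorm w 2 volume ^ 2
  set D := ∑ i, eLpNorm (W i) 2 volume ^ 2
  have h2 : N⁻¹ * h1Size w W ^ 2 ≤ A + D := by
    calc _ ≤ N⁻¹ * (N * (A + D)) := by gcongr; exact h1Size_sq_le w W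
      _ = _ := by rw [← mul_assoc, ENNReal.inv_mul_cancel hN0 hNt, one_mul]
  calc _ ≤ _ := h.2 wm w W hw g hg hgt
    _ ≤ _ := mul_rpow_mul_rpow_le hθ0 hθ1 hN0 hNt
    _ ≤ N ^ (θ / (1 - θ)) * (C * e) ^ (1 / (1 - θ)) * A + (A + D) := by gcongr
    _ = N ^ (θ / (1 - θ)) * C ^ (1 / (1 - θ)) * e ^ (1 / (1 - θ)) * A + 1 * 1 * A + D := by
        rw [ENNReal.mul_rpow_of_nonneg C e (by positivity)]; ring
    _ ≤ (N ^ (θ / (1 - θ)) * C ^ (1 / (1 - θ)) + 1) * e ^ (1 / (1 - θ)) * A +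
          (N ^ (θ / (1 - θ)) * C ^ (1 / (1 - θ)) + 1) * 1 * A + D := by
        gcongr
        · exact le_self_add
        · exact le_add_self
    _ = _ := by ring

/-! ### Testing the divergence with functions in `H¹` -/

/-- Rests on |w| ≤ 1 + |w|². -/
lemma integrable_mul_of_lintegral_mul_sq {g w : Torus n → ℝ} (hg : Integrable g)
    (hw : AEStronglyMeasurable w volume) (h : ∫⁻ x, ‖g x‖ₑ * ‖w x‖ₑ ^ 2 ≠ ⊤) :
    Integrable (fun x => g x * w x) := by
  refine ⟨hg.1.mul hw, ?_⟩
  refine lt_of_le_of_lt (b := ∫⁻ x, (‖g x‖ₑ + ‖g x‖ₑ * ‖w x‖ₑ ^ 2))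
    (lintegral_mono fun x => ?_) ?_
  · rw [enorm_mul]
    rcases le_total ‖w x‖ₑ 1 with h1 | h1
    · exact (mul_le_of_le_one_right' h1).trans le_self_add
    · refine le_trans ?_ le_add_self
      gcongr
      rw [pow_two]; exact le_mul_of_one_le_left' h1
  · rw [lintegral_add_left' hg.1.enorm]
    exact ENNReal.add_lt_top.2 ⟨hg.2, h.lt_top⟩

lemma HasGN.lintegral_ne_top {q : ℝ≥0∞} {θ : ℝ} {C : ℝ≥0∞} (h : HasGN n q θ C) (hθ0 : 0 ≤ θ)
    (hθ1 : θ < 1) {wm : ℕ → smoothFun n} {w : Torus n → ℝ} {W : Fin n → Torus n → ℝ}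
    (hw : H1Lim wm w W) {g : Torus n → ℝ} (hg : AEStronglyMeasurable g volume)
    (hgt : eLpNorm g q volume ≠ ⊤) : ∫⁻ x, ‖g x‖ₑ * ‖w x‖ₑ ^ 2 ≠ ⊤ := by
  refine ne_top_of_le_ne_top (ENNReal.mul_ne_top (ENNReal.mul_ne_top h.1 hgt)
    (ENNReal.mul_ne_top ?_ ?_)) (h.2 wm w W hw g hg hgt)
  · exact ENNReal.rpow_ne_top_of_nonneg (by linarith) (ENNReal.pow_ne_top hw.fn.2.2.ne)
  · exact ENNReal.rpow_ne_top_of_nonneg hθ0 (ENNReal.pow_ne_top hw.h1Size_ne_top)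

/-- Cauchy–Schwarz in the form |g| |w| = |g|^(1/2) (|g| w²)^(1/2) reduces convergence to
Gagliardo–Nirenberg for the difference, whose `H¹` size tends to zero. -/
lemma HasGN.tendsto_integral_mul {q : ℝ≥0∞} {θ : ℝ} {C : ℝ≥0∞} (h : HasGN n q θ C) (hθ0 : 0 ≤ θ)
    (hθ1 : θ < 1) {wm : ℕ → smoothFun n} {w : Torus n → ℝ} {W : Fin n → Torus n → ℝ}
    (hw : H1Lim wm w W) {g : Torus n → ℝ} (hg : Integrable g)
    (hgt : eLpNorm g q volume ≠ ⊤) :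
    Filter.Tendsto (fun m => ∫ x, g x * (wm m : Torus n → ℝ) x) Filter.atTop
      (nhds (∫ x, g x * w x)) := by
  refine tendsto_integral_of_L1' _ (hg.1.mul hw.fn.2.1)
    (.of_forall fun m => integrable_mul_smoothFun hg _) ?_
  have h1 : ∀ m, eLpNorm ((fun x => g x * (wm m : Torus n → ℝ) x) - fun x => g x * w x) 1 volume ≤
      (∫⁻ x, ‖g x‖ₑ) ^ (1 / 2 : ℝ) * (C * eLpNorm g q volume *
        ((eLpNorm (fun x => (wm m : Torus n → ℝ) x - w x) 2 volume ^ 2) ^ (1 - θ) *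
        (h1Size (fun x => (wm m : Torus n → ℝ) x - w x)
          (fun i x => partialDeriv i (wm m : Torus n → ℝ) x - W i x) ^ 2) ^ θ)) ^ (1 / 2 : ℝ) := by
    intro m
    rw [eLpNorm_one_eq_lintegral_enorm]
    have hm : AEStronglyMeasurable (fun x => (wm m : Torus n → ℝ) x - w x) volume :=
      ((hw.fn.1 m).sub hw.fn.2).1
    have h2 := ENNReal.lintegral_mul_norm_pow_le (μ := volume) hg.1.enorm
      (hg.1.enorm.mul (hm.enorm.pow_const 2))
      (p := 1 / 2) (q := 1 / 2) (by norm_num) (by norm_num) (by norm_num)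
    calc _ = ∫⁻ x, ‖g x‖ₑ ^ (1 / 2 : ℝ) *
          (‖g x‖ₑ * ‖(wm m : Torus n → ℝ) x - w x‖ₑ ^ 2) ^ (1 / 2 : ℝ) := by
          congr 1; ext x
          rw [Pi.sub_apply, ← mul_sub, enorm_mul, ← ENNReal.mul_rpow_of_nonneg _ _ (by norm_num)]
          rw [show ‖g x‖ₑ * (‖g x‖ₑ * ‖(wm m : Torus n → ℝ) x - w x‖ₑ ^ 2) =
            (‖g x‖ₑ * ‖(wm m : Torus n → ℝ) x - w x‖ₑ) ^ 2 by ring]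
          rw [← ENNReal.rpow_natCast, ← ENNReal.rpow_mul]
          norm_num
      _ ≤ _ := h2
      _ ≤ _ := by
          gcongr
          -- With m fixed, wₘ - w is itself an `H¹` limit of smooth functions.
          exact h.2 _ _ _ (hw.const_sub (wm m)) g hg.1 hgt
  refine tendsto_of_tendsto_of_tendsto_of_le_of_le tendsto_const_nhds ?_ (fun _ => zero_le) h1
  have hA := hw.fn.3
  have hB : Filter.Tendsto (fun m => h1Size (fun x => (wm m : Torus n → ℝ) x - w x)
      (fun i x => partialDeriv i (wm m : Torus n → ℝ) x - W i x)) Filter.atTop (nhds 0) := by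
    have := hw.fn.3.add (tendsto_finsetSum Finset.univ fun i _ => (hw.grad i).3)
    simpa [h1Size] using this
  have hA2 := ((((ENNReal.continuous_pow 2).tendsto _).comp hA).ennrpow_const (1 - θ))
  have hB2 := ((((ENNReal.continuous_pow 2).tendsto _).comp hB).ennrpow_const θ)
  have hz : ((0 : ℝ≥0∞) ^ 2) ^ (1 - θ) = 0 := by
    rw [zero_pow two_ne_zero, ENNReal.zero_rpow_of_pos (by linarith)]
  have hz' : ((0 : ℝ≥0∞) ^ 2) ^ θ ≠ ⊤ := ENNReal.rpow_ne_top_of_nonneg hθ0 (by simp)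
  have h3 := ENNReal.Tendsto.mul hA2 (Or.inr hz') hB2 (Or.inr (by rw [hz]; simp))
  rw [hz, zero_mul] at h3
  have h4 := (ENNReal.Tendsto.const_mul h3
    (Or.inr (ENNReal.mul_ne_top h.1 hgt))).ennrpow_const (1 / 2)
  rw [mul_zero, ENNReal.zero_rpow_of_pos (by norm_num)] at h4
  have h5 := ENNReal.Tendsto.const_mul (a := (∫⁻ x, ‖g x‖ₑ) ^ (1 / 2 : ℝ)) h4
    (Or.inr (ENNReal.rpow_ne_top_of_nonneg (by norm_num) hg.2.ne))
  rw [mul_zero] at h5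
  exact h5

/-- By density: the side with b converges because b is in `L²`, the side with the divergence by
`HasGN.tendsto_integral_mul`. -/
lemma HasGN.integral_div {q : ℝ≥0∞} {θ : ℝ} {C : ℝ≥0∞} (h : HasGN n q θ C) (hθ0 : 0 ≤ θ)
    (hθ1 : θ < 1) {wm : ℕ → smoothFun n} {w : Torus n → ℝ} {W : Fin n → Torus n → ℝ}
    (hw : H1Lim wm w W) {g : Torus n → ℝ} (hg : Integrable g)
    (hgt : eLpNorm g q volume ≠ ⊤) {b : Torus n → EuclideanSpace ℝ (Fin n)}
    (hb : ∀ i, MemLp (fun x => b x i) 2 volume) (hdiv : IsWeakDivergence b g) :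
    ∫ x, ∑ i, b x i * W i x = -∫ x, g x * w x := by
  refine tendsto_nhds_unique ?_ (h.tendsto_integral_mul hθ0 hθ1 hw hg hgt).neg
  have h0 := fun m => (hdiv (wm m)).symm
  have h1 : ∀ m, ∫ x, ∑ i, b x i * partialDeriv i (wm m : Torus n → ℝ) x =
      ∑ i, ∫ x, b x i * partialDeriv i (wm m : Torus n → ℝ) x := fun m =>
    integral_finsetSum _ fun i _ => (hb i).integrable_mul (smoothFun.memLp_partialDeriv _ i 2)
  have h2 : ∫ x, ∑ i, b x i * W i x = ∑ i, ∫ x, b x i * W i x :=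
    integral_finsetSum _ fun i _ => (hb i).integrable_mul (hw.grad i).2
  simp only [h0, h1, h2]
  exact tendsto_finsetSum _ fun i _ => (hw.grad i).tendsto_integral_mul (hb i)

/-! ### The entropy -/

/-- The entropy `s arctan s / 2`. -/
def entropy (s : ℝ) : ℝ := s * Real.arctan s / 2

/-- The derivative of the entropy. -/
def entropyDeriv (s : ℝ) : ℝ := (s / (1 + s ^ 2) + Real.arctan s) / 2

lemma contDiff_arctan : ContDiff ℝ ∞ Real.arctan := Real.contDiff_arctan

lemma contDiff_entropy : ContDiff ℝ ∞ entropy :=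
  (contDiff_id.mul contDiff_arctan).div_const 2

lemma contDiff_entropyDeriv : ContDiff ℝ ∞ entropyDeriv := by
  refine ContDiff.div_const (ContDiff.add (ContDiff.div contDiff_id ?_ fun s => ?_)
    contDiff_arctan) 2
  · exact contDiff_const.add (contDiff_id.pow 2)
  · positivity

lemma hasDerivAt_entropy (s : ℝ) : HasDerivAt entropy (entropyDeriv s) s := by
  refine (((hasDerivAt_id' s).mul (Real.hasDerivAt_arctan s)).div_const 2).congr_deriv ?_
  unfold entropyDeriv; ring

lemma deriv_entropy (s : ℝ) : deriv entropy s = entropyDeriv s := (hasDerivAt_entropy s).deriv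

/-- Since S'' is the square of the derivative of arctan, the dissipation ∫ S''(u) |Du|² is the
Dirichlet integral of arctan u. -/
lemma deriv_entropyDeriv (s : ℝ) : deriv entropyDeriv s = (1 / (1 + s ^ 2)) ^ 2 := by
  have h0 : (1 + s ^ 2) ≠ 0 := by positivity
  have h1 : HasDerivAt (fun s : ℝ => 1 + s ^ 2) (2 * s) s := by
    simpa using (hasDerivAt_pow 2 s).const_add 1
  have h2 := (((hasDerivAt_id' s).div h1 h0).add (Real.hasDerivAt_arctan s)).div_const 2
  refine Eq.trans (HasDerivAt.deriv h2) ?_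
  field_simp; ring

lemma abs_arctan_le (s : ℝ) : |Real.arctan s| ≤ |s| := by
  have h : LipschitzWith 1 Real.arctan := by
    refine lipschitzWith_of_nnnorm_deriv_le Real.differentiable_arctan fun s => ?_
    rw [Real.deriv_arctan, ← NNReal.coe_le_coe, coe_nnnorm, Real.norm_of_nonneg (by positivity)]
    rw [NNReal.coe_one, div_le_one (by positivity)]
    nlinarith [sq_nonneg s]
  simpa using h.dist_le_mul s 0

lemma abs_arctan_le_two (s : ℝ) : |Real.arctan s| ≤ 2 := by
  have := Real.arctan_lt_pi_div_two s
  have := Real.neg_pi_div_two_lt_arctan s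
  have := Real.pi_le_four
  rw [abs_le]; constructor <;> linarith

lemma abs_entropyDeriv_le (s : ℝ) : |entropyDeriv s| ≤ |s| := by
  have h1 : |s / (1 + s ^ 2)| ≤ |s| := by
    rw [abs_div, abs_of_pos (by positivity : 0 < 1 + s ^ 2)]
    exact div_le_self (abs_nonneg _) (by nlinarith [sq_nonneg s])
  rw [entropyDeriv, abs_div, abs_two]
  linarith [abs_add_le (s / (1 + s ^ 2)) (Real.arctan s), abs_arctan_le s]

lemma abs_entropyDeriv_le_two (s : ℝ) : |entropyDeriv s| ≤ 2 := by
  have h1 : |s / (1 + s ^ 2)| ≤ 1 := by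
    rw [abs_div, abs_of_pos (by positivity : 0 < 1 + s ^ 2), div_le_one (by positivity)]
    nlinarith [sq_nonneg (|s| - 1), sq_abs s]
  rw [entropyDeriv, abs_div, abs_two]
  linarith [abs_add_le (s / (1 + s ^ 2)) (Real.arctan s), abs_arctan_le_two s]

lemma one_div_le_one (s : ℝ) : 1 / (1 + s ^ 2) ≤ 1 := by
  rw [div_le_one (by positivity)]; nlinarith [sq_nonneg s]

lemma abs_deriv_entropyDeriv_le (s : ℝ) : |deriv entropyDeriv s| ≤ 1 := by
  rw [deriv_entropyDeriv, abs_of_nonneg (by positivity)]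
  exact pow_le_one₀ (by positivity) (one_div_le_one s)

lemma abs_deriv_arctan_le (s : ℝ) : |deriv Real.arctan s| ≤ 1 := by
  rw [Real.deriv_arctan, abs_of_nonneg (by positivity)]
  exact one_div_le_one s

lemma abs_deriv_entropy_le (s : ℝ) : |deriv entropy s| ≤ 2 := by
  rw [deriv_entropy]; exact abs_entropyDeriv_le_two s

/-- Lets Grönwall's lemma be run on ∫ arctan² u rather than on the entropy. -/
lemma sq_arctan_le (s : ℝ) : Real.arctan s ^ 2 ≤ 2 * entropy s := by
  have h1 : 0 ≤ s * Real.arctan s := by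
    rcases le_total 0 s with h | h
    · exact mul_nonneg h (Real.arctan_nonneg.2 h)
    · exact mul_nonneg_of_nonpos_of_nonpos h (Real.arctan_le_zero.2 h)
  have h2 : Real.arctan s ^ 2 ≤ |s| * |Real.arctan s| := by
    rw [← sq_abs, pow_two]
    exact mul_le_mul_of_nonneg_right (abs_arctan_le s) (abs_nonneg _)
  rw [← abs_mul, abs_of_nonneg h1] at h2
  simp only [entropy]; linarith

/-- The left side is the factor multiplying div b. It equals half of s²/(1+s²) = sin²(arctan s). -/
lemma abs_entropy_sub_le (s : ℝ) : |entropy s - s * entropyDeriv s| ≤ Real.arctan s ^ 2 / 2 := by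
  have h1 : entropy s - s * entropyDeriv s = -(s ^ 2 / (1 + s ^ 2) / 2) := by
    simp only [entropy, entropyDeriv]; ring
  have h2 : s ^ 2 / (1 + s ^ 2) = Real.sin (Real.arctan s) ^ 2 := by
    rw [Real.sin_arctan, div_pow, Real.sq_sqrt (by positivity)]
  have h3 : Real.sin (Real.arctan s) ^ 2 ≤ Real.arctan s ^ 2 :=
    sq_le_sq.2 Real.abs_sin_le_abs
  rw [h1, abs_neg, abs_of_nonneg (by positivity), h2]
  linarith

/-! ### Estimates at a fixed time -/

/-- The integral of a translate does not depend on the shift; differentiate in the shift. -/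
lemma integral_partialDeriv (ψ : smoothFun n) (i : Fin n) :
    ∫ x, partialDeriv i (ψ : Torus n → ℝ) x = 0 := by
  obtain ⟨C, hC⟩ := smoothFun.exists_bound (smoothFun.pderiv i ψ)
  have hline : ∀ s : ℝ, Continuous fun x : Torus n => x + proj (Pi.single i s) := fun s => by
    fun_prop
  have h := (hasDerivAt_integral_of_dominated_loc_of_deriv_le (μ := (volume : Measure (Torus n)))
    (F := fun s x => (ψ : Torus n → ℝ) (x + proj (Pi.single i s)))
    (F' := fun s x => partialDeriv i (ψ : Torus n → ℝ) (x + proj (Pi.single i s)))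
    (x₀ := 0) (bound := fun _ => C) (Metric.ball_mem_nhds 0 zero_lt_one)
    (.of_forall fun s => ((smoothFun.continuous ψ).comp (hline s)).aestronglyMeasurable)
    (integrable_of_continuous ((smoothFun.continuous ψ).comp (hline 0)))
    ((smoothFun.continuous_partialDeriv ψ i).comp (hline 0)).aestronglyMeasurable
    (.of_forall fun x s _ => hC _) (integrable_const C)
    (.of_forall fun x s _ => smoothFun.hasDerivAt_line ψ i x s)).2
  have h2 : ∀ s : ℝ, ∫ x, (ψ : Torus n → ℝ) (x + proj (Pi.single i s)) =
      ∫ x, (ψ : Torus n → ℝ) x := fun s => integral_add_right_eq_self _ _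
  simp only [h2] at h
  have h3 := h.unique (hasDerivAt_const 0 _)
  simpa using h3

lemma integral_mul_partialDeriv (φ ψ : smoothFun n) (i : Fin n) :
    ∫ x, (φ : Torus n → ℝ) x * partialDeriv i (ψ : Torus n → ℝ) x =
      -∫ x, partialDeriv i (φ : Torus n → ℝ) x * (ψ : Torus n → ℝ) x := by
  have h := integral_partialDeriv (smoothFun.mul φ ψ) i
  simp only [smoothFun.partialDeriv_mul] at h
  rw [integral_add] at h
  · linarith
  · exact integrable_of_continuous
      ((smoothFun.continuous_partialDeriv φ i).mul (smoothFun.continuous ψ))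
  · exact integrable_of_continuous
      ((smoothFun.continuous φ).mul (smoothFun.continuous_partialDeriv ψ i))

lemma partialDeriv_avg_smoothFun (K : SmoothingKernel n) (φ : smoothFun n) (i : Fin n)
    (x : Torus n) :
    partialDeriv i (K.avg φ : Torus n → ℝ) x =
      (K.avg (partialDeriv i (φ : Torus n → ℝ)) : Torus n → ℝ) x :=
  K.partialDeriv_avg (integrable_of_continuous (smoothFun.continuous φ))
    (fun ψ => integral_mul_partialDeriv φ ψ i) x

/-- The smooth approximation of `entropyDeriv u` that is used as a test function. -/
def testFun (K : SmoothingKernel n) (u : Torus n → ℝ) : smoothFun n :=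
  K.avg (smoothFun.comp entropyDeriv contDiff_entropyDeriv (K.avg u) : smoothFun n)

lemma integral_sq_eq {α : Type*} [MeasurableSpace α] {μ : Measure α} {f : α → ℝ}
    (hf : MemLp f 2 μ) : ENNReal.ofReal (∫ x, f x ^ 2 ∂μ) = eLpNorm f 2 μ ^ 2 := by
  rw [ofReal_integral_eq_lintegral_ofReal hf.integrable_sq (.of_forall fun x => sq_nonneg _),
    ← lintegral_enorm_sq]
  congr 1; ext x
  rw [← ofReal_norm, ← ENNReal.ofReal_pow (norm_nonneg _), Real.norm_eq_abs, sq_abs]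

lemma integral_sq_le_of_eLpNorm_le {α : Type*} [MeasurableSpace α] {μ : Measure α} {f g : α → ℝ}
    (hf : MemLp f 2 μ) (hg : MemLp g 2 μ) (h : eLpNorm f 2 μ ≤ eLpNorm g 2 μ) :
    ∫ x, f x ^ 2 ∂μ ≤ ∫ x, g x ^ 2 ∂μ := by
  rw [← ENNReal.ofReal_le_ofReal_iff (integral_nonneg fun x => sq_nonneg _), integral_sq_eq hf,
    integral_sq_eq hg]
  gcongr

/-- Both averages are contractions and commute with derivatives, while S' satisfies |S'(s)| ≤ |s|
and |S''| ≤ 1. The bound does not depend on K, which makes it a dominating function later. -/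
lemma h1Norm_testFun_le (K : SmoothingKernel n) {u : Torus n → ℝ} {G : Fin n → Torus n → ℝ}
    (hu : MemLp u 2 volume) (hG : ∀ i, MemLp (G i) 2 volume)
    (h : ∀ ψ : smoothFun n, ∀ i,
      ∫ x, u x * partialDeriv i (ψ : Torus n → ℝ) x = -∫ x, G i x * (ψ : Torus n → ℝ) x) :
    h1Norm (testFun K u) ≤ Real.sqrt ((∫ x, u x ^ 2) + ∑ i, ∫ x, G i x ^ 2) := by
  set φ : smoothFun n := smoothFun.comp entropyDeriv contDiff_entropyDeriv (K.avg u) with hφ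
  refine Real.sqrt_le_sqrt (add_le_add ?_ (Finset.sum_le_sum fun i _ => ?_))
  · refine integral_sq_le_of_eLpNorm_le (smoothFun.memLp _ 2) hu ?_
    calc _ ≤ eLpNorm (φ : Torus n → ℝ) 2 volume := K.eLpNorm_avg_le (smoothFun.memLp _ 2)
      _ ≤ eLpNorm (K.avg u : Torus n → ℝ) 2 volume :=
          eLpNorm_mono fun x => abs_entropyDeriv_le _
      _ ≤ _ := K.eLpNorm_avg_le hu
  · refine integral_sq_le_of_eLpNorm_le (smoothFun.memLp_partialDeriv _ i 2) (hG i) ?_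
    have h1 : partialDeriv i (testFun K u : Torus n → ℝ) =
        (K.avg (partialDeriv i (φ : Torus n → ℝ)) : Torus n → ℝ) :=
      funext fun x => partialDeriv_avg_smoothFun K φ i x
    have h2 : partialDeriv i (K.avg u : Torus n → ℝ) = (K.avg (G i) : Torus n → ℝ) :=
      funext fun x => K.partialDeriv_avg (hu.integrable (by norm_num)) (fun ψ => h ψ i) x
    rw [h1]
    calc _ ≤ eLpNorm (partialDeriv i (φ : Torus n → ℝ)) 2 volume :=
          K.eLpNorm_avg_le (smoothFun.memLp_partialDeriv _ i 2)
      _ ≤ eLpNorm (partialDeriv i (K.avg u : Torus n → ℝ)) 2 volume :=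
          eLpNorm_mono fun x => by
            rw [hφ, smoothFun.partialDeriv_comp, norm_mul]
            exact mul_le_of_le_one_left (norm_nonneg _) (abs_deriv_entropyDeriv_le _)
      _ ≤ _ := by rw [h2]; exact K.eLpNorm_avg_le (hG i)

lemma abs_testFun_le (K : SmoothingKernel n) (u : Torus n → ℝ) (x : Torus n) :
    |(testFun K u : Torus n → ℝ) x| ≤ 2 :=
  K.abs_avg_le (integrable_of_continuous (smoothFun.continuous _))
    (fun _ => abs_entropyDeriv_le_two _) x

lemma H1Lim.testFun {u : Torus n → ℝ} {G : Fin n → Torus n → ℝ}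
    (h : H1Lim (fun m => (peakKernel m).avg u) u G) :
    H1Lim (fun m => testFun (peakKernel m) u) (fun x => entropyDeriv (u x))
      (fun i x => deriv entropyDeriv (u x) * G i x) := by
  have h1 := h.comp contDiff_entropyDeriv abs_deriv_entropyDeriv_le
  refine ⟨h1.fn.avg_seq, fun i => ?_⟩
  have h2 := (h1.grad i).avg_seq
  have h3 : ∀ m, partialDeriv i (FokkerPlanck.testFun (peakKernel m) u : Torus n → ℝ) =
      ((peakKernel m).avg (partialDeriv i (smoothFun.comp entropyDeriv contDiff_entropyDeriv
        ((peakKernel m).avg u) : Torus n → ℝ)) : Torus n → ℝ) := fun m => funext fun x =>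
    partialDeriv_avg_smoothFun _ _ i x
  simp only [h3]
  exact h2

/-- The weak form of the product rule `div (u b) = b · Du + u div b`. -/
lemma HasGN.integral_mul_div {q : ℝ≥0∞} {θ : ℝ} {C : ℝ≥0∞} (h : HasGN n q θ C) (hθ0 : 0 ≤ θ)
    (hθ1 : θ < 1) {um : ℕ → smoothFun n} {u : Torus n → ℝ} {G : Fin n → Torus n → ℝ}
    (hu : H1Lim um u G) {g : Torus n → ℝ} (hg : Integrable g)
    (hgt : eLpNorm g q volume ≠ ⊤) {b : Torus n → EuclideanSpace ℝ (Fin n)}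
    (hb : ∀ i, MemLp (fun x => b x i) 2 volume) (hdiv : IsWeakDivergence b g) (ψ : smoothFun n) :
    ∫ x, u x * ∑ i, b x i * partialDeriv i (ψ : Torus n → ℝ) x =
      -∫ x, (∑ i, b x i * G i x + g x * u x) * (ψ : Torus n → ℝ) x := by
  -- The divergence is tested with ψ u and the product rule applied to its gradient.
  have h1 := h.integral_div hθ0 hθ1 (hu.mul ψ) hg hgt hb hdiv
  have i1 : Integrable (fun x => g x * u x) := integrable_mul_of_lintegral_mul_sq hg hu.fn.2.1
    (h.lintegral_ne_top hθ0 hθ1 hu hg.1 hgt)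
  have i2 : Integrable (fun x => ∑ i, b x i * G i x) :=
    integrable_finsetSum _ fun i _ => (hb i).integrable_mul (hu.grad i).2
  have i3 : Integrable (fun x => u x * ∑ i, b x i * partialDeriv i (ψ : Torus n → ℝ) x) := by
    simp only [Finset.mul_sum, ← mul_assoc]
    refine integrable_finsetSum _ fun i _ => integrable_mul_smoothFun ?_ (smoothFun.pderiv i ψ)
    exact hu.fn.2.integrable_mul (hb i)
  have e1 : ∀ x, ∑ i, b x i * (partialDeriv i (ψ : Torus n → ℝ) x * u x +
      (ψ : Torus n → ℝ) x * G i x) = u x * ∑ i, b x i * partialDeriv i (ψ : Torus n → ℝ) x +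
        (∑ i, b x i * G i x) * (ψ : Torus n → ℝ) x := by
    intro x
    simp only [mul_add, Finset.sum_add_distrib, Finset.mul_sum, Finset.sum_mul]
    congr 1 <;> exact Finset.sum_congr rfl fun i _ => by ring
  simp only [e1] at h1
  rw [integral_add i3 (integrable_mul_smoothFun i2 ψ)] at h1
  simp only [add_mul]
  rw [integral_add (integrable_mul_smoothFun i2 ψ) (integrable_mul_smoothFun i1 ψ)]
  have e2 : ∫ x, g x * ((ψ : Torus n → ℝ) x * u x) = ∫ x, g x * u x * (ψ : Torus n → ℝ) x := by
    congr 1; ext x; ring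
  rw [e2] at h1
  linarith

/-- The entropy dissipation at a fixed time. -/
theorem exists_limit_le {q : ℝ≥0∞} {θ : ℝ} {C C' : ℝ≥0∞} (h : HasGN n q θ C) (hθ0 : 0 ≤ θ)
    (hθ1 : θ < 1) (h' : HasFormBound n q (1 / (1 - θ)) C') {u : Torus n → ℝ}
    {G : Fin n → Torus n → ℝ} (hu : H1Lim (fun m => (peakKernel m).avg u) u G) {g : Torus n → ℝ}
    (hg : Integrable g) (hgt : eLpNorm g q volume ≠ ⊤)
    {b : Torus n → EuclideanSpace ℝ (Fin n)} (hb : ∀ i, MemLp (fun x => b x i) 2 volume)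
    (hdiv : IsWeakDivergence b g) :
    ∃ A : ℝ, Filter.Tendsto (fun m =>
      -(∫ x, ∑ i, G i x * partialDeriv i (testFun (peakKernel m) u : Torus n → ℝ) x) +
        ∫ x, u x * ∑ i, b x i * partialDeriv i (testFun (peakKernel m) u : Torus n → ℝ) x)
      Filter.atTop (nhds A) ∧
      2 * A ≤ (C' * (eLpNorm g q volume ^ (1 / (1 - θ)) + 1)).toReal *
        ∫ x, Real.arctan (u x) ^ 2 := by
  have hψ := hu.testFun
  have i1 : Integrable (fun x => g x * u x) := integrable_mul_of_lintegral_mul_sq hg hu.fn.2.1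
    (h.lintegral_ne_top hθ0 hθ1 hu hg.1 hgt)
  have i2 : Integrable (fun x => ∑ i, b x i * G i x) :=
    integrable_finsetSum _ fun i _ => (hb i).integrable_mul (hu.grad i).2
  -- The limit is -∫ S''(u) |Du|² - ∫ (b · Du + u div b) S'(u). The derivative must leave the test
  -- function before the limit, as u b need not be in `L²`.
  refine ⟨-(∑ i, ∫ x, G i x * (deriv entropyDeriv (u x) * G i x)) +
    -∫ x, (∑ i, b x i * G i x + g x * u x) * entropyDeriv (u x), ?_, ?_⟩
  · refine Filter.Tendsto.add (Filter.Tendsto.neg ?_) ?_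
    · have e1 : ∀ m, ∫ x, ∑ i, G i x * partialDeriv i (testFun (peakKernel m) u : Torus n → ℝ) x =
          ∑ i, ∫ x, G i x * partialDeriv i (testFun (peakKernel m) u : Torus n → ℝ) x := fun m =>
        integral_finsetSum _ fun i _ =>
          (hu.grad i).2.integrable_mul (smoothFun.memLp_partialDeriv _ i 2)
      simp only [e1]
      exact tendsto_finsetSum _ fun i _ => (hψ.grad i).tendsto_integral_mul (hu.grad i).2
    · simp only [h.integral_mul_div hθ0 hθ1 hu hg hgt hb hdiv]
      refine Filter.Tendsto.neg ?_
      -- Truncation at ±2 supplies the bounded function that `L2Lim.tendsto_integral_mul_comp` asks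
      -- for; it changes nothing, since S' and its averages take values in [-2, 2].
      have hκ : Continuous fun s : ℝ => max (-2) (min s 2) := by fun_prop
      have hκ' : ∀ s : ℝ, |s| ≤ 2 → max (-2) (min s 2) = s := fun s hs => by
        rw [abs_le] at hs
        rw [min_eq_left hs.2, max_eq_right hs.1]
      have := hψ.fn.tendsto_integral_mul_comp (i2.add i1) hκ (C := 2) fun s => by
        rw [abs_le]
        exact ⟨le_max_left _ _, max_le (by norm_num) (min_le_right _ _)⟩
      simpa only [Pi.add_apply, hκ' _ (abs_testFun_le _ _ _), hκ' _ (abs_entropyDeriv_le_two _)] using this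
  · have hS := h.integral_div hθ0 hθ1 (hu.comp contDiff_entropy abs_deriv_entropy_le) hg hgt hb
      hdiv
    have hw := hu.comp contDiff_arctan abs_deriv_arctan_le
    have hF := h'.2 _ _ _ hw g hg.1 hgt
    have i3 : Integrable (fun x => g x * entropy (u x)) :=
      integrable_mul_of_lintegral_mul_sq hg
        (hu.comp contDiff_entropy abs_deriv_entropy_le).fn.2.1
        (h.lintegral_ne_top hθ0 hθ1 (hu.comp contDiff_entropy abs_deriv_entropy_le) hg.1 hgt)
    have hβm : AEStronglyMeasurable (fun x => entropyDeriv (u x)) volume := hψ.fn.2.1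
    have i4 : Integrable (fun x => (∑ i, b x i * G i x) * entropyDeriv (u x)) :=
      i2.mul_bdd hβm (.of_forall fun x => abs_entropyDeriv_le_two _)
    have i5 : Integrable (fun x => g x * u x * entropyDeriv (u x)) :=
      i1.mul_bdd hβm (.of_forall fun x => abs_entropyDeriv_le_two _)
    have e1 : ∫ x, (∑ i, b x i * G i x + g x * u x) * entropyDeriv (u x) =
        -∫ x, g x * (entropy (u x) - u x * entropyDeriv (u x)) := by
      simp only [add_mul, mul_sub]
      rw [integral_add i4 i5, integral_sub i3 (by simpa only [mul_assoc] using i5)]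
      have e2 : ∫ x, (∑ i, b x i * G i x) * entropyDeriv (u x) = -∫ x, g x * entropy (u x) := by
        rw [← hS]
        congr 1; ext x
        rw [Finset.sum_mul]
        refine Finset.sum_congr rfl fun i _ => ?_
        rw [deriv_entropy]; ring
      rw [e2]
      simp only [mul_assoc]
      ring
    have hD : ∀ i, ∫ x, G i x * (deriv entropyDeriv (u x) * G i x) =
        ∫ x, (deriv Real.arctan (u x) * G i x) ^ 2 := by
      intro i
      congr 1; ext x
      rw [deriv_entropyDeriv, Real.deriv_arctan]; ring
    have i6 : Integrable (fun x => |g x| * Real.arctan (u x) ^ 2) := by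
      refine hg.abs.mul_bdd (c := 4) (hw.fn.2.1.pow 2) (.of_forall fun x => ?_)
      rw [Real.norm_of_nonneg (sq_nonneg _), ← sq_abs]
      nlinarith [abs_arctan_le_two (u x), abs_nonneg (Real.arctan (u x))]
    have e3 : ∫ x, |g x| * Real.arctan (u x) ^ 2 ≤
        (C' * (eLpNorm g q volume ^ (1 / (1 - θ)) + 1)).toReal * (∫ x, Real.arctan (u x) ^ 2) +
        ∑ i, ∫ x, (deriv Real.arctan (u x) * G i x) ^ 2 := by
      have hκ : C' * (eLpNorm g q volume ^ (1 / (1 - θ)) + 1) ≠ ⊤ := by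
        refine ENNReal.mul_ne_top h'.1 (ENNReal.add_ne_top.2 ⟨?_, by simp⟩)
        exact ENNReal.rpow_ne_top_of_nonneg (by have := sub_pos.2 hθ1; positivity) hgt
      rw [← ENNReal.ofReal_le_ofReal_iff (add_nonneg (mul_nonneg ENNReal.toReal_nonneg
        (integral_nonneg fun x => sq_nonneg _)) (Finset.sum_nonneg fun i _ =>
          integral_nonneg fun x => sq_nonneg _)), ENNReal.ofReal_add (mul_nonneg
            ENNReal.toReal_nonneg (integral_nonneg fun x => sq_nonneg _)) (Finset.sum_nonneg
              fun i _ => integral_nonneg fun x => sq_nonneg _),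
        ENNReal.ofReal_mul ENNReal.toReal_nonneg, ENNReal.ofReal_toReal hκ,
        ENNReal.ofReal_sum_of_nonneg fun i _ => integral_nonneg fun x => sq_nonneg _,
        integral_sq_eq hw.fn.2, ofReal_integral_eq_lintegral_ofReal i6 (.of_forall fun x => by
          positivity)]
      simp only [fun i => integral_sq_eq (hw.grad i).2]
      refine le_trans (le_of_eq ?_) hF
      congr 1; ext x
      rw [ENNReal.ofReal_mul (abs_nonneg _), ← Real.norm_eq_abs, ofReal_norm, ← sq_abs,
        ENNReal.ofReal_pow (abs_nonneg _), ← Real.norm_eq_abs, ofReal_norm]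
    have e4 : 2 * ∫ x, g x * (entropy (u x) - u x * entropyDeriv (u x)) ≤
        ∫ x, |g x| * Real.arctan (u x) ^ 2 := by
      rw [← integral_const_mul]
      refine integral_mono ?_ i6 fun x => ?_
      · have := (i3.sub i5).const_mul 2
        refine this.congr (.of_forall fun x => ?_)
        simp only [Pi.sub_apply]; ring
      · have := abs_entropy_sub_le (u x)
        have h7 : g x * (entropy (u x) - u x * entropyDeriv (u x)) ≤
            |g x| * (Real.arctan (u x) ^ 2 / 2) := by
          refine (le_abs_self _).trans ?_
          rw [abs_mul]
          exact mul_le_mul_of_nonneg_left this (abs_nonneg _)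
        simp only
        linarith
    -- Doubling the limit produces the dissipation twice: one copy absorbs the gradient term of the
    -- form bound, the other is dropped by its sign.
    have h8 : 0 ≤ ∑ i, ∫ x, (deriv Real.arctan (u x) * G i x) ^ 2 :=
      Finset.sum_nonneg fun i _ => integral_nonneg fun x => sq_nonneg _
    simp only [hD]
    rw [e1]
    linarith

/-! ### Functions of time -/

lemma absolutelyContinuousOnInterval_lipschitz_comp {S f : ℝ → ℝ} {C : NNReal}
    (hS : LipschitzWith C S) {a b : ℝ} (hf : AbsolutelyContinuousOnInterval f a b) :
    AbsolutelyContinuousOnInterval (fun t => S (f t)) a b := by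
  rw [absolutelyContinuousOnInterval_iff] at hf ⊢
  intro ε hε
  obtain ⟨δ, hδ, h⟩ := hf (ε / (C + 1)) (by positivity)
  refine ⟨δ, hδ, fun E hE hEδ => ?_⟩
  have h1 := h E hE hEδ
  calc _ ≤ ∑ i ∈ Finset.range E.1, (C : ℝ) * dist (f (E.2 i).1) (f (E.2 i).2) :=
        Finset.sum_le_sum fun i _ => hS.dist_le_mul _ _
    _ = C * ∑ i ∈ Finset.range E.1, dist (f (E.2 i).1) (f (E.2 i).2) :=
        (Finset.mul_sum _ _ _).symm
    _ ≤ C * (ε / (C + 1)) := by gcongr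
    _ < (C + 1) * (ε / (C + 1)) := by gcongr; linarith
    _ = ε := by field_simp

/-- The primitive of an integrable function is only absolutely continuous. A Lipschitz S preserves
this, so the chain rule at almost every time integrates back. -/
lemma comp_primitive_eq {S β : ℝ → ℝ} {C : NNReal} (hS : LipschitzWith C S)
    (hβ : ∀ s, HasDerivAt S (β s) s) {f : ℝ → ℝ} (hf : Integrable f) (t : ℝ) :
    S (∫ s in (0 : ℝ)..t, f s) - S 0 = ∫ s in (0 : ℝ)..t, β (∫ r in (0 : ℝ)..s, f r) * f s := by
  have h1 : AbsolutelyContinuousOnInterval (fun t => ∫ s in (0 : ℝ)..t, f s) 0 t :=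
    hf.intervalIntegrable.absolutelyContinuousOnInterval_intervalIntegral left_mem_uIcc
  have h2 := (absolutelyContinuousOnInterval_lipschitz_comp hS h1).integral_deriv_eq_sub
  simp only [intervalIntegral.integral_same] at h2
  rw [← h2]
  refine intervalIntegral.integral_congr_ae ?_
  filter_upwards [LocallyIntegrable.ae_hasDerivAt_integral hf.locallyIntegrable] with s hs _
  exact ((hβ _).comp s (hs 0)).deriv

/-- The scalar chain rule is applied for each fixed x and integrated in x. Fubini is permitted since
S' and the φⱼ are bounded and the `F j` are integrable. -/
lemma integral_entropy_eq {J : Type*} [Fintype J] {F : J → ℝ → ℝ} (hF : ∀ j, Integrable (F j))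
    (φ : J → smoothFun n) {t : ℝ} (ht : 0 ≤ t) :
    Integrable (fun s => ∑ j, F j s * ∫ x, entropyDeriv (∑ i, (∫ r in (0 : ℝ)..s, F i r) *
      (φ i : Torus n → ℝ) x) * (φ j : Torus n → ℝ) x) ∧
    ∫ x, entropy (∑ j, (∫ s in (0 : ℝ)..t, F j s) * (φ j : Torus n → ℝ) x) =
      ∫ s in (0 : ℝ)..t, ∑ j, F j s * ∫ x, entropyDeriv (∑ i, (∫ r in (0 : ℝ)..s, F i r) *
        (φ i : Torus n → ℝ) x) * (φ j : Torus n → ℝ) x := by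
  have hU : ∀ j, Continuous fun s => ∫ r in (0 : ℝ)..s, F j r := fun j =>
    intervalIntegral.continuous_primitive (fun _ _ => (hF j).intervalIntegrable) 0
  have hφ := fun j => smoothFun.continuous (φ j)
  set U : ℝ → Torus n → ℝ := fun s x =>
    ∑ i, (∫ r in (0 : ℝ)..s, F i r) * (φ i : Torus n → ℝ) x with hUd
  have hUc : Continuous fun p : ℝ × Torus n => entropyDeriv (U p.1 p.2) := by
    refine contDiff_entropyDeriv.continuous.comp (continuous_finsetSum _ fun i _ => ?_)
    exact ((hU i).comp continuous_fst).mul ((hφ i).comp continuous_snd)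
  have key : ∀ j, Integrable (fun p : ℝ × Torus n =>
      F j p.1 * (entropyDeriv (U p.1 p.2) * (φ j : Torus n → ℝ) p.2)) (volume.prod volume) := by
    intro j
    obtain ⟨C, hC⟩ := smoothFun.exists_bound (φ j)
    refine ((hF j).comp_fst volume).mul_bdd (c := 2 * C)
      (hUc.mul ((hφ j).comp continuous_snd)).aestronglyMeasurable (.of_forall fun p => ?_)
    rw [norm_mul]
    exact mul_le_mul (abs_entropyDeriv_le_two _) (hC _) (norm_nonneg _) (by norm_num)
  have key2 : Integrable (fun p : ℝ × Torus n =>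
      ∑ j, F j p.1 * (entropyDeriv (U p.1 p.2) * (φ j : Torus n → ℝ) p.2))
      (volume.prod volume) := integrable_finsetSum _ fun j _ => key j
  have e1 : ∀ s, ∑ j, F j s * ∫ x, entropyDeriv (U s x) * (φ j : Torus n → ℝ) x =
      ∫ x, ∑ j, F j s * (entropyDeriv (U s x) * (φ j : Torus n → ℝ) x) := by
    intro s
    rw [integral_finsetSum]
    · exact Finset.sum_congr rfl fun j _ => (integral_const_mul _ _).symm
    · intro j _
      refine (integrable_of_continuous ?_).const_mul _
      exact (hUc.comp (continuous_const.prodMk continuous_id)).mul (hφ j)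
  change Integrable (fun s => ∑ j, F j s * ∫ x, entropyDeriv (U s x) * (φ j : Torus n → ℝ) x) ∧
    ∫ x, entropy (U t x) = ∫ s in (0 : ℝ)..t, ∑ j, F j s *
      ∫ x, entropyDeriv (U s x) * (φ j : Torus n → ℝ) x
  simp only [e1]
  refine ⟨key2.integral_prod_left, ?_⟩
  rw [intervalIntegral.integral_of_le ht]
  have key3 : Integrable (uncurry fun s x =>
      ∑ j, F j s * (entropyDeriv (U s x) * (φ j : Torus n → ℝ) x))
      ((volume.restrict (Ioc 0 t)).prod volume) := by
    refine key2.mono_measure ?_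
    exact Measure.prod_mono Measure.restrict_le_self le_rfl
  rw [integral_integral_swap key3]
  congr 1; ext x
  have h2 : Integrable (fun s => ∑ j, F j s * (φ j : Torus n → ℝ) x) :=
    integrable_finsetSum _ fun j _ => (hF j).mul_const _
  have h3 := comp_primitive_eq (lipschitzWith_of_abs_deriv_le contDiff_entropy abs_deriv_entropy_le)
    hasDerivAt_entropy h2 t
  have h4 : ∀ s, ∫ r in (0 : ℝ)..s, ∑ j, F j r * (φ j : Torus n → ℝ) x = U s x := by
    intro s
    rw [intervalIntegral.integral_finsetSum fun j _ => ((hF j).mul_const _).intervalIntegrable]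
    simp only [intervalIntegral.integral_mul_const, hUd]
  have h0 : entropy 0 = 0 := by simp [entropy]
  simp only [h4, h0, sub_zero] at h3
  rw [h3, intervalIntegral.integral_of_le ht]
  congr 1; ext s
  rw [Finset.mul_sum]
  exact Finset.sum_congr rfl fun j _ => by ring

lemma exists_forall_ge_eq_zero {T : ℝ} {η : ℝ → ℝ} (hc : HasCompactSupport η)
    (hs : tsupport η ⊆ Ioo 0 T) : ∃ τ < T, ∀ t, τ ≤ t → η t = 0 := by
  rcases (tsupport η).eq_empty_or_nonempty with he | hne
  · refine ⟨T - 1, by linarith, fun t _ => image_eq_zero_of_notMem_tsupport (by simp [he])⟩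
  · obtain ⟨m, hm, hmax⟩ := hc.isCompact.exists_isMaxOn hne continuous_id.continuousOn
    refine ⟨(m + T) / 2, by linarith [(hs hm).2], fun t ht => ?_⟩
    refine image_eq_zero_of_notMem_tsupport fun h => ?_
    have h1 : t ≤ m := hmax h
    linarith [(hs hm).2]

/-- The compactly supported test functions on `(0,T)` are derivatives of smooth functions that
vanish near `T`. -/
lemma exists_primitive {T : ℝ} {η : ℝ → ℝ} (hη : ContDiff ℝ ∞ η) (hc : HasCompactSupport η)
    (hs : tsupport η ⊆ Ioo 0 T) : ∃ χ : ℝ → ℝ, ContDiff ℝ ∞ χ ∧ (∃ τ < T, ∀ t, τ ≤ t → χ t = 0) ∧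
      ∀ t, HasDerivAt χ (η t) t := by
  have hd : ∀ t, HasDerivAt (fun t => ∫ s in T..t, η s) (η t) t := fun t =>
    intervalIntegral.integral_hasDerivAt_right (hη.continuous.intervalIntegrable _ _)
      hη.continuous.aestronglyMeasurable.stronglyMeasurableAtFilter hη.continuous.continuousAt
  refine ⟨fun t => ∫ s in T..t, η s, ?_, ?_, hd⟩
  · rw [contDiff_infty_iff_deriv]
    exact ⟨fun t => (hd t).differentiableAt, by rw [funext fun t => (hd t).deriv]; exact hη⟩
  · obtain ⟨τ, hτ, hτ'⟩ := exists_forall_ge_eq_zero hc hs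
    refine ⟨τ, hτ, fun t ht => ?_⟩
    show (∫ s in T..t, η s) = 0
    rw [intervalIntegral.integral_congr (g := fun _ => (0 : ℝ))]
    · simp
    · intro s hs'
      refine hτ' s (le_trans ?_ hs'.1)
      exact le_min hτ.le ht

/-- The test functions need not vanish at time 0, so the hypothesis also encodes the initial value 0
and no constant of integration is left. -/
lemma ae_eq_primitive {T : ℝ} (hT : 0 < T) {a F : ℝ → ℝ} (ha : IntegrableOn a (Ioo 0 T))
    (hF : Integrable F)
    (h : ∀ χ : ℝ → ℝ, ContDiff ℝ ∞ χ → (∃ τ < T, ∀ t, τ ≤ t → χ t = 0) →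
      ∫ t in Ioo 0 T, deriv χ t * a t = -∫ t in Ioo 0 T, χ t * F t) :
    ∀ᵐ t ∂(volume.restrict (Ioo 0 T)), a t = ∫ s in (0 : ℝ)..t, F s := by
  have hU : Continuous fun t => ∫ s in (0 : ℝ)..t, F s :=
    intervalIntegral.continuous_primitive (fun _ _ => hF.intervalIntegrable) 0
  have hUi : IntegrableOn (fun t => ∫ s in (0 : ℝ)..t, F s) (Ioo 0 T) :=
    (hU.integrableOn_Icc (a := 0) (b := T)).mono_set Ioo_subset_Icc_self
  have h1 := isOpen_Ioo.ae_eq_zero_of_integral_contDiff_smul_eq_zero (μ := volume)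
    (f := fun t => a t - ∫ s in (0 : ℝ)..t, F s) (U := Ioo 0 T)
    (ha.sub hUi).locallyIntegrableOn ?_
  · rw [ae_restrict_iff' measurableSet_Ioo]
    filter_upwards [h1] with t ht htm
    exact sub_eq_zero.1 (ht htm)
  intro η hη hc hs
  obtain ⟨χ, hχ, hχτ, hχd⟩ := exists_primitive hη hc hs
  have h2 := h χ hχ hχτ
  have hχT : χ T = 0 := by
    obtain ⟨τ, hτ, h3⟩ := hχτ
    exact h3 T hτ.le
  -- Integration by parts without boundary terms: χ vanishes at T and the primitive of F at 0.
  have h3 : ∫ t in Ioo 0 T, η t * (∫ s in (0 : ℝ)..t, F s) = -∫ t in Ioo 0 T, χ t * F t := by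
    have hac1 : AbsolutelyContinuousOnInterval χ 0 T :=
      (hχ.of_le (by simp)).contDiffOn.absolutelyContinuousOnInterval
    have hac2 : AbsolutelyContinuousOnInterval (fun t => ∫ s in (0 : ℝ)..t, F s) 0 T :=
      hF.intervalIntegrable.absolutelyContinuousOnInterval_intervalIntegral left_mem_uIcc
    have h4 := hac1.integral_mul_deriv_eq_deriv_mul hac2
    simp only [hχT, intervalIntegral.integral_same, zero_mul, mul_zero, sub_zero, zero_sub] at h4
    have h5 : ∫ t in (0 : ℝ)..T, χ t * deriv (fun t => ∫ s in (0 : ℝ)..t, F s) t =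
        ∫ t in (0 : ℝ)..T, χ t * F t := by
      refine intervalIntegral.integral_congr_ae ?_
      filter_upwards [LocallyIntegrable.ae_hasDerivAt_integral hF.locallyIntegrable] with s hs _
      rw [(hs 0).deriv]
    rw [h5] at h4
    simp only [(hχd _).deriv] at h4
    simp only [← integral_Ioc_eq_integral_Ioo, ← intervalIntegral.integral_of_le hT.le]
    linarith
  have hηb : ∃ C, ∀ t, ‖η t‖ ≤ C := hc.exists_bound_of_continuous hη.continuous
  obtain ⟨C, hC⟩ := hηb
  have hz : ∀ t, t ∉ Ioo 0 T → η t • (a t - ∫ s in (0 : ℝ)..t, F s) = 0 := fun t ht => by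
    rw [image_eq_zero_of_notMem_tsupport fun h => ht (hs h), zero_smul]
  rw [← setIntegral_eq_integral_of_forall_compl_eq_zero hz]
  simp only [smul_eq_mul, mul_sub]
  have i1 : IntegrableOn (fun t => η t * a t) (Ioo 0 T) :=
    Integrable.bdd_mul ha hη.continuous.aestronglyMeasurable (.of_forall hC)
  have i2 : IntegrableOn (fun t => η t * ∫ s in (0 : ℝ)..t, F s) (Ioo 0 T) :=
    Integrable.bdd_mul hUi hη.continuous.aestronglyMeasurable (.of_forall hC)
  rw [integral_sub i1 i2, h3]
  simp only [(hχd _).deriv] at h2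
  rw [h2]; ring

lemma ae_eq_of_forall_integral_mul_eq {T : ℝ} {f g : ℝ → ℝ} (hf : IntegrableOn f (Ioo 0 T))
    (hg : IntegrableOn g (Ioo 0 T))
    (h : ∀ θ : ℝ → ℝ, ContDiff ℝ ∞ θ → HasCompactSupport θ → tsupport θ ⊆ Ioo 0 T →
      ∫ t in Ioo 0 T, θ t * f t = ∫ t in Ioo 0 T, θ t * g t) :
    ∀ᵐ t ∂(volume.restrict (Ioo 0 T)), f t = g t := by
  have h1 := isOpen_Ioo.ae_eq_zero_of_integral_contDiff_smul_eq_zero (μ := volume)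
    (f := fun t => f t - g t) (U := Ioo 0 T) (hf.sub hg).locallyIntegrableOn ?_
  · rw [ae_restrict_iff' measurableSet_Ioo]
    filter_upwards [h1] with t ht htm
    exact sub_eq_zero.1 (ht htm)
  intro η hη hc hs
  obtain ⟨C, hC⟩ := hc.exists_bound_of_continuous hη.continuous
  have hz : ∀ t, t ∉ Ioo 0 T → η t • (f t - g t) = 0 := fun t ht => by
    rw [image_eq_zero_of_notMem_tsupport fun h => ht (hs h), zero_smul]
  rw [← setIntegral_eq_integral_of_forall_compl_eq_zero hz]
  simp only [smul_eq_mul, mul_sub]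
  rw [integral_sub, h η hη hc hs, sub_self]
  · exact Integrable.bdd_mul hf hη.continuous.aestronglyMeasurable (.of_forall hC)
  · exact Integrable.bdd_mul hg hη.continuous.aestronglyMeasurable (.of_forall hC)

/-- Grönwall's lemma with an integrable coefficient. -/
lemma ae_eq_zero_of_le_integral {T : ℝ} {z κ : ℝ → ℝ} (hκ : Integrable κ)
    (hκ0 : ∀ t, 0 ≤ κ t) (hz0 : ∀ t, 0 ≤ z t) (hκz : Integrable fun t => κ t * z t)
    (h : ∀ᵐ t ∂(volume.restrict (Ioo 0 T)), z t ≤ ∫ s in (0 : ℝ)..t, κ s * z s) :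
    ∀ᵐ t ∂(volume.restrict (Ioo 0 T)), z t = 0 := by
  set Z : ℝ → ℝ := fun t => ∫ s in (0 : ℝ)..t, κ s * z s with hZ
  have hZc : Continuous Z :=
    intervalIntegral.continuous_primitive (fun _ _ => hκz.intervalIntegrable) 0
  have hsub : ∀ s t, Z t - Z s = ∫ r in s..t, κ r * z r := fun s t =>
    intervalIntegral.integral_interval_sub_left hκz.intervalIntegrable hκz.intervalIntegrable
  have hmono : ∀ s t, s ≤ t → Z s ≤ Z t := fun s t hst => by
    have : 0 ≤ Z t - Z s := by
      rw [hsub]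
      exact intervalIntegral.integral_nonneg hst fun r _ => mul_nonneg (hκ0 r) (hz0 r)
    linarith
  have hZ0 : Z 0 = 0 := by simp [hZ]
  -- Continuous induction on the zero set of Z. Just after a zero, while ∫ κ < 1/2, monotonicity of
  -- Z gives Z t ≤ Z t / 2, hence Z t = 0.
  have hall : Icc 0 T ⊆ {t | Z t = 0} := by
    refine IsClosed.Icc_subset_of_forall_exists_gt ?_ hZ0 ?_
    · exact (isClosed_singleton.preimage hZc).inter isClosed_Icc
    rintro x ⟨hx0, hx⟩ y hy
    have hkc : Continuous fun t => ∫ r in x..t, κ r :=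
      intervalIntegral.continuous_primitive (fun _ _ => hκ.intervalIntegrable) x
    have hev : ∀ᶠ t in nhdsWithin x (Ioi x), (∫ r in x..t, κ r) < 1 / 2 := by
      have := hkc.tendsto x
      rw [intervalIntegral.integral_same] at this
      exact (this.mono_left nhdsWithin_le_nhds).eventually (gt_mem_nhds (by norm_num))
    have hev2 : ∀ᶠ t in nhdsWithin x (Ioi x), t ∈ Ioo x (min y T) :=
      Ioo_mem_nhdsGT (lt_min hy hx.2)
    obtain ⟨t, ht1, ht2⟩ := (hev.and hev2).exists
    refine ⟨t, ?_, ht2.1, ht2.2.le.trans (min_le_left _ _)⟩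
    have htT : t < T := ht2.2.trans_le (min_le_right _ _)
    have hle : Z t - Z x ≤ (∫ r in x..t, κ r) * Z t := by
      rw [hsub, ← intervalIntegral.integral_mul_const]
      refine intervalIntegral.integral_mono_ae_restrict ht2.1.le hκz.intervalIntegrable
        (hκ.mul_const _).intervalIntegrable ?_
      have h1 : ∀ᵐ r ∂(volume.restrict (Ioo x t)), z r ≤ Z r :=
        ae_restrict_of_ae_restrict_of_subset (Ioo_subset_Ioo hx.1 htT.le) h
      rw [← restrict_Ioo_eq_restrict_Icc]
      filter_upwards [h1, ae_restrict_mem measurableSet_Ioo] with r hr hrm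
      exact mul_le_mul_of_nonneg_left (hr.trans (hmono r t hrm.2.le)) (hκ0 r)
    have hx0' : Z x = 0 := hx0
    have hZt : 0 ≤ Z t := hx0' ▸ hmono x t ht2.1.le
    have : (∫ r in x..t, κ r) * Z t ≤ 1 / 2 * Z t := mul_le_mul_of_nonneg_right ht1.le hZt
    show Z t = 0
    linarith
  filter_upwards [h, ae_restrict_mem measurableSet_Ioo] with t ht htm
  exact le_antisymm (ht.trans (hall ⟨htm.1.le, htm.2.le⟩).le) (hz0 t)

lemma aemeasurable_eLpNorm {q : ℝ≥0∞} (hq : q ≠ 0) {μ : Measure ℝ} [SFinite μ]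
    {E : Type*} [NormedAddCommGroup E] {g : ℝ → Torus n → E}
    (hg : AEStronglyMeasurable (uncurry g) (μ.prod (volume : Measure (Torus n)))) :
    AEMeasurable (fun t => eLpNorm (g t) q volume) μ := by
  rcases eq_or_ne q ⊤ with rfl | hqt
  · have h1 : ∀ᵐ t ∂μ, eLpNorm (g t) ⊤ volume = essSup (fun x => ‖hg.mk _ (t, x)‖ₑ) volume := by
      filter_upwards [Measure.ae_ae_of_ae_prod hg.ae_eq_mk] with t ht
      rw [eLpNorm_exponent_top, eLpNormEssSup]
      refine essSup_congr_ae ?_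
      filter_upwards [ht] with x hx
      rw [← hx]; rfl
    refine AEMeasurable.congr (Measurable.aemeasurable ?_) (h1.mono fun t ht => ht.symm)
    have hm : Measurable fun p : ℝ × Torus n => ‖hg.mk _ p‖ₑ :=
      hg.stronglyMeasurable_mk.enorm
    refine measurable_of_Iic fun c => ?_
    -- An essential supremum is at most c exactly when the slice of the superlevel set is null, and
    -- the measure of a slice is a measurable function of t.
    have h2 : (fun t => essSup (fun x => ‖hg.mk _ (t, x)‖ₑ) (volume : Measure (Torus n))) ⁻¹'
        Iic c = {t | volume (Prod.mk t ⁻¹' {p : ℝ × Torus n | c < ‖hg.mk _ p‖ₑ}) = 0} := by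
      ext t
      simp only [mem_preimage, mem_Iic, mem_ofPred_eq]
      have h3 : (∀ᵐ x ∂(volume : Measure (Torus n)), ‖hg.mk _ (t, x)‖ₑ ≤ c) ↔
          volume {x : Torus n | c < ‖hg.mk _ (t, x)‖ₑ} = 0 := by
        rw [ae_iff]; simp only [not_le]
      refine Iff.trans ⟨fun h => ?_, fun h => ?_⟩ h3
      · filter_upwards [ae_le_essSup (μ := (volume : Measure (Torus n)))
          (f := fun x => ‖hg.mk _ (t, x)‖ₑ)] with x hx
        exact hx.trans h
      · exact essSup_le_of_ae_le _ h
    rw [h2]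
    exact (measurable_measure_prodMk_left (measurableSet_lt measurable_const hm))
      (measurableSet_singleton 0)
  · simp only [eLpNorm_eq_lintegral_rpow_enorm_toReal hq hqt]
    refine AEMeasurable.pow_const ?_ _
    exact AEMeasurable.lintegral_prod_right' (f := fun p : ℝ × Torus n => ‖g p.1 p.2‖ₑ ^ q.toReal)
      (hg.enorm.pow_const _)

/-! ### Slices in time -/

instance (T : ℝ) : IsFiniteMeasure (cylinder n T) := by unfold cylinder; infer_instance

lemma memLp_two_slice {E : Type*} [NormedAddCommGroup E] {T : ℝ} {f : ℝ → Torus n → E}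
    (hf : MemLp (uncurry f) 2 (cylinder n T)) :
    ∀ᵐ t ∂(volume.restrict (Ioo 0 T)), MemLp (f t) 2 volume := by
  filter_upwards [hf.1.prodMk_left, ((memLp_two_iff_integrable_sq_norm hf.1).1 hf).prod_right_ae]
    with t ht ht2
  exact (memLp_two_iff_integrable_sq_norm ht).2 ht2

lemma memLp_coord {α : Type*} [MeasurableSpace α] {μ : Measure α} {p : ℝ≥0∞}
    {H : α → EuclideanSpace ℝ (Fin n)} (hH : MemLp H p μ) (i : Fin n) :
    MemLp (fun x => H x i) p μ :=
  (EuclideanSpace.proj i : EuclideanSpace ℝ (Fin n) →L[ℝ] ℝ).comp_memLp' hH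

lemma integrable_coord {α : Type*} [MeasurableSpace α] {μ : Measure α}
    {H : α → EuclideanSpace ℝ (Fin n)} (hH : Integrable H μ) (i : Fin n) :
    Integrable (fun x => H x i) μ :=
  memLp_one_iff_integrable.1 (memLp_coord (memLp_one_iff_integrable.2 hH) i)

lemma integrable_mul_space {T : ℝ} {f : ℝ × Torus n → ℝ} (hf : Integrable f (cylinder n T))
    {c : Torus n → ℝ} (hc : Continuous c) :
    Integrable (fun z => f z * c z.2) (cylinder n T) := by
  obtain ⟨C, hC⟩ := isCompact_univ.exists_bound_of_continuousOn hc.continuousOn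
  exact hf.mul_bdd (c := C) (hc.comp continuous_snd).aestronglyMeasurable
    (.of_forall fun z => hC _ trivial)

lemma integrable_time_mul {T : ℝ} {f : ℝ × Torus n → ℝ} (hf : Integrable f (cylinder n T))
    {χ : ℝ → ℝ} (hχ : Continuous χ) :
    Integrable (fun z => χ z.1 * f z) (cylinder n T) := by
  obtain ⟨C, hC⟩ := (isCompact_Icc (a := (0 : ℝ)) (b := T)).exists_bound_of_continuousOn
    hχ.continuousOn
  refine hf.bdd_mul (c := C) (hχ.comp continuous_fst).aestronglyMeasurable ?_
  refine Measure.quasiMeasurePreserving_fst.ae (p := fun t => ‖χ t‖ ≤ C) ?_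
  filter_upwards [ae_restrict_mem measurableSet_Ioo] with t ht
  exact hC t (Ioo_subset_Icc_self ht)

lemma integral_cylinder_time_mul {T : ℝ} {f : ℝ × Torus n → ℝ} (hf : Integrable f (cylinder n T))
    {χ : ℝ → ℝ} (hχ : Continuous χ) :
    ∫ z, χ z.1 * f z ∂(cylinder n T) = ∫ t in Ioo 0 T, χ t * ∫ x, f (t, x) := by
  rw [cylinder, integral_prod _ (integrable_time_mul hf hχ)]
  simp only [integral_const_mul]

lemma integrableOn_time_mul {T : ℝ} {f : ℝ → ℝ} (hf : IntegrableOn f (Ioo 0 T))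
    {χ : ℝ → ℝ} (hχ : Continuous χ) : IntegrableOn (fun t => χ t * f t) (Ioo 0 T) := by
  obtain ⟨C, hC⟩ := (isCompact_Icc (a := (0 : ℝ)) (b := T)).exists_bound_of_continuousOn
    hχ.continuousOn
  refine Integrable.bdd_mul (c := C) hf hχ.aestronglyMeasurable ?_
  filter_upwards [ae_restrict_mem measurableSet_Ioo] with t ht
  exact hC t (Ioo_subset_Icc_self ht)

/-! ### The weak form of the equation -/

/-- The functional `ψ ↦ ∫ H · Dψ`. -/
def fluxPairing (H : Torus n → EuclideanSpace ℝ (Fin n)) (ψ : smoothFun n) : ℝ :=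
  ∫ x, ∑ i, H x i * partialDeriv i (ψ : Torus n → ℝ) x

lemma integrable_flux {H : Torus n → EuclideanSpace ℝ (Fin n)} (hH : Integrable H)
    (ψ : smoothFun n) : Integrable fun x => ∑ i, H x i * partialDeriv i (ψ : Torus n → ℝ) x :=
  integrable_finsetSum _ fun i _ =>
    integrable_mul_of_continuous (integrable_coord hH i) (smoothFun.continuous_partialDeriv ψ i)

lemma fluxPairing_sub {H H' : Torus n → EuclideanSpace ℝ (Fin n)} (hH : Integrable H)
    (hH' : Integrable H') (ψ : smoothFun n) :
    fluxPairing (fun x => H x - H' x) ψ = fluxPairing H ψ - fluxPairing H' ψ := by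
  unfold fluxPairing
  rw [← integral_sub (integrable_flux hH ψ) (integrable_flux hH' ψ)]
  simp [sub_mul, Finset.sum_sub_distrib]

lemma fluxPairing_sum {H : Torus n → EuclideanSpace ℝ (Fin n)} (hH : Integrable H)
    {J : Type*} [Fintype J] (c : J → ℝ) (φ : J → smoothFun n) :
    fluxPairing H (∑ j, c j • φ j) = ∑ j, c j * fluxPairing H (φ j) := by
  unfold fluxPairing
  simp only [smoothFun.partialDeriv_sum, ← integral_const_mul]
  rw [← integral_finsetSum _ fun j _ => (integrable_flux hH _).const_mul _]
  congr 1; ext x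
  simp only [Finset.mul_sum]
  rw [Finset.sum_comm]
  exact Finset.sum_congr rfl fun j _ => Finset.sum_congr rfl fun i _ => by ring

lemma integrable_flux_cylinder {T : ℝ} {H : ℝ × Torus n → EuclideanSpace ℝ (Fin n)}
    (hH : Integrable H (cylinder n T)) (ψ : smoothFun n) :
    Integrable (fun z => ∑ i, H z i * partialDeriv i (ψ : Torus n → ℝ) z.2) (cylinder n T) :=
  integrable_finsetSum _ fun i _ =>
    integrable_mul_space (integrable_coord hH i) (smoothFun.continuous_partialDeriv ψ i)

/-- The parabolic regularity and the weak form of `∂ₜu - Δu + div(bu) = 0`, with the initial datum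
given by the functional `c`. -/
structure IsWeakSolution (T : ℝ) (b : ℝ → Torus n → EuclideanSpace ℝ (Fin n)) (c : smoothFun n → ℝ)
    (u : ℝ → Torus n → ℝ) (G : ℝ → Torus n → EuclideanSpace ℝ (Fin n))
    (v : ℝ → smoothFun n →ₗ[ℝ] ℝ) (N : ℝ → ℝ) : Prop where
  memLp : MemLp (uncurry u) 2 (cylinder n T)
  memLp_grad : MemLp (uncurry G) 2 (cylinder n T)
  weakGradient : ∀ᵐ t ∂(volume.restrict (Ioo 0 T)), IsWeakGradient (u t) (G t)
  integrable_drift : Integrable (fun z : ℝ × Torus n => u z.1 z.2 • b z.1 z.2) (cylinder n T)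
  aemeasurable_dual : ∀ ψ, AEMeasurable (fun t => v t ψ) (volume.restrict (Ioo 0 T))
  memLp_bound : MemLp N 2 (volume.restrict (Ioo 0 T))
  abs_le : ∀ᵐ t ∂(volume.restrict (Ioo 0 T)), ∀ ψ, |v t ψ| ≤ N t * h1Norm ψ
  weakTimeDeriv : IsWeakTimeDeriv T u v
  weak_eq : ∀ χ : ℝ → ℝ, ContDiff ℝ ∞ χ → (∃ τ < T, ∀ t, τ ≤ t → χ t = 0) → ∀ ψ : smoothFun n,
    ∫ t in Ioo 0 T, deriv χ t * ∫ x, u t x * (ψ : Torus n → ℝ) x =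
      -(∫ t in Ioo 0 T, χ t * fluxPairing (fun x => u t x • b t x - G t x) ψ) - χ 0 * c ψ

/-- Only products χ(t) ψ(x) are kept as test functions; they suffice for finite-rank averages. -/
lemma IsSolution.exists_isWeakSolution {T : ℝ} {b : ℝ → Torus n → EuclideanSpace ℝ (Fin n)}
    {ρ₀ : Torus n → ℝ} {ρ : ℝ → Torus n → ℝ} (h : IsSolution T b ρ₀ ρ) :
    ∃ G v N, IsWeakSolution T b (fun ψ => ∫ x, ρ₀ x * (ψ : Torus n → ℝ) x) ρ G v N := by
  obtain ⟨⟨-, v, ⟨hv, N, hN, hvN⟩, hvd⟩, hd, G, ⟨hρ, hG, hgrad⟩, hw⟩ := h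
  refine ⟨G, v, N, hρ, hG, hgrad, hd, hv, hN, hvN, hvd, fun χ hχ hχτ ψ => ?_⟩
  have hφ : IsTestFun T (fun t x => χ t * (ψ : Torus n → ℝ) x) := by
    obtain ⟨τ, hτ, h0⟩ := hχτ
    refine ⟨?_, τ, hτ, fun t ht x => by simp [h0 t ht]⟩
    exact (hχ.comp contDiff_fst).mul ((smoothFun.contDiff ψ).comp contDiff_snd)
  have h1 := hw _ hφ
  have hχd : Continuous (deriv χ) := hχ.continuous_deriv (by simp)
  have d1 : ∀ (t : ℝ) (x : Torus n),
      deriv (fun s => χ s * (ψ : Torus n → ℝ) x) t = deriv χ t * (ψ : Torus n → ℝ) x := fun t x =>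
    deriv_mul_const (hχ.differentiable (by simp) t) _
  have d2 : ∀ (t : ℝ) (i : Fin n) (x : Torus n),
      partialDeriv i (fun x => χ t * (ψ : Torus n → ℝ) x) x =
        χ t * partialDeriv i (ψ : Torus n → ℝ) x := fun t i x =>
    ((smoothFun.hasDerivAt_line_zero ψ i x).const_mul (χ t)).deriv
  simp only [d1, d2] at h1
  have hGi := hG.integrable (by norm_num)
  have hρi : Integrable (fun z : ℝ × Torus n => ρ z.1 z.2 * (ψ : Torus n → ℝ) z.2)
      (cylinder n T) :=
    integrable_mul_space (hρ.integrable (by norm_num)) (smoothFun.continuous ψ)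
  have e1 := integral_cylinder_time_mul hρi hχd
  have e4 := integral_cylinder_time_mul (integrable_flux_cylinder (hd.sub hGi) ψ) hχ.continuous
  have e5 : ∫ z, χ z.1 * ∑ i, (ρ z.1 z.2 • b z.1 z.2 - G z.1 z.2) i *
      partialDeriv i (ψ : Torus n → ℝ) z.2 ∂(cylinder n T) =
      (∫ z, χ z.1 * ∑ i, (ρ z.1 z.2 • b z.1 z.2) i *
        partialDeriv i (ψ : Torus n → ℝ) z.2 ∂(cylinder n T)) -
      ∫ z, χ z.1 * ∑ i, (G z.1 z.2) i *
        partialDeriv i (ψ : Torus n → ℝ) z.2 ∂(cylinder n T) := by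
    refine Eq.trans ?_ (integral_sub (integrable_time_mul (integrable_flux_cylinder hd ψ)
      hχ.continuous) (integrable_time_mul (integrable_flux_cylinder hGi ψ) hχ.continuous))
    congr 1; ext z
    rw [← mul_sub, ← Finset.sum_sub_distrib]
    simp only [PiLp.sub_apply, sub_mul]
  have f1 : ∫ z, ρ z.1 z.2 * (deriv χ z.1 * (ψ : Torus n → ℝ) z.2) ∂(cylinder n T) =
      ∫ z, deriv χ z.1 * (ρ z.1 z.2 * (ψ : Torus n → ℝ) z.2) ∂(cylinder n T) := by
    congr 1; ext z; ring
  have f2 : ∫ z, ∑ i, G z.1 z.2 i * (χ z.1 * partialDeriv i (ψ : Torus n → ℝ) z.2)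
      ∂(cylinder n T) = ∫ z, χ z.1 * ∑ i, (G z.1 z.2) i *
        partialDeriv i (ψ : Torus n → ℝ) z.2 ∂(cylinder n T) := by
    congr 1; ext z
    rw [Finset.mul_sum]
    exact Finset.sum_congr rfl fun i _ => by ring
  have f3 : ∫ z, ρ z.1 z.2 * ∑ i, b z.1 z.2 i * (χ z.1 * partialDeriv i (ψ : Torus n → ℝ) z.2)
      ∂(cylinder n T) = ∫ z, χ z.1 * ∑ i, (ρ z.1 z.2 • b z.1 z.2) i *
        partialDeriv i (ψ : Torus n → ℝ) z.2 ∂(cylinder n T) := by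
    congr 1; ext z
    simp only [Finset.mul_sum, PiLp.smul_apply, smul_eq_mul]
    exact Finset.sum_congr rfl fun i _ => by ring
  have f4 : ∫ x, ρ₀ x * (χ 0 * (ψ : Torus n → ℝ) x) = χ 0 * ∫ x, ρ₀ x * (ψ : Torus n → ℝ) x := by
    rw [← integral_const_mul]
    congr 1; ext x; ring
  rw [f1, f2, f3, f4] at h1
  have e4' : ∫ z, χ z.1 * ∑ i, (ρ z.1 z.2 • b z.1 z.2 - G z.1 z.2) i *
      partialDeriv i (ψ : Torus n → ℝ) z.2 ∂(cylinder n T) =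
      ∫ t in Ioo 0 T, χ t * fluxPairing (fun x => ρ t x • b t x - G t x) ψ := e4
  rw [← e1, ← e4', e5]
  linarith

namespace IsWeakSolution

variable {T : ℝ} {b : ℝ → Torus n → EuclideanSpace ℝ (Fin n)} {c c' : smoothFun n → ℝ}
  {u u' : ℝ → Torus n → ℝ} {G G' : ℝ → Torus n → EuclideanSpace ℝ (Fin n)}
  {v v' : ℝ → smoothFun n →ₗ[ℝ] ℝ} {N N' : ℝ → ℝ}

lemma integrable_flux (h : IsWeakSolution T b c u G v N) :
    Integrable (fun z : ℝ × Torus n => u z.1 z.2 • b z.1 z.2 - G z.1 z.2) (cylinder n T) :=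
  h.integrable_drift.sub (h.memLp_grad.integrable (by norm_num))

lemma integrable_flux_slice (h : IsWeakSolution T b c u G v N) :
    ∀ᵐ t ∂(volume.restrict (Ioo 0 T)), Integrable fun x => u t x • b t x - G t x :=
  h.integrable_flux.prod_right_ae

lemma integrableOn_fluxPairing (h : IsWeakSolution T b c u G v N) (ψ : smoothFun n) :
    IntegrableOn (fun t => fluxPairing (fun x => u t x • b t x - G t x) ψ) (Ioo 0 T) :=
  (integrable_flux_cylinder h.integrable_flux ψ).integral_prod_left

lemma integrableOn_moment (h : IsWeakSolution T b c u G v N) (ψ : smoothFun n) :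
    IntegrableOn (fun t => ∫ x, u t x * (ψ : Torus n → ℝ) x) (Ioo 0 T) :=
  (integrable_mul_space (h.memLp.integrable (by norm_num))
    (smoothFun.continuous ψ)).integral_prod_left

lemma integrableOn_dual (h : IsWeakSolution T b c u G v N) (ψ : smoothFun n) :
    IntegrableOn (fun t => v t ψ) (Ioo 0 T) := by
  refine ((h.memLp_bound.integrable (by norm_num)).mul_const (h1Norm ψ)).mono'
    (h.aemeasurable_dual ψ).aestronglyMeasurable ?_
  filter_upwards [h.abs_le] with t ht
  exact ht ψ

lemma sub (h : IsWeakSolution T b c u G v N) (h' : IsWeakSolution T b c' u' G' v' N') :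
    IsWeakSolution T b (fun ψ => c ψ - c' ψ) (fun t x => u t x - u' t x)
      (fun t x => G t x - G' t x) (fun t => v t - v' t) (fun t => N t + N' t) where
  memLp := h.memLp.sub h'.memLp
  memLp_grad := h.memLp_grad.sub h'.memLp_grad
  weakGradient := by
    filter_upwards [h.weakGradient, h'.weakGradient, memLp_two_slice h.memLp,
      memLp_two_slice h'.memLp, memLp_two_slice h.memLp_grad, memLp_two_slice h'.memLp_grad]
      with t h1 h2 m1 m2 g1 g2 ψ i
    simp only [sub_mul, PiLp.sub_apply]
    have hψ := smoothFun.memLp ψ 2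
    have hψi := smoothFun.memLp_partialDeriv ψ i 2
    have e1 := integral_sub (m1.integrable_mul hψi) (m2.integrable_mul hψi)
    have e2 := integral_sub ((memLp_coord g1 i).integrable_mul hψ)
      ((memLp_coord g2 i).integrable_mul hψ)
    simp only [Pi.mul_apply] at e1 e2
    rw [e1, e2, h1, h2]
    ring
  integrable_drift := by
    simp only [sub_smul]
    exact h.integrable_drift.sub h'.integrable_drift
  aemeasurable_dual ψ := (h.aemeasurable_dual ψ).sub (h'.aemeasurable_dual ψ)
  memLp_bound := h.memLp_bound.add h'.memLp_bound
  abs_le := by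
    filter_upwards [h.abs_le, h'.abs_le] with t h1 h2 ψ
    rw [add_mul]
    exact (abs_sub _ _).trans (add_le_add (h1 ψ) (h2 ψ))
  weakTimeDeriv θ hθ hc hs ψ := by
    have hm : ∀ᵐ t ∂(volume.restrict (Ioo 0 T)),
        ∫ x, (u t x - u' t x) * (ψ : Torus n → ℝ) x =
          (∫ x, u t x * (ψ : Torus n → ℝ) x) - ∫ x, u' t x * (ψ : Torus n → ℝ) x := by
      filter_upwards [memLp_two_slice h.memLp, memLp_two_slice h'.memLp] with t m1 m2
      simp only [sub_mul]
      exact integral_sub (m1.integrable_mul (smoothFun.memLp ψ 2))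
        (m2.integrable_mul (smoothFun.memLp ψ 2))
    have hθd : Continuous (deriv θ) := hθ.continuous_deriv (by simp)
    rw [integral_congr_ae (hm.mono fun t ht => congrArg (deriv θ t * ·) ht)]
    simp only [LinearMap.sub_apply, mul_sub]
    rw [integral_sub (integrableOn_time_mul (h.integrableOn_moment ψ) hθd)
      (integrableOn_time_mul (h'.integrableOn_moment ψ) hθd),
      integral_sub (integrableOn_time_mul (h.integrableOn_dual ψ) hθ.continuous)
      (integrableOn_time_mul (h'.integrableOn_dual ψ) hθ.continuous),
      h.weakTimeDeriv θ hθ hc hs ψ, h'.weakTimeDeriv θ hθ hc hs ψ]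
    ring
  weak_eq χ hχ hχτ ψ := by
    have hm : ∀ᵐ t ∂(volume.restrict (Ioo 0 T)),
        ∫ x, (u t x - u' t x) * (ψ : Torus n → ℝ) x =
          (∫ x, u t x * (ψ : Torus n → ℝ) x) - ∫ x, u' t x * (ψ : Torus n → ℝ) x := by
      filter_upwards [memLp_two_slice h.memLp, memLp_two_slice h'.memLp] with t m1 m2
      simp only [sub_mul]
      exact integral_sub (m1.integrable_mul (smoothFun.memLp ψ 2))
        (m2.integrable_mul (smoothFun.memLp ψ 2))
    have hf : ∀ᵐ t ∂(volume.restrict (Ioo 0 T)),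
        fluxPairing (fun x => (u t x - u' t x) • b t x - (G t x - G' t x)) ψ =
          fluxPairing (fun x => u t x • b t x - G t x) ψ -
            fluxPairing (fun x => u' t x • b t x - G' t x) ψ := by
      filter_upwards [h.integrable_flux_slice, h'.integrable_flux_slice] with t m1 m2
      rw [← fluxPairing_sub m1 m2]
      congr 1; ext1 x
      rw [sub_smul]; abel
    have hχd : Continuous (deriv χ) := hχ.continuous_deriv (by simp)
    rw [integral_congr_ae (hm.mono fun t ht => congrArg (deriv χ t * ·) ht),
      integral_congr_ae (hf.mono fun t ht => congrArg (χ t * ·) ht)]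
    simp only [mul_sub]
    rw [integral_sub (integrableOn_time_mul (h.integrableOn_moment ψ) hχd)
      (integrableOn_time_mul (h'.integrableOn_moment ψ) hχd),
      integral_sub (integrableOn_time_mul (h.integrableOn_fluxPairing ψ) hχ.continuous)
      (integrableOn_time_mul (h'.integrableOn_fluxPairing ψ) hχ.continuous),
      h.weak_eq χ hχ hχτ ψ, h'.weak_eq χ hχ hχτ ψ]
    ring

lemma moment_eq (hT : 0 < T) (h : IsWeakSolution T b (fun _ => 0) u G v N) (ψ : smoothFun n) :
    ∀ᵐ t ∂(volume.restrict (Ioo 0 T)), ∫ x, u t x * (ψ : Torus n → ℝ) x =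
      ∫ s in (0 : ℝ)..t, (Ioo 0 T).indicator
        (fun s => fluxPairing (fun x => u s x • b s x - G s x) ψ) s := by
  refine ae_eq_primitive hT (h.integrableOn_moment ψ)
    ((integrable_indicator_iff measurableSet_Ioo).2 (h.integrableOn_fluxPairing ψ))
    fun χ hχ hχτ => ?_
  rw [h.weak_eq χ hχ hχτ ψ, mul_zero, sub_zero]
  congr 1
  exact setIntegral_congr_fun measurableSet_Ioo fun t ht => by simp only [indicator_of_mem ht]

/-- The weak time derivative and the weak equation agree on compactly supported functions of time.
The exceptional null set depends on ψ, so the identity may be used for countably many ψ at once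
only. -/
lemma dual_eq (h : IsWeakSolution T b (fun _ => 0) u G v N) (ψ : smoothFun n) :
    ∀ᵐ t ∂(volume.restrict (Ioo 0 T)),
      v t ψ = fluxPairing (fun x => u t x • b t x - G t x) ψ := by
  refine ae_eq_of_forall_integral_mul_eq (h.integrableOn_dual ψ) (h.integrableOn_fluxPairing ψ)
    fun θ hθ hc hs => ?_
  have h1 := h.weakTimeDeriv θ hθ hc hs ψ
  have h2 := h.weak_eq θ hθ (exists_forall_ge_eq_zero hc hs) ψ
  linarith

end IsWeakSolution

/-- Integrability in time of the Grönwall coefficient: as p ≤ r, a p-th power is at most the r-th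
power plus one. -/
lemma integrableOn_rpow_eLpNorm {T : ℝ} {r q : ℝ≥0∞} {p : ℝ} {g : ℝ → Torus n → ℝ}
    (hq : q ≠ 0) (hr : r ≠ ⊤) (hp : 0 < p) (hpr : ENNReal.ofReal p ≤ r) (hg : MemMixedLp r q T g)
    {C : ℝ≥0∞} (hC : C ≠ ⊤) :
    IntegrableOn (fun t => (C * (eLpNorm (g t) q volume ^ p + 1)).toReal) (Ioo 0 T) := by
  have hm : AEMeasurable (fun t => eLpNorm (g t) q volume) (volume.restrict (Ioo 0 T)) :=
    aemeasurable_eLpNorm hq hg.1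
  refine integrable_toReal_of_lintegral_ne_top (((hm.pow_const p).add_const 1).const_mul C) ?_
  have hr0 : r ≠ 0 := fun h => by
    rw [h, nonpos_iff_eq_zero, ENNReal.ofReal_eq_zero] at hpr
    linarith
  have hpr' : p ≤ r.toReal := (ENNReal.ofReal_le_iff_le_toReal hr).1 hpr
  have h1 := (eLpNorm_lt_top_iff_lintegral_rpow_enorm_lt_top hr0 hr).1 hg.2
  simp only [enorm_eq_self] at h1
  have h2 : ∀ E : ℝ≥0∞, E ^ p ≤ E ^ r.toReal + 1 := fun E => by
    rcases le_total E 1 with h | h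
    · exact (ENNReal.rpow_le_one h hp.le).trans le_add_self
    · exact (ENNReal.rpow_le_rpow_of_exponent_le h hpr').trans le_self_add
  rw [lintegral_const_mul' _ _ hC]
  refine ENNReal.mul_ne_top hC (ne_top_of_le_ne_top ?_
    (lintegral_mono fun t => add_le_add (h2 (eLpNorm (g t) q volume)) le_rfl))
  simp only [add_assoc]
  rw [lintegral_add_right' _ aemeasurable_const]
  exact ENNReal.add_ne_top.2 ⟨h1.ne, by simp [ENNReal.mul_eq_top]⟩

lemma MemMixedLp.ae_memLp {T : ℝ} {r q : ℝ≥0∞} {E : Type*} [NormedAddCommGroup E]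
    {g : ℝ → Torus n → E} (hq : q ≠ 0) (hr0 : r ≠ 0) (hr : r ≠ ⊤) (hg : MemMixedLp r q T g) :
    ∀ᵐ t ∂(volume.restrict (Ioo 0 T)), MemLp (g t) q volume := by
  have hm : AEMeasurable (fun t => eLpNorm (g t) q volume) (volume.restrict (Ioo 0 T)) :=
    aemeasurable_eLpNorm hq hg.1
  have h1 := (eLpNorm_lt_top_iff_lintegral_rpow_enorm_lt_top hr0 hr).1 hg.2
  simp only [enorm_eq_self] at h1
  filter_upwards [ae_lt_top' (hm.pow_const _) h1.ne, hg.1.prodMk_left] with t ht hm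
  refine ⟨hm, lt_top_iff_ne_top.2 fun h => ht.ne ?_⟩
  rw [h, ENNReal.top_rpow_of_pos (ENNReal.toReal_pos hr0 hr)]

lemma integrable_sq_slices {T : ℝ} {f : ℝ × Torus n → ℝ} (hf : MemLp f 2 (cylinder n T)) :
    IntegrableOn (fun t => ∫ x, f (t, x) ^ 2) (Ioo 0 T) :=
  Integrable.integral_prod_left (μ := volume.restrict (Ioo 0 T)) hf.integrable_sq

lemma fluxPairing_eq {u : Torus n → ℝ} {b G : Torus n → EuclideanSpace ℝ (Fin n)}
    (h : Integrable fun x => u x • b x) (hG : Integrable G) (ψ : smoothFun n) :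
    fluxPairing (fun x => u x • b x - G x) ψ =
      -(∫ x, ∑ i, G x i * partialDeriv i (ψ : Torus n → ℝ) x) +
        ∫ x, u x * ∑ i, b x i * partialDeriv i (ψ : Torus n → ℝ) x := by
  rw [fluxPairing_sub h hG, sub_eq_neg_add]
  simp only [fluxPairing, PiLp.smul_apply, smul_eq_mul, Finset.mul_sum, mul_assoc]

/-! ### The entropy inequality and the vanishing of the difference. -/

namespace IsWeakSolution

variable {T : ℝ} {b : ℝ → Torus n → EuclideanSpace ℝ (Fin n)} {u : ℝ → Torus n → ℝ}
  {G : ℝ → Torus n → EuclideanSpace ℝ (Fin n)} {v : ℝ → smoothFun n →ₗ[ℝ] ℝ} {N : ℝ → ℝ}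

/-- The entropy identity for a regularized solution. -/
lemma entropy_avg_eq (hT : 0 < T) (h : IsWeakSolution T b (fun _ => 0) u G v N)
    (K : SmoothingKernel n) :
    Integrable ((Ioo 0 T).indicator
      fun s => fluxPairing (fun x => u s x • b s x - G s x) (testFun K (u s))) ∧
    ∀ᵐ t ∂(volume.restrict (Ioo 0 T)), ∫ x, entropy ((K.avg (u t) : Torus n → ℝ) x) =
      ∫ s in (0 : ℝ)..t, (Ioo 0 T).indicator
        (fun s => fluxPairing (fun x => u s x • b s x - G s x) (testFun K (u s))) s := by
  set F : K.J → ℝ → ℝ := fun j => (Ioo 0 T).indicator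
    fun s => fluxPairing (fun x => u s x • b s x - G s x) (K.ψ j) with hFd
  have hF : ∀ j, Integrable (F j) := fun j =>
    (integrable_indicator_iff measurableSet_Ioo).2 (h.integrableOn_fluxPairing (K.ψ j))
  have hmom : ∀ᵐ t ∂(volume.restrict (Ioo 0 T)), ∀ x,
      ∑ j, (∫ s in (0 : ℝ)..t, F j s) * (K.φ j : Torus n → ℝ) x =
        (K.avg (u t) : Torus n → ℝ) x := by
    filter_upwards [ae_all_iff.2 fun j => h.moment_eq hT (K.ψ j)] with t ht x
    rw [SmoothingKernel.avg_apply_sum]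
    exact Finset.sum_congr rfl fun j _ => by rw [ht j]
  -- The sum given by the chain rule is the pairing with the doubly averaged test function, expanded
  -- in the `K.ψ j` by `SmoothingKernel.avg_eq_sum'`.
  have hΨ : (fun s => ∑ j, F j s * ∫ x, entropyDeriv (∑ i, (∫ r in (0 : ℝ)..s, F i r) *
      (K.φ i : Torus n → ℝ) x) * (K.φ j : Torus n → ℝ) x) =ᵐ[volume] (Ioo 0 T).indicator
        fun s => fluxPairing (fun x => u s x • b s x - G s x) (testFun K (u s)) := by
    filter_upwards [(ae_restrict_iff' measurableSet_Ioo).1 hmom,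
      (ae_restrict_iff' measurableSet_Ioo).1 h.integrable_flux_slice] with s hs hsi
    by_cases hm : s ∈ Ioo 0 T
    · rw [indicator_of_mem hm, testFun,
        SmoothingKernel.avg_eq_sum' K (integrable_of_continuous (smoothFun.continuous _)),
        fluxPairing_sum (hsi hm)]
      simp only [hs hm]
      simp only [hFd, indicator_of_mem hm]
      exact Finset.sum_congr rfl fun j _ => mul_comm _ _
    · simp only [hFd, indicator_of_notMem hm, zero_mul, Finset.sum_const_zero]
  refine ⟨((integral_entropy_eq hF K.φ le_rfl).1).congr hΨ, ?_⟩
  filter_upwards [hmom, ae_restrict_mem measurableSet_Ioo] with t ht htm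
  rw [← intervalIntegral.integral_congr_ae (hΨ.mono fun s hs _ => hs),
    ← (integral_entropy_eq hF K.φ htm.1.le).2]
  simp only [ht]

lemma integrableOn_bound (h : IsWeakSolution T b (fun _ => 0) u G v N) :
    IntegrableOn (fun t => |N t| * √((∫ x, u t x ^ 2) + ∑ i, ∫ x, G t x i ^ 2)) (Ioo 0 T) := by
  have h1 : IntegrableOn (fun t => (∫ x, u t x ^ 2) + ∑ i, ∫ x, G t x i ^ 2) (Ioo 0 T) :=
    (integrable_sq_slices h.memLp).add
      (integrable_finsetSum _ fun i _ => integrable_sq_slices (memLp_coord h.memLp_grad i))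
  refine h.memLp_bound.abs.integrable_mul ((memLp_two_iff_integrable_sq
    (Real.continuous_sqrt.comp_aestronglyMeasurable h1.1)).2 ?_)
  refine h1.congr (.of_forall fun t => (Real.sq_sqrt ?_).symm)
  exact add_nonneg (integral_nonneg fun x => sq_nonneg _)
    (Finset.sum_nonneg fun i _ => integral_nonneg fun x => sq_nonneg _)

/-- The bound goes through ∂ₜu: b is only `L¹` in time, and the flux alone gives no uniform bound.
The test function varies with t but stays in the span of the finitely many `K.ψ j`, where `dual_eq`
holds off a single null set. -/
lemma abs_fluxPairing_testFun_le (h : IsWeakSolution T b (fun _ => 0) u G v N)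
    (K : SmoothingKernel n) : ∀ᵐ t ∂(volume.restrict (Ioo 0 T)),
      |fluxPairing (fun x => u t x • b t x - G t x) (testFun K (u t))| ≤
        |N t| * √((∫ x, u t x ^ 2) + ∑ i, ∫ x, G t x i ^ 2) := by
  filter_upwards [ae_all_iff.2 fun j => h.dual_eq (K.ψ j), h.abs_le, memLp_two_slice h.memLp,
    memLp_two_slice h.memLp_grad, h.weakGradient, h.integrable_flux_slice] with t h1 h2 h3 h4 h5 h6
  have e : fluxPairing (fun x => u t x • b t x - G t x) (testFun K (u t)) =
      v t (testFun K (u t)) := by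
    rw [testFun, SmoothingKernel.avg_eq_sum' K (integrable_of_continuous (smoothFun.continuous _)),
      fluxPairing_sum h6, map_sum]
    exact Finset.sum_congr rfl fun j _ => by rw [map_smul, smul_eq_mul, h1 j]
  rw [e]
  exact (h2 _).trans (mul_le_mul (le_abs_self _)
    (h1Norm_testFun_le K h3 (fun i => memLp_coord h4 i) h5) (Real.sqrt_nonneg _) (abs_nonneg _))

lemma ae_eq_zero (hT : 0 < T) {r q : ℝ≥0∞} (hrq : AdmissibleExponents n r q)
    (hb : MemMixedLp 1 2 T b) {divb : ℝ → Torus n → ℝ}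
    (hdiv : ∀ᵐ t ∂(volume.restrict (Ioo 0 T)), IsWeakDivergence (b t) (divb t))
    (hdivb : MemMixedLp r q T divb) (h : IsWeakSolution T b (fun _ => 0) u G v N) :
    ∀ᵐ t ∂(volume.restrict (Ioo 0 T)), u t =ᵐ[volume] 0 := by
  obtain ⟨hq, θ, hθ0, hθ1, hθr, C, hC⟩ := hrq.exists_hasGN
  obtain ⟨C', hC'⟩ := hC.hasFormBound hθ0 hθ1
  have hq0 : q ≠ 0 := (zero_lt_one.trans_le hq).ne'
  have hrt : r ≠ ⊤ := by
    rcases hrq.2 with h1 | h1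
    · exact h1.2.2.1.ne
    · exact (h1.2.2.1.trans_lt (by simp)).ne
  have hr0 : r ≠ 0 := by
    rcases hrq.2 with h1 | h1 <;> exact (zero_lt_one.trans_le h1.2.1).ne'
  have hp : 0 < 1 / (1 - θ) := by
    have : 0 < 1 - θ := by linarith
    positivity
  set D : ℕ → ℝ → ℝ := fun m => (Ioo 0 T).indicator fun s =>
    fluxPairing (fun x => u s x • b s x - G s x) (testFun (peakKernel m) (u s)) with hD
  set κ : ℝ → ℝ := (Ioo 0 T).indicator fun t =>
    (C' * (eLpNorm (divb t) q volume ^ (1 / (1 - θ)) + 1)).toReal with hκd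
  have hκ : Integrable κ := (integrable_indicator_iff measurableSet_Ioo).2
    (integrableOn_rpow_eLpNorm hq0 hrt hp hθr hdivb hC'.1)
  have hκ0 : ∀ t, 0 ≤ κ t := indicator_nonneg fun t _ => ENNReal.toReal_nonneg
  set z : ℝ → ℝ := fun t => ∫ x, Real.arctan (u t x) ^ 2 with hz
  have hz0 : ∀ t, 0 ≤ z t := fun t => integral_nonneg fun x => sq_nonneg _
  have hlim : ∀ᵐ t, ∃ A : ℝ, Filter.Tendsto (fun m => D m t) Filter.atTop (nhds A) ∧
      2 * A ≤ κ t * z t := by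
    filter_upwards [(ae_restrict_iff' measurableSet_Ioo).1 hdiv,
      (ae_restrict_iff' measurableSet_Ioo).1 (hb.ae_memLp two_ne_zero one_ne_zero (by simp)),
      (ae_restrict_iff' measurableSet_Ioo).1 (hdivb.ae_memLp hq0 hr0 hrt),
      (ae_restrict_iff' measurableSet_Ioo).1 (memLp_two_slice h.memLp),
      (ae_restrict_iff' measurableSet_Ioo).1 (memLp_two_slice h.memLp_grad),
      (ae_restrict_iff' measurableSet_Ioo).1 h.weakGradient,
      (ae_restrict_iff' measurableSet_Ioo).1 h.integrable_drift.prod_right_ae]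
      with t h1 h2 h3 h4 h5 h6 h7
    by_cases ht : t ∈ Ioo 0 T
    · obtain ⟨A, hA, hA2⟩ := exists_limit_le hC hθ0 hθ1 hC'
        (H1Lim.avg (h4 ht) (fun i => memLp_coord (h5 ht) i) (h6 ht))
        ((h3 ht).integrable hq) (h3 ht).2.ne (fun i => memLp_coord (h2 ht) i) (h1 ht)
      refine ⟨A, ?_, ?_⟩
      · simp only [hD, indicator_of_mem ht]
        simpa only [fluxPairing_eq (h7 ht) ((h5 ht).integrable (by norm_num))] using hA
      · simpa only [hκd, indicator_of_mem ht] using hA2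
    · exact ⟨0, by simp [hD, indicator_of_notMem ht], by simp [hκd, indicator_of_notMem ht]⟩
  -- Choosing the limit by `limUnder` gives one function of time; it is measurable as an almost
  -- everywhere limit.
  set A : ℝ → ℝ := fun t => Filter.limUnder Filter.atTop fun m => D m t
  have hA : ∀ᵐ t, Filter.Tendsto (fun m => D m t) Filter.atTop (nhds (A t)) ∧
      2 * A t ≤ κ t * z t := by
    filter_upwards [hlim] with t ht
    obtain ⟨a, ha, ha2⟩ := ht
    have : A t = a := ha.limUnder_eq
    exact this ▸ ⟨ha, ha2⟩
  set B : ℝ → ℝ := (Ioo 0 T).indicator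
    fun t => |N t| * √((∫ x, u t x ^ 2) + ∑ i, ∫ x, G t x i ^ 2)
  have hB : Integrable B := (integrable_indicator_iff measurableSet_Ioo).2 h.integrableOn_bound
  have hDB : ∀ m, ∀ᵐ t, ‖D m t‖ ≤ B t := by
    intro m
    filter_upwards [(ae_restrict_iff' measurableSet_Ioo).1
      (h.abs_fluxPairing_testFun_le (peakKernel m))] with t ht
    by_cases htm : t ∈ Ioo 0 T
    · simpa only [hD, B, indicator_of_mem htm, Real.norm_eq_abs] using ht htm
    · simp only [hD, B, indicator_of_notMem htm, norm_zero, le_refl]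
  have hDi : ∀ m, Integrable (D m) := fun m => (h.entropy_avg_eq hT (peakKernel m)).1
  have hAi : Integrable A := by
    refine hB.mono' (aestronglyMeasurable_of_tendsto_ae _ (fun m => (hDi m).1)
      (hA.mono fun t ht => ht.1)) ?_
    filter_upwards [hA, ae_all_iff.2 hDB] with t h1 h2
    exact le_of_tendsto' h1.1.norm h2
  have hzm : AEStronglyMeasurable z (volume.restrict (Ioo 0 T)) := by
    refine AEStronglyMeasurable.integral_prod_right' (f := fun p : ℝ × Torus n =>
      Real.arctan (u p.1 p.2) ^ 2) ?_
    exact (Real.continuous_arctan.pow 2).comp_aestronglyMeasurable h.memLp.1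
  have hκz : Integrable fun t => κ t * z t := by
    have h1 : IntegrableOn (fun t => κ t * z t) (Ioo 0 T) := by
      refine Integrable.mul_bdd (c := 4) hκ.integrableOn hzm (.of_forall fun t => ?_)
      refine (norm_integral_le_of_norm_le_const (C := 4) (.of_forall fun x => ?_)).trans (by simp)
      rw [Real.norm_of_nonneg (sq_nonneg _), ← sq_abs]
      nlinarith [abs_arctan_le_two (u t x), abs_nonneg (Real.arctan (u t x))]
    refine ((integrable_indicator_iff measurableSet_Ioo).2 h1).congr (.of_forall fun t => ?_)
    by_cases ht : t ∈ Ioo 0 T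
    · simp only [indicator_of_mem ht]
    · simp only [hκd, indicator_of_notMem ht, zero_mul]
  have hzle : ∀ᵐ t ∂(volume.restrict (Ioo 0 T)), z t ≤ ∫ s in (0 : ℝ)..t, κ s * z s := by
    filter_upwards [ae_all_iff.2 fun m => (h.entropy_avg_eq hT (peakKernel m)).2,
      memLp_two_slice h.memLp, ae_restrict_mem measurableSet_Ioo] with t h1 h2 ht
    have hE := (L2Lim.avg h2).comp_lipschitz
      (lipschitzWith_of_abs_deriv_le contDiff_entropy abs_deriv_entropy_le)
    have l1 := hE.tendsto_integral_mul (memLp_const (1 : ℝ))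
    simp only [one_mul, h1] at l1
    -- Dominated convergence in time; the dominating function B is a product of two
    -- square-integrable functions of time.
    have l2 : Filter.Tendsto (fun m => ∫ s in (0 : ℝ)..t, D m s) Filter.atTop
        (nhds (∫ s in (0 : ℝ)..t, A s)) :=
      intervalIntegral.tendsto_integral_filter_of_dominated_convergence B
        (.of_forall fun m => (hDi m).1.restrict)
        (.of_forall fun m => (hDB m).mono fun s hs _ => hs) hB.intervalIntegrable
        (hA.mono fun s hs _ => hs.1)
    have h3 := tendsto_nhds_unique l1 l2
    have h4 : z t ≤ 2 * ∫ x, entropy (u t x) := by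
      rw [← integral_const_mul]
      refine integral_mono_of_nonneg (.of_forall fun x => sq_nonneg _)
        ((hE.2.integrable (by norm_num)).const_mul 2) (.of_forall fun x => sq_arctan_le _)
    refine h4.trans ?_
    rw [h3, ← intervalIntegral.integral_const_mul]
    exact intervalIntegral.integral_mono_ae ht.1.le (hAi.const_mul 2).intervalIntegrable
      hκz.intervalIntegrable (hA.mono fun s hs => hs.2)
  filter_upwards [ae_eq_zero_of_le_integral hκ hκ0 hz0 hκz hzle, memLp_two_slice h.memLp]
    with t ht hu
  have h1 : Integrable fun x => Real.arctan (u t x) ^ 2 := by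
    refine (hu.integrable_sq).mono'
      ((Real.continuous_arctan.pow 2).comp_aestronglyMeasurable hu.1) (.of_forall fun x => ?_)
    rw [Real.norm_of_nonneg (sq_nonneg _)]
    exact sq_le_sq.2 (abs_arctan_le _)
  filter_upwards [(integral_eq_zero_iff_of_nonneg (fun x => sq_nonneg _) h1).1 ht] with x hx
  simpa using hx

end IsWeakSolution

end

end FokkerPlanck

theorem mainTheorem12 (n : ℕ) (T : ℝ) (hT : 0 < T) (r q : ℝ≥0∞)
    (hrq : FokkerPlanck.AdmissibleExponents n r q)
    (b : ℝ → FokkerPlanck.Torus n → EuclideanSpace ℝ (Fin n))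
    (hb : FokkerPlanck.MemMixedLp 1 2 T b)
    (divb : ℝ → FokkerPlanck.Torus n → ℝ)
    (hdiv : ∀ᵐ t ∂(volume.restrict (Ioo 0 T)), FokkerPlanck.IsWeakDivergence (b t) (divb t))
    (hdivb : FokkerPlanck.MemMixedLp r q T divb)
    (ρ₀ : FokkerPlanck.Torus n → ℝ) (hρ₀ : MemLp ρ₀ 2 volume)
    (ρ₁ ρ₂ : ℝ → FokkerPlanck.Torus n → ℝ)
    (h₁ : FokkerPlanck.IsSolution T b ρ₀ ρ₁) (h₂ : FokkerPlanck.IsSolution T b ρ₀ ρ₂) :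
    uncurry ρ₁ =ᵐ[FokkerPlanck.cylinder n T] uncurry ρ₂ := by
  obtain ⟨G₁, v₁, N₁, w₁⟩ := h₁.exists_isWeakSolution
  obtain ⟨G₂, v₂, N₂, w₂⟩ := h₂.exists_isWeakSolution
  -- The two initial functionals cancel, leaving zero initial datum.
  have w := w₁.sub w₂
  simp only [sub_self] at w
  have h0 := w.ae_eq_zero hT hrq hb hdiv hdivb
  -- Passing from slices to the product needs a measurable set, hence the measurable representative
  -- of the difference.
  have h1 := (Measure.ae_prod_iff_ae_ae (measurableSet_eq_fun (f := w.memLp.1.mk _)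
    (g := fun _ => (0 : ℝ)) w.memLp.1.stronglyMeasurable_mk.measurable measurable_const)).2 (by
      filter_upwards [h0, Measure.ae_ae_of_ae_prod w.memLp.1.ae_eq_mk] with t ht ht2
      filter_upwards [ht, ht2] with x hx hx2
      exact hx2.symm.trans hx)
  filter_upwards [h1, w.memLp.1.ae_eq_mk] with p hp hp2
  exact sub_eq_zero.1 (hp2.trans hp)
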